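/- **Setting.** Let $d\ge 2$, let $\Omega\subset\mathbb R^d$ be a bounded convex polyhedral domain with boundary $\Gamma$, and let $\mathcal T_h$ be a finite collection of convex polytopes $K$ with nonempty, pairwise disjoint interiors and $\bigcup_{K\in\mathcal T_h} K=\overline\Omega$ (simplices, for instance). Let $\mathbf n$ denote the exterior unit normal on $\partial K$. An interior face is a set $e=\partial K^+\cap\partial K^-$ ($K^+\ne K^-$ in $\mathcal T_h$) of nonzero $(d-1)$-dimensional measure; $\varepsilon_h^o$ is the set of interior faces, and also their union; $\varepsilon_h^\partial$ stands for the boundary faces, whose union is $\Gamma$. Write $(v,w)_{\mathcal T_h}=\sum_K\int_K vw$, $\langle\zeta,\rho\rangle_{\partial\mathcal T_h}=\sum_K\int_{\partial K}\zeta\rho$, and $\langle\cdot,\cdot\rangle_{\partial\mathcal T_h\setminus\varepsilon_h^\partial}$, $\langle\cdot,\cdot\rangle_{\varepsilon_h^\partial}$ for the sums over $K$ of the integrals over $\partial K\setminus\Gamma$ and $\partial K\cap\Gamma$. For an integer $k\ge0$ let $$V_h=\{\mathbf v\in[L^2(\Omega)]^d:\mathbf v|_K\in[\mathcal P^k(K)]^d\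 \forall K\in\mathcal T_h\},\qquad W_h=\{w\in L^2(\Omega): w|_K\in\mathcal P^{k+1}(K)\ \forall K\in\mathcal T_h\},$$ $$\widetilde M_h(o)=\{\mu\in C^0(\varepsilon_h^o):\mu|_e\in\mathcal P^{k+1}(e)\ \text{for every interior face } e\}.$$ On $K$ and $\partial K$, elements of $V_h$, $W_h$ and their (elementwise) gradients and divergences are evaluated from inside $K$. Let $h>0$, $\gamma>0$, $f,y_d\in L^2(\Omega)$, $g\in C^0(\Gamma)$, let $\mathcal I_h:C^0(\Gamma)\to C^0(\Gamma)$ be any interpolation operator (no property of it is needed), and let $\boldsymbol\beta\in[W^{1,\infty}(\Omega)]^d$ (its representative that is continuous on $\overline\Omega$ is used) satisfy $\nabla\cdot\boldsymbol\beta\le0$ a.e. in $\Omega$. Let $\tau_1,\tau_2$ be real stabilization functions on $\partial\mathcal T_h$ (given separately on each $\partial K$), with $\tau_1$ integrable on every $\partial K$, such that, almost everywhere on $\partial K$ for every $K\in\mathcal T_h$, * (A1) $\tau_2=\tau_1-\boldsymbol\beta\cdot\mathbf n$, * (A2) $\tau_1-\tfrac12\boldsymbol\beta\cdot\mathbf n\ge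 c_K$ for some constant $c_K>0$. Define $$\begin{aligned}\mathscr B_1(\mathbf q,y,\widehat y;\mathbf r,w,\mu)={}&(\mathbf q,\mathbf r)_{\mathcal T_h}-(y,\nabla\cdot\mathbf r)_{\mathcal T_h}+\langle\widehat y,\mathbf r\cdot\mathbf n\rangle_{\partial\mathcal T_h\setminus\varepsilon_h^\partial}-(\mathbf q+\boldsymbol\beta y,\nabla w)_{\mathcal T_h}-((\nabla\cdot\boldsymbol\beta)y,w)_{\mathcal T_h}\\&+\langle\mathbf q\cdot\mathbf n+(h^{-1}+\tau_1)y,w\rangle_{\partial\mathcal T_h}+\langle(\boldsymbol\beta\cdot\mathbf n-h^{-1}-\tau_1)\widehat y,w\rangle_{\partial\mathcal T_h\setminus\varepsilon_h^\partial}\\&-\langle\mathbf q\cdot\mathbf n+\boldsymbol\beta\cdot\mathbf n\,\widehat y+(h^{-1}+\tau_1)(y-\widehat y),\mu\rangle_{\partial\mathcal T_h\setminus\varepsilon_h^\partial},\end{aligned}$$ $$\begin{aligned}\mathscr B_2(\mathbf p,z,\widehat z;\mathbf r,w,\mu)={}&(\mathbf p,\mathbf r)_{\mathcal T_h}-(z,\nabla\cdot\mathbf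 r)_{\mathcal T_h}+\langle\widehat z,\mathbf r\cdot\mathbf n\rangle_{\partial\mathcal T_h\setminus\varepsilon_h^\partial}-(\mathbf p-\boldsymbol\beta z,\nabla w)_{\mathcal T_h}\\&+\langle\mathbf p\cdot\mathbf n+(h^{-1}+\tau_2)z,w\rangle_{\partial\mathcal T_h}-\langle(\boldsymbol\beta\cdot\mathbf n+h^{-1}+\tau_2)\widehat z,w\rangle_{\partial\mathcal T_h\setminus\varepsilon_h^\partial}\\&-\langle\mathbf p\cdot\mathbf n-\boldsymbol\beta\cdot\mathbf n\,\widehat z+(h^{-1}+\tau_2)(z-\widehat z),\mu\rangle_{\partial\mathcal T_h\setminus\varepsilon_h^\partial}.\end{aligned}$$ **Proposition 3.3.** There exists exactly one $(\mathbf q_h,\mathbf p_h,y_h,z_h,u_h,\widehat y_h^o,\widehat z_h^o)\in V_h\times V_h\times W_h\times W_h\times W_h\times\widetilde M_h(o)\times\widetilde M_h(o)$ such that $$\begin{aligned}\mathscr B_1(\mathbf q_h,y_h,\widehat y_h^o;\mathbf r_1,w_1,\mu_1)&=(f+u_h,w_1)_{\mathcal T_h}-\langle\mathcal I_hg,(\boldsymbol\beta\cdot\mathbf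 n-\tau_1-h^{-1})w_1+\mathbf r_1\cdot\mathbf n\rangle_{\varepsilon_h^\partial},\\ \mathscr B_2(\mathbf p_h,z_h,\widehat z_h^o;\mathbf r_2,w_2,\mu_2)&=(y_h-y_d,w_2)_{\mathcal T_h},\\ (z_h+\gamma u_h,w_3)_{\mathcal T_h}&=0\end{aligned}$$ for all $(\mathbf r_1,\mathbf r_2,w_1,w_2,w_3,\mu_1,\mu_2)\in V_h\times V_h\times W_h\times W_h\times W_h\times\widetilde M_h(o)\times\widetilde M_h(o)$. -/

import Mathlib

open MeasureTheory

open scoped ENNReal ContDiff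

noncomputable section

namespace EDG

variable {d : ℕ}

/-- Euclidean space `ℝᵈ`. -/
abbrev Sp (d : ℕ) : Type := EuclideanSpace ℝ (Fin d)

/-! ### Domains, meshes, normals -/

/-- A convex polytope with nonempty interior (a compact set). -/
def IsConvexBody (K : Set (Sp d)) : Prop :=
  (∃ s : Finset (Sp d), K = convexHull ℝ (s : Set (Sp d))) ∧ (interior K).Nonempty

/-- A bounded convex polyhedral domain: the (nonempty) interior of a convex polytope. -/
def IsConvexPolyhedralDomain (Ω : Set (Sp d)) : Prop :=
  ∃ P : Set (Sp d), IsConvexBody P ∧ Ω = interior P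

/-- A finite collection of (closed) polytopal elements with pairwise disjoint interiors that
partitions the closure of `Ω`.  Neither simplices nor face-to-face contact is required. -/
structure IsMesh (Ω : Set (Sp d)) (T : Finset (Set (Sp d))) : Prop where
  polytope : ∀ K ∈ T, IsConvexBody K
  disjoint : ∀ K ∈ T, ∀ K' ∈ T, K ≠ K' → Disjoint (interior K) (interior K')
  cover : (⋃ K ∈ T, K) = closure Ω

/-- `(d-1)`-dimensional surface measure, normalised to agree with Lebesgue measure on
hyperplanes. -/
def surf (d : ℕ) : Measure (Sp d) := μHE[d - 1]

/-- `n` is an exterior unit normal of the convex set `K` at `x`. -/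
def IsUnitNormal (K : Set (Sp d)) (x n : Sp d) : Prop :=
  ‖n‖ = 1 ∧ ∀ y ∈ K, inner ℝ n (y - x) ≤ 0

open Classical in
/-- The exterior unit normal of a convex element `K` at `x ∈ ∂K`, wherever it is unique, that is,
off the set of lower-dimensional faces, which has surface measure zero (and where we put `0`). -/
def normal (K : Set (Sp d)) (x : Sp d) : Sp d :=
  if h : ∃! n : Sp d, IsUnitNormal K x n then h.choose else 0

/-- The set `ε_h^o` of interior faces: the sets `∂K⁺ ∩ ∂K⁻` of nonzero surface measure. -/
def interiorFaces (T : Finset (Set (Sp d))) : Set (Set (Sp d)) :=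
  {e | ∃ K ∈ T, ∃ K' ∈ T, K ≠ K' ∧ e = frontier K ∩ frontier K' ∧ surf d e ≠ 0}

/-- The union of the interior faces. -/
def skeleton (T : Finset (Set (Sp d))) : Set (Sp d) := ⋃₀ interiorFaces T

/-! ### Weak derivatives and `W^{1,∞}` -/

/-- `w` is the weak `j`-th partial derivative of `v` on the open set `Ω`. -/
def HasWeakPartial (Ω : Set (Sp d)) (j : Fin d) (v w : Sp d → ℝ) : Prop :=
  ∀ φ : Sp d → ℝ, ContDiff ℝ ∞ φ → HasCompactSupport φ → tsupport φ ⊆ Ω →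
    ∫ x in Ω, v x * fderiv ℝ φ x (EuclideanSpace.single j 1) = -∫ x in Ω, w x * φ x

/-- `w ∈ L^∞(Ω)` is the weak `j`-th partial derivative of `v` on `Ω`. -/
def IsBddWeakPartial (Ω : Set (Sp d)) (j : Fin d) (v w : Sp d → ℝ) : Prop :=
  MemLp w ∞ (volume.restrict Ω) ∧ HasWeakPartial Ω j v w

/-- `v ∈ W^{1,∞}(Ω)`. -/
def MemW1Inf (Ω : Set (Sp d)) (v : Sp d → ℝ) : Prop :=
  MemLp v ∞ (volume.restrict Ω) ∧ ∀ j, ∃ w, IsBddWeakPartial Ω j v w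

open Classical in
/-- The weak `j`-th partial derivative of `v ∈ W^{1,∞}(Ω)` (unique up to null sets). -/
def weakPartial (Ω : Set (Sp d)) (j : Fin d) (v : Sp d → ℝ) : Sp d → ℝ :=
  if h : ∃ w, IsBddWeakPartial Ω j v w then h.choose else 0

/-- The weak divergence `∇·β`. -/
def weakDiv (Ω : Set (Sp d)) (β : Sp d → Sp d) (x : Sp d) : ℝ :=
  ∑ j, weakPartial Ω j (fun x => β x j) x

/-! ### Finite element spaces -/

/-- Value of a polynomial in `d` variables at a point. -/
def ev (p : MvPolynomial (Fin d) ℝ) (x : Sp d) : ℝ := MvPolynomial.eval (fun i => x i) p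

/-- `L²(Ω)`. -/
abbrev L2 (Ω : Set (Sp d)) : Type := Lp ℝ 2 (volume.restrict Ω)

/-- `v ∈ L²(Ω)` coincides (almost everywhere) on `K` with the polynomial `p`. -/
def EqOnPoly (Ω K : Set (Sp d)) (v : L2 Ω) (p : MvPolynomial (Fin d) ℝ) : Prop :=
  ∀ᵐ x ∂(volume.restrict Ω), x ∈ K → v x = ev p x

/-- `{v ∈ L²(Ω) : v|_K ∈ P^m(K) for all K ∈ T}`. -/
def brokenPoly (Ω : Set (Sp d)) (T : Finset (Set (Sp d))) (m : ℕ) : Submodule ℝ (L2 Ω) where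
  carrier := {v | ∀ K ∈ T, ∃ p : MvPolynomial (Fin d) ℝ, p.totalDegree ≤ m ∧ EqOnPoly Ω K v p}
  zero_mem' := by
    intro K _
    refine ⟨0, by simp, ?_⟩
    filter_upwards [Lp.coeFn_zero ℝ 2 (volume.restrict Ω)] with x hx _
    exact hx.trans (by simp [ev])
  add_mem' := by
    intro a b ha hb K hK
    obtain ⟨p, hp, hpa⟩ := ha K hK
    obtain ⟨q, hq, hqb⟩ := hb K hK
    refine ⟨p + q, (MvPolynomial.totalDegree_add p q).trans (max_le hp hq), ?_⟩
    filter_upwards [Lp.coeFn_add a b, hpa, hqb] with x hx h1 h2 hxK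
    rw [hx, Pi.add_apply, h1 hxK, h2 hxK]
    simp [ev]
  smul_mem' := by
    intro c a ha K hK
    obtain ⟨p, hp, hpa⟩ := ha K hK
    refine ⟨c • p, (MvPolynomial.totalDegree_smul_le c p).trans hp, ?_⟩
    filter_upwards [Lp.coeFn_smul c a, hpa] with x hx h1 hxK
    rw [hx, Pi.smul_apply, h1 hxK]
    simp [ev, MvPolynomial.smul_eval]

/-- `V_h`: vector fields in `[L²(Ω)]ᵈ`, elementwise polynomial of degree at most `k`. -/
def Vh (Ω : Set (Sp d)) (T : Finset (Set (Sp d))) (k : ℕ) : Submodule ℝ (Fin d → L2 Ω) :=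
  Submodule.pi Set.univ fun _ => brokenPoly Ω T k

/-- `W_h`: functions in `L²(Ω)`, elementwise polynomial of degree at most `k + 1`. -/
def Wh (Ω : Set (Sp d)) (T : Finset (Set (Sp d))) (k : ℕ) : Submodule ℝ (L2 Ω) :=
  brokenPoly Ω T (k + 1)

/-- `M̃_h(o)`: continuous functions on the union of the interior faces whose restriction to every
interior face is a polynomial of degree at most `k + 1`. -/
def Mh (T : Finset (Set (Sp d))) (k : ℕ) : Submodule ℝ C(skeleton T, ℝ) where
  carrier := {μ | ∀ e ∈ interiorFaces T, ∃ p : MvPolynomial (Fin d) ℝ,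
    p.totalDegree ≤ k + 1 ∧ ∀ x : skeleton T, (x : Sp d) ∈ e → μ x = ev p x}
  zero_mem' := fun _ _ => ⟨0, by simp, by simp [ev]⟩
  add_mem' := by
    intro a b ha hb e he
    obtain ⟨p, hp, hpa⟩ := ha e he
    obtain ⟨q, hq, hqb⟩ := hb e he
    refine ⟨p + q, (MvPolynomial.totalDegree_add p q).trans (max_le hp hq), fun x hx => ?_⟩
    rw [ContinuousMap.add_apply, hpa x hx, hqb x hx]
    simp [ev]
  smul_mem' := by
    intro c a ha e he
    obtain ⟨p, hp, hpa⟩ := ha e he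
    refine ⟨c • p, (MvPolynomial.totalDegree_smul_le c p).trans hp, fun x hx => ?_⟩
    rw [ContinuousMap.smul_apply, hpa x hx]
    simp [ev, MvPolynomial.smul_eval]

open Classical in
/-- The polynomial `v|_K` for `v ∈ L²(Ω)` that is polynomial on `K`; it is unique when `K` is an
element of a mesh of `Ω`. It gives the values of `v` up to `∂K` from inside `K`. -/
def elemPoly (Ω K : Set (Sp d)) (v : L2 Ω) : MvPolynomial (Fin d) ℝ :=
  if h : ∃ p, EqOnPoly Ω K v p then h.choose else 0

/-- Value on `K` (including `∂K`, from inside) of a piecewise polynomial function. -/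
def val {Ω : Set (Sp d)} (K : Set (Sp d)) (v : L2 Ω) (x : Sp d) : ℝ := ev (elemPoly Ω K v) x

/-- Value on `K` (including `∂K`, from inside) of a piecewise polynomial vector field. -/
def vval {Ω : Set (Sp d)} (K : Set (Sp d)) (r : Fin d → L2 Ω) (x : Sp d) : Sp d :=
  WithLp.toLp 2 fun i => val K (r i) x

/-- The gradient on `K` of a piecewise polynomial function. -/
def gradOn {Ω : Set (Sp d)} (K : Set (Sp d)) (v : L2 Ω) (x : Sp d) : Sp d :=
  WithLp.toLp 2 fun i => ev (MvPolynomial.pderiv i (elemPoly Ω K v)) x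

/-- The divergence on `K` of a piecewise polynomial vector field. -/
def divOn {Ω : Set (Sp d)} (K : Set (Sp d)) (r : Fin d → L2 Ω) (x : Sp d) : ℝ :=
  ∑ i, ev (MvPolynomial.pderiv i (elemPoly Ω K (r i))) x

open Classical in
/-- Value of a function on the union of the interior faces, extended by zero. -/
def tr {T : Finset (Set (Sp d))} (μ : C(skeleton T, ℝ)) (x : Sp d) : ℝ :=
  if hx : x ∈ skeleton T then μ ⟨x, hx⟩ else 0

open Classical in
/-- Value of a function on the boundary `∂Ω`, extended by zero. -/
def bval {Ω : Set (Sp d)} (g : C(frontier Ω, ℝ)) (x : Sp d) : ℝ :=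
  if hx : x ∈ frontier Ω then g ⟨x, hx⟩ else 0

/-! ### The bilinear forms -/

/-- `(·,·)_{T_h}`: sum over `K` of the integrals over `K`. -/
def volSum (T : Finset (Set (Sp d))) (F : Set (Sp d) → Sp d → ℝ) : ℝ :=
  ∑ K ∈ T, ∫ x in K, F K x

/-- `⟨·,·⟩_{∂T_h}`: sum over `K` of the integrals over `∂K`. -/
def bdSum (T : Finset (Set (Sp d))) (F : Set (Sp d) → Sp d → ℝ) : ℝ :=
  ∑ K ∈ T, ∫ x in frontier K, F K x ∂(surf d)

/-- `⟨·,·⟩_{∂T_h ∖ ε_h^∂}`: sum over `K` of the integrals over `∂K ∖ ∂Ω`. -/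
def intSum (Ω : Set (Sp d)) (T : Finset (Set (Sp d))) (F : Set (Sp d) → Sp d → ℝ) : ℝ :=
  ∑ K ∈ T, ∫ x in frontier K \ frontier Ω, F K x ∂(surf d)

/-- `⟨·,·⟩_{ε_h^∂}`: sum over `K` of the integrals over `∂K ∩ ∂Ω`. -/
def extSum (Ω : Set (Sp d)) (T : Finset (Set (Sp d))) (F : Set (Sp d) → Sp d → ℝ) : ℝ :=
  ∑ K ∈ T, ∫ x in frontier K ∩ frontier Ω, F K x ∂(surf d)

/-- The normal component `β · n` on `∂K`. -/
def bn (β : Sp d → Sp d) (K : Set (Sp d)) (x : Sp d) : ℝ := inner ℝ (β x) (normal K x)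

/-- The normal component `r · n` on `∂K` of a piecewise polynomial vector field. -/
def rn {Ω : Set (Sp d)} (r : Fin d → L2 Ω) (K : Set (Sp d)) (x : Sp d) : ℝ :=
  inner ℝ (vval K r x) (normal K x)

/-- `B₁(q, y, ŷ; r, w, μ)`. The stabilization function `τ` is given on each `∂K` separately. -/
def B1 (Ω : Set (Sp d)) (T : Finset (Set (Sp d))) (h : ℝ) (β : Sp d → Sp d)
    (τ : Set (Sp d) → Sp d → ℝ)
    (q : Fin d → L2 Ω) (y : L2 Ω) (yhat : C(skeleton T, ℝ))
    (r : Fin d → L2 Ω) (w : L2 Ω) (μ : C(skeleton T, ℝ)) : ℝ :=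
  volSum T (fun K x => inner ℝ (vval K q x) (vval K r x))
  - volSum T (fun K x => val K y x * divOn K r x)
  + intSum Ω T (fun K x => tr yhat x * rn r K x)
  - volSum T (fun K x => inner ℝ (vval K q x + val K y x • β x) (gradOn K w x))
  - volSum T (fun K x => weakDiv Ω β x * val K y x * val K w x)
  + bdSum T (fun K x => (rn q K x + (h⁻¹ + τ K x) * val K y x) * val K w x)
  + intSum Ω T (fun K x => (bn β K x - h⁻¹ - τ K x) * tr yhat x * val K w x)
  - intSum Ω T (fun K x =>
      (rn q K x + bn β K x * tr yhat x + (h⁻¹ + τ K x) * (val K y x - tr yhat x)) * tr μ x)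

/-- `B₂(p, z, ẑ; r, w, μ)`. -/
def B2 (Ω : Set (Sp d)) (T : Finset (Set (Sp d))) (h : ℝ) (β : Sp d → Sp d)
    (τ : Set (Sp d) → Sp d → ℝ)
    (p : Fin d → L2 Ω) (z : L2 Ω) (zhat : C(skeleton T, ℝ))
    (r : Fin d → L2 Ω) (w : L2 Ω) (μ : C(skeleton T, ℝ)) : ℝ :=
  volSum T (fun K x => inner ℝ (vval K p x) (vval K r x))
  - volSum T (fun K x => val K z x * divOn K r x)
  + intSum Ω T (fun K x => tr zhat x * rn r K x)
  - volSum T (fun K x => inner ℝ (vval K p x - val K z x • β x) (gradOn K w x))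
  + bdSum T (fun K x => (rn p K x + (h⁻¹ + τ K x) * val K z x) * val K w x)
  - intSum Ω T (fun K x => (bn β K x + h⁻¹ + τ K x) * tr zhat x * val K w x)
  - intSum Ω T (fun K x =>
      (rn p K x - bn β K x * tr zhat x + (h⁻¹ + τ K x) * (val K z x - tr zhat x)) * tr μ x)

/-- The space `V_h × V_h × W_h × W_h × W_h × M̃_h(o) × M̃_h(o)`. -/
abbrev Space (Ω : Set (Sp d)) (T : Finset (Set (Sp d))) (k : ℕ) : Type :=
  Vh Ω T k × Vh Ω T k × Wh Ω T k × Wh Ω T k × Wh Ω T k × Mh T k × Mh T k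

/-- `(q, p, y, z, u, ŷ, ẑ)` solves the EDG optimality system; `gh` stands for `I_h g`. -/
def IsSolution (Ω : Set (Sp d)) (T : Finset (Set (Sp d))) (k : ℕ) (h γ : ℝ) (β : Sp d → Sp d)
    (τ₁ τ₂ : Set (Sp d) → Sp d → ℝ) (f yd : L2 Ω) (gh : C(frontier Ω, ℝ)) :
    Space Ω T k → Prop
  | (q, p, y, z, u, yhat, zhat) =>
    ∀ (r₁ r₂ : Vh Ω T k) (w₁ w₂ w₃ : Wh Ω T k) (μ₁ μ₂ : Mh T k),
      B1 Ω T h β τ₁ q y yhat r₁ w₁ μ₁ =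
          volSum T (fun K x => (f x + val K u.1 x) * val K w₁.1 x)
          - extSum Ω T (fun K x =>
              bval gh x * ((bn β K x - τ₁ K x - h⁻¹) * val K w₁.1 x + rn r₁.1 K x)) ∧
      B2 Ω T h β τ₂ p z zhat r₂ w₂ μ₂ =
          volSum T (fun K x => (val K y.1 x - yd x) * val K w₂.1 x) ∧
      volSum T (fun K x => (val K z.1 x + γ * val K u.1 x) * val K w₃.1 x) = 0

end EDG

end

open MeasureTheory

open scoped ENNReal ContDiff

noncomputable section

namespace EDG

/-! The system is square and finite-dimensional, so it suffices that the homogeneous system has only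
the zero solution (`systemMap_bijective`). The state and dual forms are adjoint up to signs: (q, y,
ŷ) tested with (p, -z, -ẑ) plus (p, z, ẑ) tested with (-q, y, ŷ) gives zero
(`edgForm_add_edgForm_eq_zero`). With zero data these two values are -(u, z) and (y, y), while the
third equation tested with u gives (z, u) = -γ(u, u). Hence (y, y) + γ(u, u) = 0, so y = u = 0, and
the third equation then gives z = 0. What remains has no scalar part, and the state form at (q, 0,
μ) is ‖q‖² plus the sum of the integrals of (h⁻¹ + τ₁ - ½ β·n) μ² over the interior parts of the
element boundaries. By (A2) it vanishes only for q = 0 and μ = 0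
(`eq_zero_of_edgForm_self_eq_zero`). The dual form is of the same type with convection -β, and by
(A1) its coefficient τ₂ + ½ β·n equals τ₁ - ½ β·n.

Two facts carry the adjoint identity. One is integration by parts on each element for β y z, where β
is continuous with bounded weak derivatives (`IsConvexBody.integral_mul_add_mul`). The other is that
β·n times a single-valued trace cancels between neighbouring elements (`intSum_eq_zero_of_normal`);
the second fact also enters the definiteness.

For the integration by parts, a polytope is written as a finite intersection of half-spaces
(`exists_finset_halfSpaces`), and the weak derivative is tested with φ times a smooth cutoff of the
polytope. The gradient of the cutoff lives in thin layers along the facets; Fubini in coordinates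
orthogonal to a facet shows that each layer tends to the surface measure (`tendsto_integral_layer`).

The cancellation comes from separating hyperplanes: two convex bodies with disjoint interiors have
opposite normals at a common point, so almost every point of the skeleton lies on exactly two
element boundaries and off the boundary of the domain. -/

/-! ### Polytopes as intersections of half-spaces -/

section HalfSpaces

variable {E : Type*} [NormedAddCommGroup E] [InnerProductSpace ℝ E]

/-- The polar of a finite set of points with respect to the centre `x₀`. -/
def polar (s : Finset E) (x₀ : E) : Set E := {m | ∀ x ∈ s, inner ℝ m (x - x₀) ≤ 1}

theorem convex_setOf_inner_sub_le (m x₀ : E) (c : ℝ) :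
    Convex ℝ {x : E | inner ℝ m (x - x₀) ≤ c} := by
  have : {x : E | inner ℝ m (x - x₀) ≤ c} = {x | innerSL ℝ m x ≤ c + inner ℝ m x₀} := by
    ext x; simp [inner_sub_right]
  rw [this]
  exact convex_halfSpace_le (innerSL ℝ m).isLinear _

theorem convex_setOf_inner_le (v : E) (c : ℝ) : Convex ℝ {m : E | inner ℝ m v ≤ c} := by
  have : {m : E | inner ℝ m v ≤ c} = {m | innerSL ℝ v m ≤ c} := by
    ext x; simp [real_inner_comm]
  rw [this]
  exact convex_halfSpace_le (innerSL ℝ v).isLinear _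

theorem inner_le_of_mem_polar {s : Finset E} {x₀ m : E} (hm : m ∈ polar s x₀) {x : E}
    (hx : x ∈ convexHull ℝ (s : Set E)) : inner ℝ m (x - x₀) ≤ 1 :=
  convexHull_min (t := {x | inner ℝ m (x - x₀) ≤ 1}) hm (convex_setOf_inner_sub_le m x₀ 1) hx

theorem convex_polar (s : Finset E) (x₀ : E) : Convex ℝ (polar s x₀) := by
  have : polar s x₀ = ⋂ x ∈ s, {m | inner ℝ m (x - x₀) ≤ 1} := by ext; simp [polar]
  rw [this]
  exact convex_iInter₂ fun x _ => convex_setOf_inner_le _ _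

theorem isClosed_polar (s : Finset E) (x₀ : E) : IsClosed (polar s x₀) := by
  have : polar s x₀ = ⋂ x ∈ s, {m | inner ℝ m (x - x₀) ≤ 1} := by ext; simp [polar]
  rw [this]
  exact isClosed_biInter fun x _ => isClosed_le (by fun_prop) continuous_const

/-- A ball of radius r around x₀ lies in the hull; testing m against the point at distance r/2 in
the direction of m itself bounds ‖m‖ by 2/r. -/
theorem isBounded_polar {s : Finset E} {x₀ : E} (hx₀ : x₀ ∈ interior (convexHull ℝ (s : Set E))) :
    Bornology.IsBounded (polar s x₀) := by
  obtain ⟨r, hr, hball⟩ := Metric.isOpen_iff.1 isOpen_interior x₀ hx₀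
  refine (Metric.isBounded_iff_subset_closedBall 0).2 ⟨2 / r, fun m hm => ?_⟩
  rw [mem_closedBall_zero_iff]
  by_cases h0 : m = 0
  · subst h0; rw [norm_zero]; positivity
  have hn : 0 < ‖m‖ := norm_pos_iff.2 h0
  have hx : x₀ + (r / 2 / ‖m‖) • m ∈ convexHull ℝ (s : Set E) := by
    refine interior_subset (hball ?_)
    rw [Metric.mem_ball, dist_eq_norm, add_sub_cancel_left, norm_smul, Real.norm_of_nonneg
      (by positivity), div_mul_cancel₀ _ hn.ne']
    linarith
  have := inner_le_of_mem_polar hm hx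
  rw [add_sub_cancel_left, inner_smul_right, real_inner_self_eq_norm_sq] at this
  rw [le_div_iff₀ hr]
  have h2 : r / 2 / ‖m‖ * ‖m‖ ^ 2 = r / 2 * ‖m‖ := by field_simp
  linarith

/-- An extreme point is determined by its set of active constraints: if m' has the same active set,
m can move both ways along m - m' without leaving the polar. Only finitely many active sets are
possible. -/
theorem finite_extremePoints_polar (s : Finset E) (x₀ : E) :
    ((polar s x₀).extremePoints ℝ).Finite := by
  classical
  refine Set.Finite.of_finite_image (f := fun m => s.filter fun x => inner ℝ m (x - x₀) = 1)
    ((s.powerset.finite_toSet).subset ?_) ?_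
  · rintro _ ⟨m, -, rfl⟩
    exact Finset.mem_coe.2 (Finset.mem_powerset.2 (Finset.filter_subset _ _))
  intro m hm m' hm' heq
  have key : ∀ᶠ δ in nhds (0 : ℝ), ∀ x ∈ s, inner ℝ (m + δ • (m - m')) (x - x₀) ≤ 1 := by
    refine (Filter.eventually_all_finset s).2 fun x hx => ?_
    by_cases hact : inner ℝ m (x - x₀) = 1
    · have h' : inner ℝ m' (x - x₀) = 1 := by
        have : x ∈ s.filter fun x => inner ℝ m (x - x₀) = 1 := by simp [hx, hact]
        have heq' : (s.filter fun x => inner ℝ m (x - x₀) = 1) =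
          s.filter fun x => inner ℝ m' (x - x₀) = 1 := heq
        rw [heq'] at this
        exact (Finset.mem_filter.1 this).2
      refine Filter.Eventually.of_forall fun δ => ?_
      rw [inner_add_left, inner_smul_left, inner_sub_left, hact, h']
      simp
    · have hlt : inner ℝ m (x - x₀) < 1 := lt_of_le_of_ne (hm.1 x hx) hact
      have hc : Filter.Tendsto (fun δ : ℝ => inner ℝ (m + δ • (m - m')) (x - x₀)) (nhds 0)
          (nhds (inner ℝ m (x - x₀))) := by
        have : Continuous fun δ : ℝ => inner ℝ (m + δ • (m - m')) (x - x₀) := by fun_prop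
        simpa using this.tendsto 0
      exact (hc.eventually_lt_const hlt).mono fun _ h => h.le
  obtain ⟨r, hr, hball⟩ := Metric.eventually_nhds_iff.1 key
  have h1 : m + (r / 2) • (m - m') ∈ polar s x₀ := hball (by
    rw [dist_zero_right, Real.norm_of_nonneg] <;> linarith)
  have h2 : m + (-(r / 2)) • (m - m') ∈ polar s x₀ := hball (by
    rw [dist_zero_right, norm_neg, Real.norm_of_nonneg] <;> linarith)
  have hseg : m ∈ openSegment ℝ (m + (r / 2) • (m - m')) (m + (-(r / 2)) • (m - m')) := by
    refine ⟨1 / 2, 1 / 2, by norm_num, by norm_num, by norm_num, ?_⟩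
    module
  have := hm.2 h1 h2 hseg
  have h3 : (r / 2) • (m - m') = 0 := by simpa using this
  have h4 : m - m' = 0 := (smul_eq_zero.1 h3).resolve_left (by linarith)
  exact sub_eq_zero.1 h4

/-- A polytope is the intersection of finitely many half-spaces whose boundaries do not contain a
given interior point. -/
theorem exists_finset_halfSpaces [FiniteDimensional ℝ E] (s : Finset E) {x₀ : E}
    (hx₀ : x₀ ∈ interior (convexHull ℝ (s : Set E))) :
    ∃ S : Finset E, 0 ∉ S ∧
      convexHull ℝ (s : Set E) = {x | ∀ m ∈ S, inner ℝ m (x - x₀) ≤ 1} := by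
  classical
  -- The half-spaces come from the vertices of the polar. The vertex 0, if present, is dropped: its
  -- constraint is void and it defines no hyperplane.
  refine ⟨(finite_extremePoints_polar s x₀).toFinset.erase 0, by simp, ?_⟩
  ext x
  constructor
  · intro hx m hm
    have : m ∈ (polar s x₀).extremePoints ℝ := by
      simpa using Finset.mem_of_mem_erase hm
    exact inner_le_of_mem_polar this.1 hx
  · intro hx
    by_contra hxK
    have hcomp : IsCompact (polar s x₀) :=
      Metric.isCompact_of_isClosed_isBounded (isClosed_polar s x₀) (isBounded_polar hx₀)
    -- By Krein–Milman the bound at the extreme points holds on the whole polar. It contradicts the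
    -- functional separating x from the hull once that functional is scaled into the polar.
    have hsub : polar s x₀ ⊆ {m | inner ℝ m (x - x₀) ≤ 1} := by
      rw [← closure_convexHull_extremePoints hcomp (convex_polar s x₀)]
      refine closure_minimal (convexHull_min (fun m hm => ?_) (convex_setOf_inner_le _ _))
        (isClosed_le (by fun_prop) continuous_const)
      by_cases h0 : m = 0
      · simp [h0]
      · exact hx m (by simp [h0, hm])
    obtain ⟨f, u, hfu, hux⟩ := geometric_hahn_banach_closed_point (convex_convexHull ℝ (s : Set E))
      (s.finite_toSet.isClosed_convexHull ℝ) hxK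
    obtain ⟨n, rfl⟩ := (InnerProductSpace.toDual ℝ E).surjective f
    simp only [InnerProductSpace.toDual_apply_apply] at hfu hux
    have hc : 0 < u - inner ℝ n x₀ := by linarith [hfu x₀ (interior_subset hx₀)]
    have hmem : (u - inner ℝ n x₀)⁻¹ • n ∈ polar s x₀ := by
      intro a ha
      rw [inner_smul_left, inner_sub_right]
      have := hfu a (subset_convexHull ℝ _ ha)
      simp only [conj_trivial]
      rw [inv_mul_le_iff₀ hc]
      linarith
    have := hsub hmem
    simp only [Set.mem_ofPred_eq, inner_smul_left, inner_sub_right, conj_trivial] at this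
    rw [← mul_sub, inv_mul_le_iff₀ hc] at this
    linarith

end HalfSpaces

/-! ### Cells bounded by finitely many hyperplanes -/

section Cell

variable {d : ℕ}

/-- The intersection of the half-spaces `⟪m, x - x₀⟫ ≤ 1`, `m ∈ S`. -/
def cell (S : Finset (Sp d)) (x₀ : Sp d) : Set (Sp d) := {x | ∀ m ∈ S, inner ℝ m (x - x₀) ≤ 1}

/-- The part of the cell lying on the hyperplane `⟪m, x - x₀⟫ = 1`. -/
def facet (S : Finset (Sp d)) (x₀ m : Sp d) : Set (Sp d) :=
  {x | x ∈ cell S x₀ ∧ inner ℝ m (x - x₀) = 1}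

theorem isClosed_cell (S : Finset (Sp d)) (x₀ : Sp d) : IsClosed (cell S x₀) := by
  have : cell S x₀ = ⋂ m ∈ S, {x | inner ℝ m (x - x₀) ≤ 1} := by ext; simp [cell]
  rw [this]
  exact isClosed_biInter fun x _ => isClosed_le (by fun_prop) continuous_const

theorem convex_cell (S : Finset (Sp d)) (x₀ : Sp d) : Convex ℝ (cell S x₀) := by
  have : cell S x₀ = ⋂ m ∈ S, {x | inner ℝ m (x - x₀) ≤ 1} := by ext; simp [cell]
  rw [this]
  exact convex_iInter₂ fun m _ => convex_setOf_inner_sub_le m x₀ 1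

theorem isClosed_facet (S : Finset (Sp d)) (x₀ m : Sp d) : IsClosed (facet S x₀ m) :=
  (isClosed_cell S x₀).inter (isClosed_eq (by fun_prop) continuous_const)

/-- From an interior point a small move along m stays in the cell and, since m ≠ 0, increases ⟪m,
·⟫; so no constraint is active there. -/
theorem interior_cell {S : Finset (Sp d)} (hS : 0 ∉ S) (x₀ : Sp d) :
    interior (cell S x₀) = {x | ∀ m ∈ S, inner ℝ m (x - x₀) < 1} := by
  apply subset_antisymm
  · intro x hx m hm
    have hm0 : m ≠ 0 := fun h => hS (h ▸ hm)
    have hn : 0 < ‖m‖ := norm_pos_iff.2 hm0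
    obtain ⟨r, hr, hball⟩ := Metric.isOpen_iff.1 isOpen_interior x hx
    have hx' : x + (r / 2 / ‖m‖) • m ∈ cell S x₀ := by
      refine interior_subset (hball ?_)
      rw [Metric.mem_ball, dist_eq_norm, add_sub_cancel_left, norm_smul, Real.norm_of_nonneg
        (by positivity), div_mul_cancel₀ _ hn.ne']
      linarith
    have := hx' m hm
    rw [add_sub_right_comm, inner_add_right, inner_smul_right, real_inner_self_eq_norm_sq] at this
    have : 0 < r / 2 / ‖m‖ * ‖m‖ ^ 2 := by positivity
    linarith
  · refine interior_maximal (fun x hx m hm => (hx m hm).le) ?_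
    have : {x | ∀ m ∈ S, inner ℝ m (x - x₀) < 1} = ⋂ m ∈ S, {x | inner ℝ m (x - x₀) < 1} := by
      ext; simp
    rw [this]
    exact isOpen_biInter_finset fun x _ => isOpen_lt (by fun_prop) continuous_const

theorem frontier_cell {S : Finset (Sp d)} (hS : 0 ∉ S) (x₀ : Sp d) :
    frontier (cell S x₀) = ⋃ m ∈ S, facet S x₀ m := by
  rw [(isClosed_cell S x₀).frontier_eq, interior_cell hS]
  ext x
  simp only [Set.mem_sdiff, Set.mem_ofPred_eq, not_forall, Set.mem_iUnion, facet]
  constructor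
  · rintro ⟨hx, m, hm, h⟩
    exact ⟨m, hm, hx, le_antisymm (hx m hm) (not_lt.1 h)⟩
  · rintro ⟨m, hm, hx, h⟩
    exact ⟨hx, m, hm, h.not_lt⟩

/-- Off the other facets, the normal on a facet is the normalised defining vector. -/
theorem normal_of_mem_facet {S : Finset (Sp d)} {x₀ m x : Sp d} (hm0 : m ≠ 0) (hm : m ∈ S)
    (hx : x ∈ facet S x₀ m) (hx' : ∀ m' ∈ S, m' ≠ m → x ∉ facet S x₀ m') :
    IsUnitNormal (cell S x₀) x (‖m‖⁻¹ • m) ∧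
      ∀ n, IsUnitNormal (cell S x₀) x n → n = ‖m‖⁻¹ • m := by
  have hn : 0 < ‖m‖ := norm_pos_iff.2 hm0
  refine ⟨⟨norm_smul_inv_norm hm0, fun y hy => ?_⟩, fun n ⟨hn1, hnK⟩ => ?_⟩
  · rw [inner_smul_left]
    have h1 := hy m hm
    have h2 := hx.2
    have : inner ℝ m (y - x) ≤ 0 := by
      have : y - x = (y - x₀) - (x - x₀) := by abel
      rw [this, inner_sub_right]; linarith
    simp only [conj_trivial]
    exact mul_nonpos_of_nonneg_of_nonpos (by positivity) this
  -- Only the constraint m is active at x, so a short move along v with ⟪m, v⟫ ≤ 0 stays in the cell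
  -- and a normal n has ⟪n, v⟫ ≤ 0. Taking for v the part of n orthogonal to m, and then -m, forces
  -- n to be a nonnegative multiple of m.
  · have cone : ∀ v : Sp d, inner ℝ m v ≤ 0 → inner ℝ n v ≤ 0 := by
      intro v hv
      have key : ∀ᶠ δ in nhdsWithin (0 : ℝ) (Set.Ioi 0), ∀ m' ∈ S,
          inner ℝ m' (x + δ • v - x₀) ≤ 1 := by
        refine (Filter.eventually_all_finset S).2 fun m' hm' => ?_
        by_cases h : m' = m
        · filter_upwards [self_mem_nhdsWithin] with δ hδ
          rw [h, add_sub_right_comm, inner_add_right, inner_smul_right, hx.2]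
          have : δ * inner ℝ m v ≤ 0 := mul_nonpos_of_nonneg_of_nonpos (le_of_lt hδ) hv
          linarith
        · have hlt : inner ℝ m' (x - x₀) < 1 :=
            lt_of_le_of_ne (hx.1 m' hm') fun he => hx' m' hm' h ⟨hx.1, he⟩
          have hc : Filter.Tendsto (fun δ : ℝ => inner ℝ m' (x + δ • v - x₀))
              (nhdsWithin 0 (Set.Ioi 0)) (nhds (inner ℝ m' (x - x₀))) := by
            have : Continuous fun δ : ℝ => inner ℝ m' (x + δ • v - x₀) := by fun_prop
            simpa using (this.tendsto 0).mono_left nhdsWithin_le_nhds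
          exact (hc.eventually_lt_const hlt).mono fun _ h => h.le
      obtain ⟨δ, hδ, hδ0⟩ := (key.and self_mem_nhdsWithin).exists
      have := hnK _ hδ
      rw [add_sub_cancel_left, inner_smul_right] at this
      exact nonpos_of_mul_nonpos_right this hδ0
    set c : ℝ := inner ℝ m n / ‖m‖ ^ 2 with hc
    have horth : inner ℝ m (n - c • m) = 0 := by
      rw [inner_sub_right, inner_smul_right, real_inner_self_eq_norm_sq, hc,
        div_mul_cancel₀ _ (by positivity), sub_self]
    have hle := cone _ horth.le
    have hself : inner ℝ (n - c • m) (n - c • m) = inner ℝ n (n - c • m) := by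
      rw [inner_sub_left, inner_smul_left, horth]; simp
    have hz : n - c • m = 0 := by
      rw [← hself, real_inner_self_eq_norm_sq] at hle
      exact norm_eq_zero.1 (pow_eq_zero_iff two_ne_zero |>.1 (le_antisymm hle (by positivity)))
    have hnc : n = c • m := sub_eq_zero.1 hz
    have hc0 : 0 ≤ c := by
      have := cone (-m) (by rw [inner_neg_right, real_inner_self_eq_norm_sq]; nlinarith)
      rw [inner_neg_right, real_inner_comm] at this
      rw [hc]
      apply div_nonneg <;> nlinarith
    have h1 : c * ‖m‖ = 1 := by
      rw [hnc, norm_smul, Real.norm_of_nonneg hc0] at hn1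
      exact hn1
    rw [hnc, eq_inv_of_mul_eq_one_left h1]

theorem normal_eq_of_existsUnique {K : Set (Sp d)} {x n : Sp d} (hn : IsUnitNormal K x n)
    (huniq : ∀ n', IsUnitNormal K x n' → n' = n) : normal K x = n := by
  have h : ∃! n : Sp d, IsUnitNormal K x n := ⟨n, hn, huniq⟩
  rw [normal, dif_pos h]
  exact huniq _ h.choose_spec.1

/-! ### Coordinates adapted to a hyperplane -/

/-- The inclusion of the hyperplane through `c` orthogonal to `m`. -/
def hyperplaneMap (m c : Sp d) (y : (ℝ ∙ m)ᗮ) : Sp d := c + (y : Sp d)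

theorem isometry_hyperplaneMap (m c : Sp d) : Isometry (hyperplaneMap m c) :=
  (isometry_add_left c).comp isometry_subtype_coe

theorem mem_range_hyperplaneMap {m c x : Sp d} :
    x ∈ Set.range (hyperplaneMap m c) ↔ inner ℝ m (x - c) = 0 := by
  rw [← Submodule.mem_orthogonal_singleton_iff_inner_right]
  constructor
  · rintro ⟨y, rfl⟩
    simp [hyperplaneMap]
  · intro h
    exact ⟨⟨x - c, h⟩, by simp [hyperplaneMap]⟩

theorem finrank_orthogonal {m : Sp d} (hm : m ≠ 0) : Module.finrank ℝ (ℝ ∙ m)ᗮ = d - 1 := by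
  have h := (ℝ ∙ m).finrank_add_finrank_orthogonal
  rw [finrank_span_singleton hm, finrank_euclideanSpace_fin] at h
  omega

/-- `surf` is a normalised Hausdorff measure, hence transported by isometries, and on the
(d-1)-dimensional space orthogonal to m it is the Lebesgue measure. -/
theorem map_hyperplaneMap {m : Sp d} (hm : m ≠ 0) (c : Sp d) :
    Measure.map (hyperplaneMap m c) volume =
      (surf d).restrict (Set.range (hyperplaneMap m c)) := by
  rw [surf, ← (isometry_hyperplaneMap m c).map_euclideanHausdorffMeasure, ← finrank_orthogonal hm,
    InnerProductSpace.euclideanHausdorffMeasure_eq_volume]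

theorem measurableEmbedding_hyperplaneMap (m c : Sp d) :
    MeasurableEmbedding (hyperplaneMap m c) :=
  (isometry_hyperplaneMap m c).isClosedEmbedding.measurableEmbedding

theorem surf_eq_volume_preimage {m : Sp d} (hm : m ≠ 0) (c : Sp d) {A : Set (Sp d)}
    (hA : A ⊆ Set.range (hyperplaneMap m c)) : surf d A = volume (hyperplaneMap m c ⁻¹' A) := by
  rw [← (measurableEmbedding_hyperplaneMap m c).map_apply, map_hyperplaneMap hm,
    Measure.restrict_eq_self _ hA]

theorem setIntegral_hyperplane {m : Sp d} (hm : m ≠ 0) (c : Sp d) {A : Set (Sp d)}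
    (hA : A ⊆ Set.range (hyperplaneMap m c)) (hAm : MeasurableSet A) (g : Sp d → ℝ) :
    ∫ x in A, g x ∂(surf d) = ∫ y, A.indicator g (hyperplaneMap m c y) := by
  rw [← (measurableEmbedding_hyperplaneMap m c).integral_map, map_hyperplaneMap hm,
    integral_indicator hAm, Measure.restrict_restrict hAm, Set.inter_eq_self_of_subset_left hA]

/-- Orthogonal coordinates `(s, y) ↦ x₀ + s m / ‖m‖ + y`. -/
def orthCoord (x₀ m : Sp d) (z : ℝ × (ℝ ∙ m)ᗮ) : Sp d :=
  x₀ + ((z.1 * ‖m‖⁻¹) • m + (z.2 : Sp d))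

/-- Up to a translation this is the isometry of the orthogonal decomposition, defined on the ℓ²
product. It allows Fubini over slices parallel to a facet. -/
theorem measurePreserving_orthCoord (x₀ : Sp d) {m : Sp d} (hm : m ≠ 0) :
    MeasurePreserving (orthCoord x₀ m) := by
  have hu : ‖(‖m‖⁻¹ • m : Sp d)‖ = 1 := norm_smul_inv_norm hm
  have hspan : (ℝ ∙ (‖m‖⁻¹ • m) : Submodule ℝ (Sp d)) = ℝ ∙ m :=
    Submodule.span_singleton_smul_eq (IsUnit.mk0 _ (inv_ne_zero (norm_ne_zero_iff.2 hm))) m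
  let e₁ : ℝ ≃ₗᵢ[ℝ] (ℝ ∙ m) := (LinearIsometryEquiv.toSpanUnitSingleton _ hu).trans
    (LinearIsometryEquiv.ofEq _ _ hspan)
  let e : WithLp 2 (ℝ × (ℝ ∙ m)ᗮ) ≃ₗᵢ[ℝ] Sp d :=
    (LinearIsometryEquiv.withLpProdCongr 2 e₁ (LinearIsometryEquiv.refl ℝ _)).trans
      (Submodule.orthogonalDecomposition (ℝ ∙ m)).symm
  have h1 : MeasurePreserving (fun z => e (WithLp.toLp 2 z)) :=
    e.measurePreserving.comp (WithLp.volume_preserving_toLp ℝ (ℝ ∙ m)ᗮ)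
  have h2 : MeasurePreserving (fun x : Sp d => x₀ + x) := measurePreserving_add_left volume x₀
  convert! h2.comp h1 using 1
  ext1 z
  simp [orthCoord, e, e₁, smul_smul]

/-- Unless m' is parallel to m, the set is empty or a proper affine subspace. If m' is parallel to
m, the functional vanishes on the orthogonal space and a ≠ 0 leaves the empty set. -/
theorem volume_orthogonal_inner_eq {m m' : Sp d} (a : ℝ)
    (h : ∀ c : ℝ, m' = c • m → a ≠ 0) :
    volume {y : (ℝ ∙ m)ᗮ | inner ℝ m' (y : Sp d) = a} = 0 := by
  let f : (ℝ ∙ m)ᗮ →ₗ[ℝ] ℝ := (innerSL ℝ m').toLinearMap ∘ₗ (ℝ ∙ m)ᗮ.subtype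
  have hf : ∀ y, f y = inner ℝ m' (y : Sp d) := fun y => rfl
  rcases Set.eq_empty_or_nonempty {y : (ℝ ∙ m)ᗮ | inner ℝ m' (y : Sp d) = a} with he | ⟨y₀, hy₀⟩
  · rw [he, measure_empty]
  by_cases hf0 : f = 0
  · exfalso
    have hm' : m' ∈ (ℝ ∙ m)ᗮᗮ := by
      rw [Submodule.mem_orthogonal]
      intro y hy
      have := hf ⟨y, hy⟩
      rw [hf0] at this
      rw [real_inner_comm]; exact this.symm
    rw [Submodule.orthogonal_orthogonal] at hm'
    obtain ⟨c, hc⟩ := Submodule.mem_span_singleton.1 hm'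
    refine h c hc.symm ?_
    rw [← (show inner ℝ m' (y₀ : Sp d) = a from hy₀), ← hf, hf0]; rfl
  · refine measure_mono_null (t := (AffineSubspace.mk' y₀ (LinearMap.ker f) : Set (ℝ ∙ m)ᗮ))
      (fun y hy => ?_) (Measure.addHaar_affineSubspace _ _ ?_)
    · rw [SetLike.mem_coe, AffineSubspace.mem_mk', LinearMap.mem_ker, vsub_eq_sub, map_sub, hf, hf]
      exact sub_eq_zero.2 (hy.trans (Eq.symm hy₀))
    · intro htop
      have := congrArg AffineSubspace.direction htop
      rw [AffineSubspace.direction_mk', AffineSubspace.direction_top] at this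
      exact hf0 (LinearMap.ker_eq_top.1 this)

/-- The foot of the perpendicular from `x₀` to the hyperplane `⟪m, x - x₀⟫ = 1`. -/
def foot (x₀ m : Sp d) : Sp d := x₀ + (‖m‖ ^ 2)⁻¹ • m

theorem inner_foot {x₀ m : Sp d} (hm : m ≠ 0) : inner ℝ m (foot x₀ m - x₀) = 1 := by
  have : ‖m‖ ≠ 0 := norm_ne_zero_iff.2 hm
  rw [foot, add_sub_cancel_left, inner_smul_right, real_inner_self_eq_norm_sq]
  field_simp

theorem facet_subset_range (S : Finset (Sp d)) (x₀ : Sp d) {m : Sp d} (hm : m ≠ 0) :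
    facet S x₀ m ⊆ Set.range (hyperplaneMap m (foot x₀ m)) := by
  intro x hx
  rw [mem_range_hyperplaneMap]
  have h : x - foot x₀ m = (x - x₀) - (foot x₀ m - x₀) := by abel
  rw [h, inner_sub_right, hx.2, inner_foot hm, sub_self]

theorem volume_hyperplaneMap_inner_eq {x₀ m m' : Sp d} (hm : m ≠ 0) (hmm' : m' ≠ m) :
    volume {y : (ℝ ∙ m)ᗮ | inner ℝ m' (hyperplaneMap m (foot x₀ m) y - x₀) = 1} = 0 := by
  have hset : {y : (ℝ ∙ m)ᗮ | inner ℝ m' (hyperplaneMap m (foot x₀ m) y - x₀) = 1} =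
      {y : (ℝ ∙ m)ᗮ | inner ℝ m' (y : Sp d) = 1 - inner ℝ m' (foot x₀ m - x₀)} := by
    ext y
    have : hyperplaneMap m (foot x₀ m) y - x₀ = (foot x₀ m - x₀) + y := by
      simp only [hyperplaneMap]; abel
    simp only [Set.mem_ofPred_eq, this, inner_add_right]
    constructor <;> intro h <;> linarith
  rw [hset]
  refine volume_orthogonal_inner_eq _ ?_
  -- For m' = c m the right-hand side is 1 - c, which vanishes only if m' = m.
  · rintro c rfl h0
    rw [inner_smul_left, inner_foot hm] at h0
    simp only [conj_trivial] at h0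
    have : c = 1 := by linarith
    exact hmm' (by rw [this, one_smul])

theorem surf_facet_inter_facet {S : Finset (Sp d)} {x₀ m m' : Sp d} (hm : m ≠ 0) (hmm' : m' ≠ m) :
    surf d (facet S x₀ m ∩ facet S x₀ m') = 0 := by
  rw [surf_eq_volume_preimage hm (foot x₀ m)
    (Set.inter_subset_left.trans (facet_subset_range S x₀ hm))]
  exact measure_mono_null (fun y hy => hy.2.2) (volume_hyperplaneMap_inner_eq (x₀ := x₀) hm hmm')

end Cell

/-! ### Smooth approximations of the indicator of a cell -/

/-- A smooth step, equal to `0` on `(-∞, 1]` and to `1` on `[2, ∞)`. -/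
def step (t : ℝ) : ℝ := Real.smoothTransition (t - 1)

theorem contDiff_step {n : ℕ∞} : ContDiff ℝ n step :=
  Real.smoothTransition.contDiff.comp (contDiff_id.sub contDiff_const)

theorem step_nonneg (t : ℝ) : 0 ≤ step t := Real.smoothTransition.nonneg _

theorem step_le_one (t : ℝ) : step t ≤ 1 := Real.smoothTransition.le_one _

theorem step_of_le_one {t : ℝ} (h : t ≤ 1) : step t = 0 :=
  Real.smoothTransition.zero_of_nonpos (by linarith)

theorem step_of_two_le {t : ℝ} (h : 2 ≤ t) : step t = 1 :=
  Real.smoothTransition.one_of_one_le (by linarith)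

theorem hasDerivAt_step (t : ℝ) : HasDerivAt step (deriv step t) t :=
  ((contDiff_step (n := 1)).differentiable (by simp) t).hasDerivAt

theorem continuous_deriv_step : Continuous (deriv step) :=
  (contDiff_step (n := 1)).continuous_deriv (by simp)

theorem deriv_step_of_lt {t : ℝ} (h : t < 1) : deriv step t = 0 := by
  have : step =ᶠ[nhds t] fun _ => 0 := by
    filter_upwards [gt_mem_nhds h] with s hs using step_of_le_one hs.le
  rw [this.deriv_eq, deriv_const]

theorem deriv_step_of_gt {t : ℝ} (h : 2 < t) : deriv step t = 0 := by
  have : step =ᶠ[nhds t] fun _ => 1 := by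
    filter_upwards [lt_mem_nhds h] with s hs using step_of_two_le hs.le
  rw [this.deriv_eq, deriv_const]

theorem hasCompactSupport_deriv_step : HasCompactSupport (deriv step) :=
  HasCompactSupport.of_support_subset_isCompact isCompact_Icc (K := Set.Icc 1 2) fun t ht => by
    by_contra h
    rw [Set.mem_Icc, not_and_or, not_le, not_le] at h
    exact ht (h.elim deriv_step_of_lt deriv_step_of_gt)

theorem integrable_deriv_step : Integrable (deriv step) :=
  continuous_deriv_step.integrable_of_hasCompactSupport hasCompactSupport_deriv_step

theorem integral_deriv_step : ∫ t, deriv step t = 1 := by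
  have h : ∫ t in (0 : ℝ)..3, deriv step t = step 3 - step 0 :=
    intervalIntegral.integral_eq_sub_of_hasDerivAt (fun t _ => hasDerivAt_step t)
      (continuous_deriv_step.intervalIntegrable _ _)
  rw [step_of_two_le (by norm_num), step_of_le_one (by norm_num), sub_zero,
    intervalIntegral.integral_of_le (by norm_num)] at h
  rw [← h, setIntegral_eq_integral_of_forall_compl_eq_zero]
  intro t ht
  rw [Set.mem_Ioc, not_and_or, not_lt, not_le] at ht
  exact ht.elim (fun h => deriv_step_of_lt (by linarith)) fun h => deriv_step_of_gt (by linarith)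

/-! ### Cutoffs of a cell and thin layers along its facets. -/

section Cell

variable {d : ℕ}

/-- The distance-like function `(1 - ⟪m, x - x₀⟫) / ε`. -/
def slack (x₀ : Sp d) (ε : ℝ) (m x : Sp d) : ℝ := (1 - inner ℝ m (x - x₀)) / ε

theorem continuous_slack (x₀ : Sp d) (ε : ℝ) (m : Sp d) : Continuous (slack x₀ ε m) := by
  unfold slack; fun_prop

/-- A product of smooth steps in the slacks. -/
def cutoff (x₀ : Sp d) (ε : ℝ) (S : Finset (Sp d)) (x : Sp d) : ℝ :=
  ∏ m ∈ S, step (slack x₀ ε m x)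

theorem continuous_cutoff (x₀ : Sp d) (ε : ℝ) (S : Finset (Sp d)) :
    Continuous (cutoff x₀ ε S) :=
  continuous_finsetProd _ fun m _ =>
    (contDiff_step (n := 0)).continuous.comp (continuous_slack x₀ ε m)

theorem norm_cutoff_le (x₀ : Sp d) (ε : ℝ) (S : Finset (Sp d)) (x : Sp d) :
    ‖cutoff x₀ ε S x‖ ≤ 1 := by
  rw [Real.norm_of_nonneg (by exact Finset.prod_nonneg fun _ _ => step_nonneg _)]
  exact Finset.prod_le_one (fun _ _ => step_nonneg _) fun _ _ => step_le_one _

/-- The cutoff is eventually `1` along points that converge to a point with positive slacks. -/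
theorem eventually_cutoff_eq_one {x₀ z : Sp d} {S : Finset (Sp d)}
    (hz : ∀ m ∈ S, inner ℝ m (z - x₀) < 1) {zε : ℝ → Sp d}
    (hlim : Filter.Tendsto zε (nhdsWithin 0 (Set.Ioi 0)) (nhds z)) :
    ∀ᶠ ε in nhdsWithin (0 : ℝ) (Set.Ioi 0), cutoff x₀ ε S (zε ε) = 1 := by
  have : ∀ᶠ ε in nhdsWithin (0 : ℝ) (Set.Ioi 0), ∀ m ∈ S, step (slack x₀ ε m (zε ε)) = 1 := by
    refine (Filter.eventually_all_finset S).2 fun m hm => ?_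
    have h1 : Filter.Tendsto (fun ε => 1 - inner ℝ m (zε ε - x₀) - 2 * ε)
        (nhdsWithin 0 (Set.Ioi 0)) (nhds (1 - inner ℝ m (z - x₀) - 2 * 0)) := by
      have hid : Filter.Tendsto (fun ε : ℝ => ε) (nhdsWithin 0 (Set.Ioi 0)) (nhds 0) :=
        nhdsWithin_le_nhds
      exact ((tendsto_const_nhds.inner (hlim.sub_const x₀)).const_sub 1).sub (hid.const_mul 2)
    have h2 : 0 < 1 - inner ℝ m (z - x₀) - 2 * 0 := by linarith [hz m hm]
    filter_upwards [h1.eventually_const_lt h2, self_mem_nhdsWithin] with ε hε hε0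
    refine step_of_two_le ?_
    rw [slack, le_div_iff₀ hε0]
    linarith
  filter_upwards [this] with ε hε using Finset.prod_eq_one hε

theorem measurable_indicator_of_continuousOn {K : Set (Sp d)} (hK : IsClosed K) {g : Sp d → ℝ}
    (hg : ContinuousOn g K) : Measurable (K.indicator g) := by
  classical
  have : K.indicator g = K.piecewise g 0 := by ext; simp [Set.indicator, Set.piecewise]
  rw [this]
  exact hg.measurable_piecewise continuousOn_const hK.measurableSet

/-- The integrand over a hyperplane parallel to a facet converges to the integrand over the
facet. -/
theorem tendsto_indicator_mul_cutoff {S : Finset (Sp d)} {x₀ m z : Sp d}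
    {g : Sp d → ℝ} (hg : ContinuousOn g (cell S x₀)) (hz : inner ℝ m (z - x₀) = 1)
    (hz' : ∀ m' ∈ S.erase m, inner ℝ m' (z - x₀) ≠ 1) {t : ℝ} (ht : 0 < t) {zε : ℝ → Sp d}
    (hlim : Filter.Tendsto zε (nhdsWithin 0 (Set.Ioi 0)) (nhds z))
    (hzε : ∀ ε, inner ℝ m (zε ε - x₀) = 1 - ε * t) :
    Filter.Tendsto (fun ε => (cell S x₀).indicator g (zε ε) * cutoff x₀ ε (S.erase m) (zε ε))
      (nhdsWithin 0 (Set.Ioi 0)) (nhds ((facet S x₀ m).indicator g z)) := by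
  have hcont : ∀ m' : Sp d, Filter.Tendsto (fun ε => inner ℝ m' (zε ε - x₀))
      (nhdsWithin 0 (Set.Ioi 0)) (nhds (inner ℝ m' (z - x₀))) := fun m' =>
    tendsto_const_nhds.inner (hlim.sub_const x₀)
  -- By `hz'`, either z is strictly inside all other half-spaces, where the cutoff is eventually 1,
  -- or it is strictly outside one of them, where both indicators eventually vanish.
  by_cases hall : ∀ m' ∈ S.erase m, inner ℝ m' (z - x₀) < 1
  · have hzc : z ∈ cell S x₀ := fun m' hm' => by
      by_cases h : m' = m
      · rw [h, hz]
      · exact (hall m' (Finset.mem_erase.2 ⟨h, hm'⟩)).le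
    have hmem : ∀ᶠ ε in nhdsWithin (0 : ℝ) (Set.Ioi 0), zε ε ∈ cell S x₀ := by
      have : ∀ᶠ ε in nhdsWithin (0 : ℝ) (Set.Ioi 0), ∀ m' ∈ S.erase m,
          inner ℝ m' (zε ε - x₀) < 1 :=
        (Filter.eventually_all_finset _).2 fun m' hm' =>
          (hcont m').eventually_lt_const (hall m' hm')
      filter_upwards [this, self_mem_nhdsWithin] with ε hε hε0 m' hm'
      by_cases h : m' = m
      · rw [h, hzε]
        have : 0 < ε * t := mul_pos hε0 ht
        linarith
      · exact (hε m' (Finset.mem_erase.2 ⟨h, hm'⟩)).le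
    rw [Set.indicator_of_mem (show z ∈ facet S x₀ m from ⟨hzc, hz⟩)]
    have hgl : Filter.Tendsto (fun ε => g (zε ε)) (nhdsWithin 0 (Set.Ioi 0)) (nhds (g z)) :=
      (hg z hzc).tendsto.comp (tendsto_nhdsWithin_iff.2 ⟨hlim, hmem⟩)
    refine hgl.congr' ?_
    filter_upwards [hmem, eventually_cutoff_eq_one hall hlim] with ε h1 h2
    rw [Set.indicator_of_mem h1, h2, mul_one]
  · push Not at hall
    obtain ⟨m', hm', hge⟩ := hall
    have hgt : 1 < inner ℝ m' (z - x₀) := lt_of_le_of_ne hge (hz' m' hm').symm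
    have hnot : z ∉ facet S x₀ m := fun h => absurd (h.1 m' (Finset.mem_of_mem_erase hm'))
      (not_le.2 hgt)
    rw [Set.indicator_of_notMem hnot]
    refine tendsto_const_nhds.congr' ?_
    filter_upwards [(hcont m').eventually_const_lt hgt] with ε hε
    have : zε ε ∉ cell S x₀ := fun h => absurd (h m' (Finset.mem_of_mem_erase hm'))
      (not_le.2 hε)
    rw [Set.indicator_of_notMem this, zero_mul]

theorem inner_orthCoord {x₀ m : Sp d} (hm : m ≠ 0) (s : ℝ) (y : (ℝ ∙ m)ᗮ) :
    inner ℝ m (orthCoord x₀ m (s, y) - x₀) = s * ‖m‖ := by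
  have hn : ‖m‖ ≠ 0 := norm_ne_zero_iff.2 hm
  rw [orthCoord, add_sub_cancel_left, inner_add_right, inner_smul_right,
    real_inner_self_eq_norm_sq, Submodule.mem_orthogonal_singleton_iff_inner_right.1 y.2]
  field_simp
  ring

theorem norm_le_norm_orthCoord_sub {x₀ m : Sp d} (s : ℝ) (y : (ℝ ∙ m)ᗮ) :
    ‖y‖ ≤ ‖orthCoord x₀ m (s, y) - x₀‖ := by
  rw [orthCoord, add_sub_cancel_left]
  have h := norm_add_sq_eq_norm_sq_add_norm_sq_of_inner_eq_zero ((s * ‖m‖⁻¹) • m) (y : Sp d)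
    (by rw [inner_smul_left, Submodule.mem_orthogonal_singleton_iff_inner_right.1 y.2, mul_zero])
  have : ‖(y : Sp d)‖ = ‖y‖ := rfl
  nlinarith [norm_nonneg ((s * ‖m‖⁻¹) • m), norm_nonneg (y : Sp d),
    norm_nonneg ((s * ‖m‖⁻¹) • m + (y : Sp d))]

theorem continuous_orthCoord (x₀ m : Sp d) : Continuous (orthCoord x₀ m) := by
  unfold orthCoord; fun_prop

theorem exists_norm_indicator_le {K : Set (Sp d)} (hK : IsCompact K) {g : Sp d → ℝ}
    (hg : ContinuousOn g K) : ∃ C, ∀ x, ‖K.indicator g x‖ ≤ C := by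
  obtain ⟨C, hC⟩ := hK.exists_bound_of_continuousOn hg
  refine ⟨max C 0, fun x => ?_⟩
  by_cases hx : x ∈ K
  · rw [Set.indicator_of_mem hx]; exact (hC x hx).trans (le_max_left _ _)
  · rw [Set.indicator_of_notMem hx, norm_zero]; exact le_max_right _ _

/-- The bound depends neither on ε nor on the slice and has bounded support in y, so it dominates in
both limits below, over one slice and over a whole layer. -/
theorem norm_slice_le {S S' : Finset (Sp d)} {x₀ : Sp d} {g : Sp d → ℝ} {C R : ℝ}
    (hC : ∀ x, ‖(cell S x₀).indicator g x‖ ≤ C) (hR : cell S x₀ ⊆ Metric.closedBall x₀ R)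
    (m : Sp d) (ε s : ℝ) (y : (ℝ ∙ m)ᗮ) :
    ‖(cell S x₀).indicator g (orthCoord x₀ m (s, y)) * cutoff x₀ ε S' (orthCoord x₀ m (s, y))‖ ≤
      (Metric.closedBall (0 : (ℝ ∙ m)ᗮ) R).indicator (fun _ => C) y := by
  set z := orthCoord x₀ m (s, y)
  by_cases hzK : z ∈ cell S x₀
  · have : y ∈ Metric.closedBall (0 : (ℝ ∙ m)ᗮ) R := by
      rw [mem_closedBall_zero_iff]
      refine (norm_le_norm_orthCoord_sub (x₀ := x₀) s y).trans ?_
      rw [← dist_eq_norm]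
      exact hR hzK
    rw [Set.indicator_of_mem this, norm_mul]
    exact (mul_le_mul (hC z) (norm_cutoff_le _ _ _ _) (norm_nonneg _)
      ((norm_nonneg _).trans (hC z))).trans_eq (mul_one C)
  · rw [Set.indicator_of_notMem hzK, zero_mul, norm_zero]
    exact Set.indicator_nonneg (fun _ _ => (norm_nonneg _).trans (hC z)) _

/-- Integrals over parallel hyperplanes converge to the surface integral over the facet. -/
theorem tendsto_slice_integral {S : Finset (Sp d)} {x₀ m : Sp d} (hm0 : m ≠ 0)
    (hK : Bornology.IsBounded (cell S x₀)) {g : Sp d → ℝ} (hg : ContinuousOn g (cell S x₀))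
    {t : ℝ} (ht : 0 < t) :
    Filter.Tendsto (fun ε => ∫ y : (ℝ ∙ m)ᗮ,
        (cell S x₀).indicator g (orthCoord x₀ m ((1 - ε * t) * ‖m‖⁻¹, y)) *
          cutoff x₀ ε (S.erase m) (orthCoord x₀ m ((1 - ε * t) * ‖m‖⁻¹, y)))
      (nhdsWithin 0 (Set.Ioi 0)) (nhds (∫ x in facet S x₀ m, g x ∂(surf d))) := by
  obtain ⟨C, hC⟩ := exists_norm_indicator_le
    (Metric.isCompact_of_isClosed_isBounded (isClosed_cell S x₀) hK) hg
  obtain ⟨R, hR⟩ := (Metric.isBounded_iff_subset_closedBall x₀).1 hK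
  rw [setIntegral_hyperplane hm0 (foot x₀ m) (facet_subset_range S x₀ hm0)
    (isClosed_facet S x₀ m).measurableSet]
  refine tendsto_integral_filter_of_dominated_convergence
    ((Metric.closedBall (0 : (ℝ ∙ m)ᗮ) R).indicator fun _ => C)
    (Filter.Eventually.of_forall fun ε => ?_)
    (Filter.Eventually.of_forall fun ε => Filter.Eventually.of_forall fun y => ?_) ?_ ?_
  · have hc : Continuous fun y : (ℝ ∙ m)ᗮ => orthCoord x₀ m ((1 - ε * t) * ‖m‖⁻¹, y) :=
      (continuous_orthCoord x₀ m).comp (by fun_prop)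
    exact (((measurable_indicator_of_continuousOn (isClosed_cell S x₀) hg).comp
      hc.measurable).mul ((continuous_cutoff x₀ ε _).comp hc).measurable).aestronglyMeasurable
  · exact norm_slice_le hC hR _ _ _ _
  · exact (integrable_indicator_iff Metric.isClosed_closedBall.measurableSet).2
      (integrableOn_const measure_closedBall_lt_top.ne)
  -- Almost every point of the hyperplane lies on none of the other bounding hyperplanes, as the
  -- pointwise limit requires.
  · have hae : ∀ᵐ y : (ℝ ∙ m)ᗮ, ∀ m' ∈ S.erase m,
        inner ℝ m' (hyperplaneMap m (foot x₀ m) y - x₀) ≠ 1 := by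
      refine (Filter.eventually_all_finset _).2 fun m' hm' => ?_
      exact measure_eq_zero_iff_ae_notMem.1
        (volume_hyperplaneMap_inner_eq (x₀ := x₀) hm0 (Finset.ne_of_mem_erase hm'))
    have hn : ‖m‖ ≠ 0 := norm_ne_zero_iff.2 hm0
    filter_upwards [hae] with y hy
    have h0 : orthCoord x₀ m ((1 - 0 * t) * ‖m‖⁻¹, y) = hyperplaneMap m (foot x₀ m) y := by
      simp only [orthCoord, hyperplaneMap, foot]
      rw [add_assoc]
      congr 3
      field_simp
      ring
    have hin : ∀ ε, inner ℝ m (orthCoord x₀ m ((1 - ε * t) * ‖m‖⁻¹, y) - x₀) = 1 - ε * t := by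
      intro ε
      rw [inner_orthCoord hm0, mul_assoc, inv_mul_cancel₀ hn, mul_one]
    refine tendsto_indicator_mul_cutoff hg ?_ hy ht ?_ hin
    · rw [← h0, hin]; ring
    · rw [← h0]
      have : Continuous fun ε : ℝ => orthCoord x₀ m ((1 - ε * t) * ‖m‖⁻¹, y) :=
        (continuous_orthCoord x₀ m).comp (by fun_prop)
      exact (this.tendsto 0).mono_left nhdsWithin_le_nhds

/-- The layer of width `ε` along a facet carries, in the limit, the surface measure. -/
theorem integral_layer_eq {S : Finset (Sp d)} {x₀ m : Sp d} (hm0 : m ≠ 0)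
    (hK : Bornology.IsBounded (cell S x₀)) {g : Sp d → ℝ} (hg : ContinuousOn g (cell S x₀))
    {ε : ℝ} (hε : 0 < ε) :
    ∫ x in cell S x₀, g x * (ε⁻¹ * deriv step (slack x₀ ε m x) * cutoff x₀ ε (S.erase m) x) =
      ‖m‖⁻¹ * ∫ t, deriv step t * ∫ y : (ℝ ∙ m)ᗮ,
        (cell S x₀).indicator g (orthCoord x₀ m ((1 - ε * t) * ‖m‖⁻¹, y)) *
          cutoff x₀ ε (S.erase m) (orthCoord x₀ m ((1 - ε * t) * ‖m‖⁻¹, y)) := by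
  have hn : ‖m‖ ≠ 0 := norm_ne_zero_iff.2 hm0
  have hn' : 0 < ‖m‖ := norm_pos_iff.2 hm0
  set G : Sp d → ℝ := fun x => (cell S x₀).indicator g x *
    (ε⁻¹ * deriv step (slack x₀ ε m x) * cutoff x₀ ε (S.erase m) x) with hG
  have hcont : Continuous fun x =>
      ε⁻¹ * deriv step (slack x₀ ε m x) * cutoff x₀ ε (S.erase m) x :=
    (continuous_const.mul (continuous_deriv_step.comp (continuous_slack x₀ ε m))).mul
      (continuous_cutoff _ _ _)
  have hGind : G = (cell S x₀).indicator fun x => g x *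
      (ε⁻¹ * deriv step (slack x₀ ε m x) * cutoff x₀ ε (S.erase m) x) := by
    ext x
    simp only [hG, Set.indicator_mul_left]
  have hGint : Integrable G := by
    rw [hGind, integrable_indicator_iff (isClosed_cell S x₀).measurableSet]
    exact (hg.mul hcont.continuousOn).integrableOn_compact
      (Metric.isCompact_of_isClosed_isBounded (isClosed_cell S x₀) hK)
  have hmp := measurePreserving_orthCoord x₀ hm0
  have hemb : MeasurableEmbedding (orthCoord x₀ m) := by
    refine Continuous.measurableEmbedding (continuous_orthCoord x₀ m) fun z z' h => ?_
    have h1 : z.1 = z'.1 := by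
      have := inner_orthCoord (x₀ := x₀) hm0 z.1 z.2
      rw [show (z.1, z.2) = z from rfl, h, show z' = (z'.1, z'.2) from rfl,
        inner_orthCoord hm0] at this
      exact (mul_right_cancel₀ hn this).symm
    have h2 : z.2 = z'.2 := by
      simp only [orthCoord, h1] at h
      exact Subtype.ext (add_left_cancel (add_left_cancel h))
    exact Prod.ext h1 h2
  rw [← integral_indicator (isClosed_cell S x₀).measurableSet, ← hGind,
    ← hmp.integral_comp hemb, Measure.volume_eq_prod,
    integral_prod _ (by
      rw [← Measure.volume_eq_prod]
      exact (hmp.integrable_comp_emb hemb).2 hGint)]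
  set H : ℝ → ℝ := fun s => ∫ y, G (orthCoord x₀ m (s, y)) with hH
  -- The substitution s = (1 - ε t) / ‖m‖ turns the slack into t; its Jacobian ε / ‖m‖ absorbs the
  -- factor ε⁻¹ and leaves ‖m‖⁻¹.
  have hsub : ∫ t, H ((1 - ε * t) * ‖m‖⁻¹) = (ε / ‖m‖)⁻¹ * ∫ s, H s := by
    have h1 : ∀ t, H ((1 - ε * t) * ‖m‖⁻¹) = (fun r => H (‖m‖⁻¹ - r)) ((ε / ‖m‖) * t) := by
      intro t
      congr 1
      field_simp
    simp_rw [h1]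
    rw [Measure.integral_comp_mul_left (fun r => H (‖m‖⁻¹ - r)), integral_sub_left_eq_self H,
      abs_of_pos (by positivity), smul_eq_mul]
  have hHt : ∀ t, H ((1 - ε * t) * ‖m‖⁻¹) = ε⁻¹ * (deriv step t * ∫ y : (ℝ ∙ m)ᗮ,
        (cell S x₀).indicator g (orthCoord x₀ m ((1 - ε * t) * ‖m‖⁻¹, y)) *
          cutoff x₀ ε (S.erase m) (orthCoord x₀ m ((1 - ε * t) * ‖m‖⁻¹, y))) := by
    intro t
    simp only [hH, hG]
    rw [← integral_const_mul, ← integral_const_mul]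
    refine integral_congr_ae (Filter.Eventually.of_forall fun y => ?_)
    have hs : slack x₀ ε m (orthCoord x₀ m ((1 - ε * t) * ‖m‖⁻¹, y)) = t := by
      rw [slack, inner_orthCoord hm0]
      field_simp
      ring
    simp only [hs]
    ring
  simp_rw [hHt] at hsub
  rw [integral_const_mul] at hsub
  change ∫ s, H s = _
  field_simp at hsub ⊢
  linarith

/-- A layer is a superposition of slices with weight `deriv step`, of total mass 1, and each slice
that matters tends to the facet integral. The factor ‖m‖⁻¹ converts slack into Euclidean distance.
-/
theorem tendsto_integral_layer {S : Finset (Sp d)} {x₀ m : Sp d} (hm0 : m ≠ 0)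
    (hK : Bornology.IsBounded (cell S x₀)) {g : Sp d → ℝ} (hg : ContinuousOn g (cell S x₀)) :
    Filter.Tendsto (fun ε => ∫ x in cell S x₀,
        g x * (ε⁻¹ * deriv step (slack x₀ ε m x) * cutoff x₀ ε (S.erase m) x))
      (nhdsWithin 0 (Set.Ioi 0)) (nhds (‖m‖⁻¹ * ∫ x in facet S x₀ m, g x ∂(surf d))) := by
  set I : ℝ → ℝ → ℝ := fun ε t => ∫ y : (ℝ ∙ m)ᗮ,
        (cell S x₀).indicator g (orthCoord x₀ m ((1 - ε * t) * ‖m‖⁻¹, y)) *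
          cutoff x₀ ε (S.erase m) (orthCoord x₀ m ((1 - ε * t) * ‖m‖⁻¹, y)) with hI
  suffices h : Filter.Tendsto (fun ε => ∫ t, deriv step t * I ε t) (nhdsWithin 0 (Set.Ioi 0))
      (nhds (∫ t, deriv step t * ∫ x in facet S x₀ m, g x ∂(surf d))) by
    rw [integral_mul_const, integral_deriv_step, one_mul] at h
    refine (h.const_mul ‖m‖⁻¹).congr' ?_
    filter_upwards [self_mem_nhdsWithin] with ε hε
    exact (integral_layer_eq hm0 hK hg hε).symm
  obtain ⟨C, hC⟩ := exists_norm_indicator_le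
    (Metric.isCompact_of_isClosed_isBounded (isClosed_cell S x₀) hK) hg
  obtain ⟨R, hR⟩ := (Metric.isBounded_iff_subset_closedBall x₀).1 hK
  set V : ℝ := C * volume.real (Metric.closedBall (0 : (ℝ ∙ m)ᗮ) R)
  have hmeasF : ∀ ε, Measurable fun z : ℝ × (ℝ ∙ m)ᗮ =>
      (cell S x₀).indicator g (orthCoord x₀ m ((1 - ε * z.1) * ‖m‖⁻¹, z.2)) *
          cutoff x₀ ε (S.erase m) (orthCoord x₀ m ((1 - ε * z.1) * ‖m‖⁻¹, z.2)) := by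
    intro ε
    have hc : Continuous fun z : ℝ × (ℝ ∙ m)ᗮ =>
        orthCoord x₀ m ((1 - ε * z.1) * ‖m‖⁻¹, z.2) :=
      (continuous_orthCoord x₀ m).comp (by fun_prop)
    exact ((measurable_indicator_of_continuousOn (isClosed_cell S x₀) hg).comp
      hc.measurable).mul ((continuous_cutoff x₀ ε _).comp hc).measurable
  have hbound : ∀ ε t, ‖I ε t‖ ≤ V := by
    intro ε t
    have : V = ∫ y : (ℝ ∙ m)ᗮ, (Metric.closedBall (0 : (ℝ ∙ m)ᗮ) R).indicator (fun _ => C) y := by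
      rw [integral_indicator Metric.isClosed_closedBall.measurableSet, setIntegral_const,
        smul_eq_mul, mul_comm]
    rw [this]
    refine norm_integral_le_of_norm_le ?_ (Filter.Eventually.of_forall fun y => ?_)
    · exact (integrable_indicator_iff Metric.isClosed_closedBall.measurableSet).2
        (integrableOn_const measure_closedBall_lt_top.ne)
    exact norm_slice_le hC hR _ _ _ _
  refine tendsto_integral_filter_of_dominated_convergence (fun t => ‖deriv step t‖ * V)
    (Filter.Eventually.of_forall fun ε => ?_)
    (Filter.Eventually.of_forall fun ε => Filter.Eventually.of_forall fun t => ?_)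
    (integrable_deriv_step.norm.mul_const V) (Filter.Eventually.of_forall fun t => ?_)
  · refine continuous_deriv_step.aestronglyMeasurable.mul ?_
    exact ((hmeasF ε).stronglyMeasurable.integral_prod_right').aestronglyMeasurable
  · rw [norm_mul]
    exact mul_le_mul_of_nonneg_left (hbound ε t) (norm_nonneg _)
  -- Slices with t ≤ 0 are not strictly inside the half-space of m, but they carry no weight because
  -- the step is constant there.
  · rcases le_or_gt t 0 with ht | ht
    · simp only [deriv_step_of_lt (show t < 1 by linarith), zero_mul]
      exact tendsto_const_nhds
    · exact (tendsto_slice_integral hm0 hK hg ht).const_mul _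

end Cell

/-! ### Integration by parts on a cell -/

section Cell

variable {d : ℕ}

theorem isCompact_cell {S : Finset (Sp d)} {x₀ : Sp d} (hK : Bornology.IsBounded (cell S x₀)) :
    IsCompact (cell S x₀) :=
  Metric.isCompact_of_isClosed_isBounded (isClosed_cell S x₀) hK

theorem hasFDerivAt_slack (x₀ : Sp d) (ε : ℝ) (m x : Sp d) :
    HasFDerivAt (slack x₀ ε m) (-(ε⁻¹ • innerSL ℝ m)) x := by
  have h1 : HasFDerivAt (fun x => inner ℝ m (x - x₀)) (innerSL ℝ m) x :=
    (innerSL ℝ m).hasFDerivAt.comp x ((hasFDerivAt_id x).sub_const x₀)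
  have h2 := (h1.const_sub 1).mul_const ε⁻¹
  rw [smul_neg] at h2
  exact h2.congr_of_eventuallyEq (Filter.Eventually.of_forall fun y => by
    simp [slack, div_eq_mul_inv])

theorem contDiff_cutoff (x₀ : Sp d) (ε : ℝ) (S : Finset (Sp d)) :
    ContDiff ℝ ∞ (cutoff x₀ ε S) := by
  refine contDiff_prod fun m _ => contDiff_step.comp ?_
  exact (contDiff_const.sub ((innerSL ℝ m).contDiff.comp
    (contDiff_id.sub contDiff_const))).div_const _

theorem fderiv_cutoff_single (x₀ : Sp d) (ε : ℝ) (S : Finset (Sp d)) (x : Sp d) (j : Fin d) :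
    fderiv ℝ (cutoff x₀ ε S) x (EuclideanSpace.single j 1) =
      ∑ m ∈ S, -m j * (ε⁻¹ * deriv step (slack x₀ ε m x) * cutoff x₀ ε (S.erase m) x) := by
  classical
  have h : HasFDerivAt (cutoff x₀ ε S) (∑ m ∈ S, (∏ m' ∈ S.erase m, step (slack x₀ ε m' x)) •
      (deriv step (slack x₀ ε m x) • -(ε⁻¹ • innerSL ℝ m))) x :=
    HasFDerivAt.finsetProd fun m _ =>
      (hasDerivAt_step _).comp_hasFDerivAt x (hasFDerivAt_slack x₀ ε m x)
  rw [h.fderiv, _root_.sum_apply]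
  refine Finset.sum_congr rfl fun m _ => ?_
  simp [cutoff, EuclideanSpace.inner_single_right]
  ring

theorem tsupport_cutoff_subset (x₀ : Sp d) {ε : ℝ} (hε : 0 < ε) (S : Finset (Sp d)) :
    tsupport (cutoff x₀ ε S) ⊆ {x | ∀ m ∈ S, inner ℝ m (x - x₀) < 1} := by
  have hsub : tsupport (cutoff x₀ ε S) ⊆ {x | ∀ m ∈ S, inner ℝ m (x - x₀) ≤ 1 - ε} := by
    refine closure_minimal (fun x hx m hm => ?_) ?_
    · by_contra h
      refine hx (Finset.prod_eq_zero hm (step_of_le_one ?_))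
      rw [slack, div_le_one hε]
      linarith
    · have : {x | ∀ m ∈ S, inner ℝ m (x - x₀) ≤ 1 - ε} =
          ⋂ m ∈ S, {x | inner ℝ m (x - x₀) ≤ 1 - ε} := by ext; simp
      rw [this]
      exact isClosed_biInter fun x _ => isClosed_le (by fun_prop) continuous_const
  exact hsub.trans fun x hx m hm => (hx m hm).trans_lt (by linarith)

/-- The cutoff tends to 1 at interior points, and the frontier of a convex set is null. -/
theorem tendsto_integral_mul_cutoff {S : Finset (Sp d)} (hS : 0 ∉ S) {x₀ : Sp d} {f : Sp d → ℝ}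
    (hf : IntegrableOn f (cell S x₀)) :
    Filter.Tendsto (fun ε => ∫ x in cell S x₀, f x * cutoff x₀ ε S x)
      (nhdsWithin 0 (Set.Ioi 0)) (nhds (∫ x in cell S x₀, f x)) := by
  refine tendsto_integral_filter_of_dominated_convergence (fun x => ‖f x‖)
    (Filter.Eventually.of_forall fun ε =>
      hf.aestronglyMeasurable.mul (continuous_cutoff _ _ _).aestronglyMeasurable)
    (Filter.Eventually.of_forall fun ε => Filter.Eventually.of_forall fun x => ?_) hf.norm ?_
  · rw [norm_mul]
    exact (mul_le_mul_of_nonneg_left (norm_cutoff_le _ _ _ _) (norm_nonneg _)).trans_eq (mul_one _)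
  · have hnull : ∀ᵐ x, x ∉ frontier (cell S x₀) :=
      measure_eq_zero_iff_ae_notMem.1 ((convex_cell S x₀).addHaar_frontier volume)
    filter_upwards [ae_restrict_of_ae hnull, ae_restrict_mem (isClosed_cell S x₀).measurableSet]
      with x hx hxK
    have hxi : x ∈ interior (cell S x₀) := by
      by_contra h
      exact hx ((isClosed_cell S x₀).frontier_eq ▸ ⟨hxK, h⟩)
    rw [interior_cell hS] at hxi
    refine tendsto_const_nhds.congr' ?_
    filter_upwards [eventually_cutoff_eq_one hxi tendsto_const_nhds] with ε hε
    rw [hε, mul_one]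

/-- The weak derivative accepts only test functions supported in Ω, so φ is multiplied by the
cutoff. The derivative of the cutoff is a sum of layer densities with weights -m j, and as ε tends
to 0 the layers become facet integrals with exterior normal m / ‖m‖. -/
theorem integral_mul_add_mul_eq_sum_facet {Ω : Set (Sp d)} {S : Finset (Sp d)} (hS : 0 ∉ S)
    {x₀ : Sp d} (hK : Bornology.IsBounded (cell S x₀)) (hΩ : interior (cell S x₀) ⊆ Ω)
    {j : Fin d} {v w : Sp d → ℝ} (hv : ContinuousOn v (cell S x₀))
    (hw : IntegrableOn w (cell S x₀)) (hvw : HasWeakPartial Ω j v w) {φ : Sp d → ℝ}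
    (hφ : ContDiff ℝ ∞ φ) :
    ∫ x in cell S x₀, (v x * fderiv ℝ φ x (EuclideanSpace.single j 1) + w x * φ x) =
      ∑ m ∈ S, ‖m‖⁻¹ * m j * ∫ x in facet S x₀ m, v x * φ x ∂(surf d) := by
  have hcomp := isCompact_cell hK
  have hdφ : Continuous fun x => fderiv ℝ φ x (EuclideanSpace.single j 1) :=
    (hφ.continuous_fderiv (by simp)).clm_apply continuous_const
  have hi1 : IntegrableOn (fun x => v x * fderiv ℝ φ x (EuclideanSpace.single j 1))
      (cell S x₀) := (hv.mul hdφ.continuousOn).integrableOn_compact hcomp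
  have hi2 : IntegrableOn (fun x => w x * φ x) (cell S x₀) :=
    hw.mul_continuousOn hφ.continuous.continuousOn hcomp
  have hvφ : ContinuousOn (fun x => v x * φ x) (cell S x₀) := hv.mul hφ.continuous.continuousOn
  have hlayer : ∀ ε m, IntegrableOn (fun x => v x * φ x *
      (ε⁻¹ * deriv step (slack x₀ ε m x) * cutoff x₀ ε (S.erase m) x)) (cell S x₀) := by
    intro ε m
    have : Continuous fun x =>
        ε⁻¹ * deriv step (slack x₀ ε m x) * cutoff x₀ ε (S.erase m) x :=
      (continuous_const.mul (continuous_deriv_step.comp (continuous_slack x₀ ε m))).mul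
        (continuous_cutoff _ _ _)
    exact (hvφ.mul this.continuousOn).integrableOn_compact hcomp
  have hcut : ∀ {f : Sp d → ℝ} (ε : ℝ), IntegrableOn f (cell S x₀) →
      IntegrableOn (fun x => f x * cutoff x₀ ε S x) (cell S x₀) := fun ε hf =>
    hf.mul_continuousOn (continuous_cutoff _ _ _).continuousOn hcomp
  have hid : ∀ ε : ℝ, 0 < ε →
      (∫ x in cell S x₀, v x * fderiv ℝ φ x (EuclideanSpace.single j 1) * cutoff x₀ ε S x) +
        (∫ x in cell S x₀, w x * φ x * cutoff x₀ ε S x) =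
      ∑ m ∈ S, m j * ∫ x in cell S x₀, v x * φ x *
        (ε⁻¹ * deriv step (slack x₀ ε m x) * cutoff x₀ ε (S.erase m) x) := by
    intro ε hε
    set ψ : Sp d → ℝ := fun x => φ x * cutoff x₀ ε S x with hψ
    have hχ := contDiff_cutoff x₀ ε S
    have hts : tsupport ψ ⊆ interior (cell S x₀) := by
      rw [interior_cell hS]
      exact (tsupport_mul_subset_right (f := φ)).trans (tsupport_cutoff_subset x₀ hε S)
    have hψc : HasCompactSupport ψ :=
      hcomp.of_isClosed_subset (isClosed_tsupport _) (hts.trans interior_subset)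
    have hfd : ∀ x, fderiv ℝ ψ x (EuclideanSpace.single j 1) =
        φ x * fderiv ℝ (cutoff x₀ ε S) x (EuclideanSpace.single j 1) +
          fderiv ℝ φ x (EuclideanSpace.single j 1) * cutoff x₀ ε S x := by
      intro x
      rw [hψ, fderiv_fun_mul (hφ.differentiable (by simp) x) (hχ.differentiable (by simp) x)]
      simp
      ring
    have hweak := hvw ψ (hφ.mul hχ) hψc (hts.trans hΩ)
    have hz1 : ∀ x, x ∉ interior (cell S x₀) →
        v x * fderiv ℝ ψ x (EuclideanSpace.single j 1) = 0 := by
      intro x hx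
      rw [fderiv_of_notMem_tsupport ℝ (fun h => hx (hts h))]
      simp
    have hz2 : ∀ x, x ∉ interior (cell S x₀) → w x * ψ x = 0 := by
      intro x hx
      rw [image_eq_zero_of_notMem_tsupport (fun h => hx (hts h)), mul_zero]
    -- The support of ψ lies in the interior of the cell, so integrating over Ω or over the cell
    -- makes no difference.
    have hchange : ∀ F : Sp d → ℝ, (∀ x, x ∉ interior (cell S x₀) → F x = 0) →
        ∫ x in Ω, F x = ∫ x in cell S x₀, F x := by
      intro F hF
      rw [setIntegral_eq_integral_of_forall_compl_eq_zero fun x hx => hF x fun h => hx (hΩ h),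
        setIntegral_eq_integral_of_forall_compl_eq_zero fun x hx =>
          hF x fun h => hx (interior_subset h)]
    rw [hchange _ hz1, hchange _ hz2] at hweak
    have hexp : ∀ x, v x * fderiv ℝ ψ x (EuclideanSpace.single j 1) =
        v x * fderiv ℝ φ x (EuclideanSpace.single j 1) * cutoff x₀ ε S x -
          ∑ m ∈ S, m j * (v x * φ x *
            (ε⁻¹ * deriv step (slack x₀ ε m x) * cutoff x₀ ε (S.erase m) x)) := by
      intro x
      have : ∀ m : Sp d, m j * (v x * φ x *
            (ε⁻¹ * deriv step (slack x₀ ε m x) * cutoff x₀ ε (S.erase m) x)) =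
          -(v x * φ x) * (-m j *
            (ε⁻¹ * deriv step (slack x₀ ε m x) * cutoff x₀ ε (S.erase m) x)) := fun m => by ring
      simp_rw [this]
      rw [← Finset.mul_sum, ← fderiv_cutoff_single, hfd]
      ring
    simp_rw [hexp] at hweak
    rw [integral_sub (hcut ε hi1) (integrable_finsetSum _ fun m _ => (hlayer ε m).const_mul _),
      integral_finsetSum _ fun m _ => (hlayer ε m).const_mul _] at hweak
    simp_rw [integral_const_mul] at hweak
    have : ∀ x, w x * ψ x = w x * φ x * cutoff x₀ ε S x := fun x => by rw [hψ]; ring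
    simp_rw [this] at hweak
    linarith
  have hl1 := (tendsto_integral_mul_cutoff hS hi1).add (tendsto_integral_mul_cutoff hS hi2)
  have hl2 : Filter.Tendsto (fun ε => ∑ m ∈ S, m j * ∫ x in cell S x₀, v x * φ x *
        (ε⁻¹ * deriv step (slack x₀ ε m x) * cutoff x₀ ε (S.erase m) x))
      (nhdsWithin 0 (Set.Ioi 0))
      (nhds (∑ m ∈ S, m j * (‖m‖⁻¹ * ∫ x in facet S x₀ m, v x * φ x ∂(surf d)))) :=
    tendsto_finsetSum _ fun m hm =>
      (tendsto_integral_layer (fun h => hS (h ▸ hm)) hK hvφ).const_mul _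
  rw [integral_add hi1 hi2]
  refine (tendsto_nhds_unique (hl1.congr' ?_) hl2).trans
    (Finset.sum_congr rfl fun m _ => by ring)
  filter_upwards [self_mem_nhdsWithin] with ε hε using hid ε hε

end Cell

/-! ### Boundaries of polytopes -/

section Boundary

variable {d : ℕ}

theorem IsConvexBody.exists_cell {K : Set (Sp d)} (hK : IsConvexBody K) :
    ∃ (S : Finset (Sp d)) (x₀ : Sp d), 0 ∉ S ∧ K = cell S x₀ ∧ Bornology.IsBounded (cell S x₀) := by
  obtain ⟨⟨s, rfl⟩, x₀, hx₀⟩ := hK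
  obtain ⟨S, hS, hcell⟩ := exists_finset_halfSpaces s hx₀
  refine ⟨S, x₀, hS, hcell, ?_⟩
  have : Bornology.IsBounded (convexHull ℝ (s : Set (Sp d))) :=
    isBounded_convexHull.2 s.finite_toSet.isBounded
  rw [hcell] at this
  exact this

theorem IsConvexBody.isCompact {K : Set (Sp d)} (hK : IsConvexBody K) : IsCompact K := by
  obtain ⟨S, x₀, -, rfl, hb⟩ := hK.exists_cell
  exact isCompact_cell hb

theorem IsConvexBody.isClosed {K : Set (Sp d)} (hK : IsConvexBody K) : IsClosed K :=
  hK.isCompact.isClosed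

theorem IsConvexBody.convex {K : Set (Sp d)} (hK : IsConvexBody K) : Convex ℝ K := by
  obtain ⟨⟨s, rfl⟩, -⟩ := hK
  exact convex_convexHull ℝ _

theorem IsConvexBody.frontier_subset {K : Set (Sp d)} (hK : IsConvexBody K) : frontier K ⊆ K :=
  hK.isClosed.frontier_subset

theorem IsConvexBody.isCompact_frontier {K : Set (Sp d)} (hK : IsConvexBody K) :
    IsCompact (frontier K) :=
  hK.isCompact.of_isClosed_subset isClosed_frontier hK.frontier_subset

theorem frontier_cell_eq_iUnion {S : Finset (Sp d)} (hS : 0 ∉ S) (x₀ : Sp d) :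
    frontier (cell S x₀) = ⋃ m : S, facet S x₀ m := by
  rw [frontier_cell hS]
  ext x
  simp

theorem surf_facet_lt_top {S : Finset (Sp d)} {x₀ m : Sp d} (hm : m ≠ 0)
    (hb : Bornology.IsBounded (cell S x₀)) : surf d (facet S x₀ m) < ⊤ := by
  rw [surf_eq_volume_preimage hm (foot x₀ m) (facet_subset_range S x₀ hm)]
  have hbf : Bornology.IsBounded (facet S x₀ m) := hb.subset fun x hx => hx.1
  exact ((isometry_hyperplaneMap m (foot x₀ m)).antilipschitz.isBounded_preimage hbf).measure_lt_top

theorem IsConvexBody.surf_frontier_lt_top {K : Set (Sp d)} (hK : IsConvexBody K) :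
    surf d (frontier K) < ⊤ := by
  obtain ⟨S, x₀, hS, rfl, hb⟩ := hK.exists_cell
  rw [frontier_cell hS]
  exact measure_biUnion_lt_top S.finite_toSet fun m hm =>
    surf_facet_lt_top (fun h => hS (h ▸ hm)) hb

/-- `normal K x` is the unique exterior unit normal of `K` at `x`. -/
def IsRegularPoint (K : Set (Sp d)) (x : Sp d) : Prop :=
  IsUnitNormal K x (normal K x) ∧ ∀ n, IsUnitNormal K x n → n = normal K x

theorem ae_facet_normal {S : Finset (Sp d)} (hS : 0 ∉ S) {x₀ m : Sp d} (hm : m ∈ S) :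
    ∀ᵐ x ∂((surf d).restrict (facet S x₀ m)), normal (cell S x₀) x = ‖m‖⁻¹ • m ∧
      IsRegularPoint (cell S x₀) x := by
  have hm0 : m ≠ 0 := fun h => hS (h ▸ hm)
  have h1 : ∀ᵐ x ∂(surf d), ∀ m' ∈ S.erase m, x ∉ facet S x₀ m ∩ facet S x₀ m' :=
    (Filter.eventually_all_finset _).2 fun m' hm' =>
      measure_eq_zero_iff_ae_notMem.1 (surf_facet_inter_facet hm0 (Finset.ne_of_mem_erase hm'))
  filter_upwards [ae_restrict_of_ae h1, ae_restrict_mem (isClosed_facet S x₀ m).measurableSet]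
    with x hx hxm
  obtain ⟨h2, h3⟩ := normal_of_mem_facet hm0 hm hxm fun m' hm' hne hmem =>
    hx m' (Finset.mem_erase.2 ⟨hne, hm'⟩) ⟨hxm, hmem⟩
  have h4 := normal_eq_of_existsUnique h2 h3
  exact ⟨h4, by rw [IsRegularPoint, h4]; exact ⟨h2, h3⟩⟩

theorem IsConvexBody.ae_isRegularPoint {K : Set (Sp d)} (hK : IsConvexBody K) :
    ∀ᵐ x ∂(surf d), x ∈ frontier K → IsRegularPoint K x := by
  rw [← ae_restrict_iff' isClosed_frontier.measurableSet]
  obtain ⟨S, x₀, hS, rfl, hb⟩ := hK.exists_cell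
  rw [frontier_cell hS, ae_restrict_biUnion_finset_iff]
  exact fun m hm => (ae_facet_normal hS hm).mono fun x hx => hx.2

/-- `normal` is defined by choice; its measurability comes from being almost everywhere constant on
each of finitely many facets. -/
theorem IsConvexBody.aestronglyMeasurable_normal {K : Set (Sp d)} (hK : IsConvexBody K) :
    AEStronglyMeasurable (normal K) ((surf d).restrict (frontier K)) := by
  obtain ⟨S, x₀, hS, rfl, hb⟩ := hK.exists_cell
  rw [frontier_cell_eq_iUnion hS, aestronglyMeasurable_iUnion_iff]
  rintro ⟨m, hm⟩
  exact aestronglyMeasurable_const.congr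
    ((ae_facet_normal hS hm).mono fun x hx => hx.1.symm)

theorem norm_normal_le (K : Set (Sp d)) (x : Sp d) : ‖normal K x‖ ≤ 1 := by
  unfold normal
  split_ifs with h
  · exact h.choose_spec.1.1.le
  · simp

theorem IsConvexBody.integrable_mul_normal {K : Set (Sp d)} (hK : IsConvexBody K) {f : Sp d → ℝ}
    (hf : IntegrableOn f (frontier K) (surf d)) (j : Fin d) :
    IntegrableOn (fun x => f x * normal K x j) (frontier K) (surf d) := by
  refine Integrable.mul_bdd (c := 1) hf ?_ (Filter.Eventually.of_forall fun x => ?_)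
  · exact ((EuclideanSpace.proj j : Sp d →L[ℝ] ℝ).continuous).comp_aestronglyMeasurable
      hK.aestronglyMeasurable_normal
  · exact (PiLp.norm_apply_le (normal K x) j).trans (norm_normal_le K x)

theorem IsConvexBody.integrableOn_frontier {K : Set (Sp d)} (hK : IsConvexBody K) {f : Sp d → ℝ}
    (hf : ContinuousOn f (frontier K)) : IntegrableOn f (frontier K) (surf d) :=
  hf.integrableOn_of_subset_isCompact hK.isCompact_frontier isClosed_frontier.measurableSet
    subset_rfl hK.surf_frontier_lt_top.ne

/-- **Integration by parts** on a polytope, for a continuous function with a weak partial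
derivative and a smooth function. -/
theorem IsConvexBody.integral_mul_add_mul {Ω K : Set (Sp d)} (hK : IsConvexBody K)
    (hΩ : interior K ⊆ Ω) {j : Fin d} {v w : Sp d → ℝ} (hv : ContinuousOn v K)
    (hw : IntegrableOn w K) (hvw : HasWeakPartial Ω j v w) {φ : Sp d → ℝ}
    (hφ : ContDiff ℝ ∞ φ) :
    ∫ x in K, (v x * fderiv ℝ φ x (EuclideanSpace.single j 1) + w x * φ x) =
      ∫ x in frontier K, v x * φ x * normal K x j ∂(surf d) := by
  have hint : IntegrableOn (fun x => v x * φ x * normal K x j) (frontier K) (surf d) :=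
    hK.integrable_mul_normal (hK.integrableOn_frontier
      ((hv.mono hK.frontier_subset).mul hφ.continuous.continuousOn)) j
  obtain ⟨S, x₀, hS, rfl, hb⟩ := hK.exists_cell
  rw [integral_mul_add_mul_eq_sum_facet hS hb hΩ hv hw hvw hφ]
  rw [frontier_cell_eq_iUnion hS] at hint ⊢
  -- Distinct facets overlap only in null sets, so the boundary integral splits over them.
  rw [integral_iUnion_ae (s := fun m : S => facet S x₀ m)
    (fun m => (isClosed_facet S x₀ m).measurableSet.nullMeasurableSet)
    (fun m m' hne => surf_facet_inter_facet (fun h => hS (h ▸ m.2))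
      fun h => hne (Subtype.ext h.symm)) hint, tsum_fintype,
    ← Finset.sum_coe_sort]
  refine Finset.sum_congr rfl fun m _ => ?_
  rw [← integral_const_mul]
  refine integral_congr_ae ?_
  filter_upwards [ae_facet_normal hS m.2] with x hx
  rw [hx.1]
  simp
  ring

end Boundary

/-! ### Faces of a mesh -/

section Mesh

variable {d : ℕ}

theorem eq_zero_of_eq_neg {n : Sp d} (h : n = -n) : n = 0 := by
  have h2 : (2 : ℝ) • n = 0 := by
    rw [two_smul]
    nth_rewrite 1 [h]
    exact neg_add_cancel n
  exact (smul_eq_zero.1 h2).resolve_left two_ne_zero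

theorem isUnitNormal_of_dual {f : StrongDual ℝ (Sp d)} (hf : f ≠ 0) :
    ∃ n : Sp d, ‖n‖ = 1 ∧ ∃ c : ℝ, 0 < c ∧ ∀ y, f y = c * inner ℝ n y := by
  obtain ⟨v, rfl⟩ := (InnerProductSpace.toDual ℝ (Sp d)).surjective f
  have hv : v ≠ 0 := fun h => hf (by simp [h])
  have hn : 0 < ‖v‖ := norm_pos_iff.2 hv
  refine ⟨‖v‖⁻¹ • v, norm_smul_inv_norm hv, ‖v‖, hn, fun y => ?_⟩
  rw [InnerProductSpace.toDual_apply_apply, inner_smul_left]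
  simp
  field_simp

theorem IsConvexBody.subset_closure_interior {K : Set (Sp d)} (hK : IsConvexBody K) :
    K ⊆ closure (interior K) := by
  rw [hK.convex.closure_interior_eq_closure_of_nonempty_interior hK.2]
  exact subset_closure

theorem IsConvexBody.disjoint_interior {K K' : Set (Sp d)} (hK' : IsConvexBody K')
    (h : Disjoint (interior K) (interior K')) : Disjoint (interior K) K' :=
  (h.closure_right isOpen_interior).mono_right hK'.subset_closure_interior

/-- Two convex bodies with disjoint interiors have opposite normals at a common point. -/
theorem exists_opposite_normals {K K' : Set (Sp d)} (hK : IsConvexBody K) (hK' : IsConvexBody K')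
    (h : Disjoint (interior K) (interior K')) {x : Sp d} (hx : x ∈ K) (hx' : x ∈ K') :
    ∃ n, IsUnitNormal K x n ∧ IsUnitNormal K' x (-n) := by
  obtain ⟨f, u, hf, hfK, hfK'⟩ := geometric_hahn_banach_of_nonempty_interior hK.convex hK'.convex
    (hK'.disjoint_interior h) hK.2 ⟨x, hx'⟩
  obtain ⟨n, hn, c, hc, hfn⟩ := isUnitNormal_of_dual hf
  -- A common point lies on the separating hyperplane, which therefore supports both bodies there.
  have hfx : f x = u := le_antisymm (hfK x hx) (hfK' x hx')
  refine ⟨n, ⟨hn, fun y hy => ?_⟩, ⟨by rw [norm_neg, hn], fun y hy => ?_⟩⟩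
  · have := hfK y hy
    rw [← hfx, hfn, hfn, mul_le_mul_iff_right₀ hc] at this
    rw [inner_sub_right]; linarith
  · have := hfK' y hy
    rw [← hfx, hfn, hfn, mul_le_mul_iff_right₀ hc] at this
    rw [inner_neg_left, inner_sub_right]; linarith

/-- Separation provides one pair of opposite normals, and regularity leaves no others. -/
theorem normal_eq_neg_normal {K K' : Set (Sp d)} (hK : IsConvexBody K) (hK' : IsConvexBody K')
    (h : Disjoint (interior K) (interior K')) {x : Sp d} (hx : x ∈ K) (hx' : x ∈ K')
    (hr : IsRegularPoint K x) (hr' : IsRegularPoint K' x) : normal K' x = -normal K x := by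
  obtain ⟨n, hn, hn'⟩ := exists_opposite_normals hK hK' h hx hx'
  rw [← hr.2 n hn, ← hr'.2 _ hn']

theorem IsConvexPolyhedralDomain.isOpen {Ω : Set (Sp d)} (hΩ : IsConvexPolyhedralDomain Ω) :
    IsOpen Ω := by
  obtain ⟨P, -, rfl⟩ := hΩ
  exact isOpen_interior

/-- Ω is the interior of a closed set. This places the interiors of the elements in Ω, the elements
themselves being known only to lie in its closure. -/
theorem IsConvexPolyhedralDomain.interior_closure_subset {Ω : Set (Sp d)}
    (hΩ : IsConvexPolyhedralDomain Ω) : interior (closure Ω) ⊆ Ω := by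
  obtain ⟨P, hP, rfl⟩ := hΩ
  exact interior_mono (closure_minimal interior_subset hP.isClosed)

theorem IsConvexPolyhedralDomain.convex {Ω : Set (Sp d)}
    (hΩ : IsConvexPolyhedralDomain Ω) : Convex ℝ Ω := by
  obtain ⟨P, hP, rfl⟩ := hΩ
  exact hP.convex.interior

theorem IsConvexPolyhedralDomain.isBounded {Ω : Set (Sp d)}
    (hΩ : IsConvexPolyhedralDomain Ω) : Bornology.IsBounded Ω := by
  obtain ⟨P, hP, rfl⟩ := hΩ
  exact hP.isCompact.isBounded.subset interior_subset

theorem IsConvexPolyhedralDomain.exists_normal {Ω : Set (Sp d)}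
    (hΩ : IsConvexPolyhedralDomain Ω) {x : Sp d} (hx : x ∈ frontier Ω) :
    ∃ n, IsUnitNormal (closure Ω) x n := by
  have hint : x ∉ interior (closure Ω) := fun h => by
    rw [hΩ.isOpen.frontier_eq] at hx
    exact hx.2 (hΩ.interior_closure_subset h)
  have hne : (interior (closure Ω)).Nonempty := by
    obtain ⟨P, hP, rfl⟩ := hΩ
    exact hP.2.mono (interior_maximal subset_closure isOpen_interior)
  obtain ⟨f, hf, hfx⟩ :=
    geometric_hahn_banach_of_nonempty_interior_point hΩ.convex.closure hint hne
  obtain ⟨n, hn, c, hc, hfn⟩ := isUnitNormal_of_dual hf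
  refine ⟨n, hn, fun y hy => ?_⟩
  have := hfx y hy
  rw [hfn, hfn, mul_le_mul_iff_right₀ hc] at this
  rw [inner_sub_right]; linarith

theorem IsUnitNormal.mono {K K' : Set (Sp d)} {x n : Sp d} (h : IsUnitNormal K' x n)
    (hsub : K ⊆ K') : IsUnitNormal K x n := ⟨h.1, fun y hy => h.2 y (hsub hy)⟩

variable {Ω : Set (Sp d)} {T : Finset (Set (Sp d))}

theorem IsMesh.subset_closure (hT : IsMesh Ω T) {K : Set (Sp d)} (hK : K ∈ T) : K ⊆ closure Ω := by
  rw [← hT.cover]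
  exact Set.subset_biUnion_of_mem (u := fun K => K) hK

theorem IsMesh.interior_subset (hT : IsMesh Ω T) (hΩ : IsConvexPolyhedralDomain Ω)
    {K : Set (Sp d)} (hK : K ∈ T) : interior K ⊆ Ω :=
  (interior_mono (hT.subset_closure hK)).trans hΩ.interior_closure_subset

theorem IsMesh.ae_isRegularPoint (hT : IsMesh Ω T) :
    ∀ᵐ x ∂(surf d), ∀ K ∈ T, x ∈ frontier K → IsRegularPoint K x :=
  (Filter.eventually_all_finset T).2 fun K hK => (hT.polytope K hK).ae_isRegularPoint

theorem IsMesh.normal_eq_neg (hT : IsMesh Ω T) {K K' : Set (Sp d)} (hK : K ∈ T) (hK' : K' ∈ T)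
    (hne : K ≠ K') {x : Sp d} (hx : x ∈ frontier K) (hx' : x ∈ frontier K')
    (hreg : ∀ K ∈ T, x ∈ frontier K → IsRegularPoint K x) : normal K' x = -normal K x :=
  normal_eq_neg_normal (hT.polytope K hK) (hT.polytope K' hK') (hT.disjoint K hK K' hK' hne)
    ((hT.polytope K hK).frontier_subset hx) ((hT.polytope K' hK').frontier_subset hx')
    (hreg K hK hx) (hreg K' hK' hx')

/-- Interior faces meet the boundary of the domain in a set of surface measure zero. -/
theorem IsMesh.ae_notMem_frontier (hT : IsMesh Ω T) (hΩ : IsConvexPolyhedralDomain Ω) :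
    ∀ᵐ x ∂(surf d), x ∈ skeleton T → x ∉ frontier Ω := by
  filter_upwards [hT.ae_isRegularPoint] with x hreg hx hxΩ
  obtain ⟨e, ⟨K, hK, K', hK', hne, rfl, -⟩, hxe⟩ := hx
  -- A supporting hyperplane of the domain at x supports both elements with the same normal, whereas
  -- their normals are opposite.
  obtain ⟨n, hn⟩ := hΩ.exists_normal hxΩ
  have h1 := (hreg K hK hxe.1).2 n (hn.mono (hT.subset_closure hK))
  have h2 := (hreg K' hK' hxe.2).2 n (hn.mono (hT.subset_closure hK'))
  have h3 := hT.normal_eq_neg hK hK' hne hxe.1 hxe.2 hreg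
  rw [← h1, ← h2] at h3
  have h4 : n = 0 := eq_zero_of_eq_neg h3
  have := hn.1
  rw [h4, norm_zero] at this
  exact zero_ne_one this

/-- The normal components of a vector field cancel over the interior faces. -/
theorem IsMesh.sum_normal_eq_zero (hT : IsMesh Ω T) {x : Sp d} (hx : x ∈ skeleton T)
    (hreg : ∀ K ∈ T, x ∈ frontier K → IsRegularPoint K x) (b : Sp d) :
    ∑ K ∈ T, (frontier K).indicator (fun x => inner ℝ b (normal K x)) x = 0 := by
  obtain ⟨e, ⟨K, hK, K', hK', hne, rfl, -⟩, hxe⟩ := hx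
  have hopp := hT.normal_eq_neg hK hK' hne hxe.1 hxe.2 hreg
  rw [Finset.sum_eq_add K K' hne (fun L hL ⟨hLK, hLK'⟩ => ?_) (fun h => absurd hK h)
    (fun h => absurd hK' h), Set.indicator_of_mem hxe.1, Set.indicator_of_mem hxe.2, hopp,
    inner_neg_right, add_neg_cancel]
  -- A third element at x would have a normal opposite to each of two opposite unit vectors, which
  -- is impossible.
  refine Set.indicator_of_notMem (fun hxL => ?_) _
  have h1 := hT.normal_eq_neg hK hL hLK.symm hxe.1 hxL hreg
  have h2 := hT.normal_eq_neg hK' hL hLK'.symm hxe.2 hxL hreg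
  rw [h1, hopp, neg_neg] at h2
  have h3 : normal K x = 0 := eq_zero_of_eq_neg h2.symm
  have := (hreg K hK hxe.1).1.1
  rw [h3, norm_zero] at this
  exact zero_ne_one this

/-- After exchanging sum and integral, the normals cancel at almost every point of the skeleton, and
`a` vanishes elsewhere. The factor `a` must not depend on the element. -/
theorem intSum_eq_zero_of_normal (hT : IsMesh Ω T) (β : Sp d → Sp d) (a : Sp d → ℝ)
    (ha : ∀ x ∉ skeleton T, a x = 0)
    (hint : ∀ K ∈ T, IntegrableOn (fun x => bn β K x * a x) (frontier K \ frontier Ω) (surf d)) :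
    intSum Ω T (fun K x => bn β K x * a x) = 0 := by
  have hmeas : ∀ K : Set (Sp d), MeasurableSet (frontier K \ frontier Ω) := fun K =>
    isClosed_frontier.measurableSet.diff isClosed_frontier.measurableSet
  have h1 : intSum Ω T (fun K x => bn β K x * a x) =
      ∑ K ∈ T, ∫ x, (frontier K \ frontier Ω).indicator (fun x => bn β K x * a x) x ∂(surf d) :=
    Finset.sum_congr rfl fun K _ => (integral_indicator (hmeas K)).symm
  rw [h1, ← integral_finsetSum _ fun K hK => (integrable_indicator_iff (hmeas K)).2 (hint K hK)]
  refine integral_eq_zero_of_ae ?_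
  filter_upwards [hT.ae_isRegularPoint] with x hreg
  rw [Pi.zero_apply]
  by_cases hxΓ : x ∈ frontier Ω
  · exact Finset.sum_eq_zero fun K _ => Set.indicator_of_notMem (fun h => h.2 hxΓ) _
  by_cases hxs : x ∈ skeleton T
  · have : ∀ K ∈ T, (frontier K \ frontier Ω).indicator (fun x => bn β K x * a x) x =
        (frontier K).indicator (fun y => inner ℝ (β x) (normal K y)) x * a x := by
      intro K _
      by_cases hxK : x ∈ frontier K
      · rw [Set.indicator_of_mem (show x ∈ frontier K \ frontier Ω from ⟨hxK, hxΓ⟩),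
          Set.indicator_of_mem hxK, bn]
      · rw [Set.indicator_of_notMem (fun h => hxK h.1), Set.indicator_of_notMem hxK, zero_mul]
    rw [Finset.sum_congr rfl this, ← Finset.sum_mul, hT.sum_normal_eq_zero hxs hreg, zero_mul]
  · refine Finset.sum_eq_zero fun K _ => ?_
    exact Set.indicator_apply_eq_zero.2 fun _ => by rw [ha x hxs, mul_zero]

theorem finite_interiorFaces (T : Finset (Set (Sp d))) : (interiorFaces T).Finite := by
  refine ((T ×ˢ T).finite_toSet.image fun p => frontier p.1 ∩ frontier p.2).subset ?_
  rintro e ⟨K, hK, K', hK', -, rfl, -⟩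
  exact ⟨(K, K'), by simp [hK, hK'], rfl⟩

theorem IsMesh.isCompact_skeleton (hT : IsMesh Ω T) : IsCompact (skeleton T) := by
  refine (finite_interiorFaces T).isCompact_sUnion fun e he => ?_
  obtain ⟨K, hK, K', hK', -, rfl, -⟩ := he
  exact (hT.polytope K hK).isCompact_frontier.inter_right isClosed_frontier

theorem IsMesh.inter_frontier_eq (hT : IsMesh Ω T) {K K' : Set (Sp d)} (hK : K ∈ T) (hK' : K' ∈ T)
    (hne : K ≠ K') : frontier K ∩ frontier K' = K ∩ K' := by
  have hb := hT.polytope K hK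
  have hb' := hT.polytope K' hK'
  have hd := hT.disjoint K hK K' hK' hne
  rw [hb.isClosed.frontier_eq, hb'.isClosed.frontier_eq]
  ext x
  constructor
  · rintro ⟨h1, h2⟩; exact ⟨h1.1, h2.1⟩
  · rintro ⟨h1, h2⟩
    exact ⟨⟨h1, fun h => Set.disjoint_left.1 (hb'.disjoint_interior hd) h h2⟩,
      ⟨h2, fun h => Set.disjoint_left.1 (hb.disjoint_interior hd.symm) h h1⟩⟩

/-- A convex set of positive surface measure has positive surface measure near each of its
points. -/
theorem surf_inter_ball_ne_zero {e : Set (Sp d)} (he : Convex ℝ e) (hb : Bornology.IsBounded e)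
    (hpos : surf d e ≠ 0) {x : Sp d} (hx : x ∈ e) {r : ℝ} (hr : 0 < r) :
    surf d (e ∩ Metric.ball x r) ≠ 0 := by
  obtain ⟨R, hR⟩ := (Metric.isBounded_iff_subset_closedBall x).1 hb
  have hR0 : 0 ≤ R := dist_nonneg.trans (hR hx)
  -- Contracting e towards x by the factor t moves it into the ball and, by convexity, keeps it in
  -- e; its measure only gets multiplied by a power of t.
  obtain ⟨t, ht0, ht1, htR⟩ : ∃ t : ℝ, 0 < t ∧ t ≤ 1 ∧ t * R < r := by
    refine ⟨min 1 (r / (2 * (R + 1))), by positivity, min_le_left _ _, ?_⟩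
    have : min 1 (r / (2 * (R + 1))) * R ≤ r / (2 * (R + 1)) * R :=
      mul_le_mul_of_nonneg_right (min_le_right _ _) hR0
    refine this.trans_lt ?_
    rw [div_mul_eq_mul_div, div_lt_iff₀ (by positivity)]
    nlinarith
  have hsub : AffineMap.homothety x t '' e ⊆ e ∩ Metric.ball x r := by
    rintro _ ⟨y, hy, rfl⟩
    refine ⟨?_, ?_⟩
    · rw [AffineMap.homothety_eq_lineMap]
      exact he.lineMap_mem hx hy ⟨ht0.le, ht1⟩
    · rw [Metric.mem_ball, dist_homothety_center, Real.norm_of_nonneg ht0.le]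
      rw [dist_comm]
      exact (mul_le_mul_of_nonneg_left (hR hy) ht0.le).trans_lt htR
  intro h0
  have := measure_mono_null hsub h0
  rw [surf, euclideanHausdorffMeasure_homothety_image _ _ ht0.ne'] at this
  rcases smul_eq_zero.1 this with h | h
  · exact ht0.ne' (nnnorm_eq_zero.1 (eq_zero_of_pow_eq_zero h))
  · exact hpos h

/-- A continuous function on the skeleton that vanishes almost everywhere vanishes. -/
theorem IsMesh.eq_zero_of_tr_ae_eq_zero (hT : IsMesh Ω T) (hΩ : IsConvexPolyhedralDomain Ω)
    {μ : C(skeleton T, ℝ)}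
    (h : ∀ K ∈ T, ∀ᵐ x ∂((surf d).restrict (frontier K \ frontier Ω)), tr μ x = 0) : μ = 0 := by
  ext ⟨x, hx⟩
  rw [ContinuousMap.zero_apply]
  by_contra hne
  have hopen : IsOpen {y : skeleton T | μ y ≠ 0} := isOpen_ne.preimage μ.continuous
  obtain ⟨r, hr, hball⟩ := Metric.isOpen_iff.1 hopen ⟨x, hx⟩ hne
  obtain ⟨e, he, hxe⟩ := Set.mem_sUnion.1 hx
  have hes : e ⊆ skeleton T := Set.subset_sUnion_of_mem he
  obtain ⟨K, hK, K', hK', hKK', rfl, hpos⟩ := he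
  -- The face equals K ∩ K', hence is convex and has positive measure in the ball on which μ does
  -- not vanish.
  have hconv : Convex ℝ (frontier K ∩ frontier K') := by
    rw [hT.inter_frontier_eq hK hK' hKK']
    exact (hT.polytope K hK).convex.inter (hT.polytope K' hK').convex
  have hbdd : Bornology.IsBounded (frontier K ∩ frontier K') :=
    (hT.polytope K hK).isCompact_frontier.isBounded.subset Set.inter_subset_left
  refine surf_inter_ball_ne_zero hconv hbdd hpos hxe hr ?_
  rw [measure_eq_zero_iff_ae_notMem]
  have hmeas : MeasurableSet (frontier K \ frontier Ω) :=
    isClosed_frontier.measurableSet.diff isClosed_frontier.measurableSet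
  filter_upwards [(ae_restrict_iff' hmeas).1 (h K hK), hT.ae_notMem_frontier hΩ] with y h1 h2 hy
  have hys : y ∈ skeleton T := hes hy.1
  have h3 := h1 ⟨hy.1.1, h2 hys⟩
  rw [tr, dif_pos hys] at h3
  have h4 : (⟨y, hys⟩ : skeleton T) ∈ Metric.ball ⟨x, hx⟩ r := Metric.mem_ball.2 hy.2
  exact hball h4 h3

end Mesh

/-! ### Polynomials and finite element functions -/

section Polynomials

variable {d : ℕ}

theorem contDiff_ev (p : MvPolynomial (Fin d) ℝ) : ContDiff ℝ ∞ (ev p) := by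
  induction p using MvPolynomial.induction_on with
  | C a =>
    have : ev (MvPolynomial.C a : MvPolynomial (Fin d) ℝ) = fun _ => a := by ext; simp [ev]
    rw [this]; exact contDiff_const
  | add p q hp hq =>
    have : ev (p + q) = fun x => ev p x + ev q x := by ext; simp [ev]
    rw [this]; exact hp.add hq
  | mul_X p i hp =>
    have : ev (p * MvPolynomial.X i) = fun x => ev p x * x i := by ext; simp [ev]
    rw [this]; exact hp.mul (EuclideanSpace.proj i : Sp d →L[ℝ] ℝ).contDiff

theorem continuous_ev (p : MvPolynomial (Fin d) ℝ) : Continuous (ev p) :=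
  (contDiff_ev p).continuous

theorem fderiv_ev_single (p : MvPolynomial (Fin d) ℝ) (j : Fin d) (x : Sp d) :
    fderiv ℝ (ev p) x (EuclideanSpace.single j 1) = ev (MvPolynomial.pderiv j p) x := by
  induction p using MvPolynomial.induction_on with
  | C a =>
    have : ev (MvPolynomial.C a : MvPolynomial (Fin d) ℝ) = fun _ => a := by ext; simp [ev]
    rw [this]; simp [ev]
  | add p q hp hq =>
    have : ev (p + q) = fun x => ev p x + ev q x := by ext; simp [ev]
    rw [this, fderiv_fun_add ((contDiff_ev p).differentiable (by simp) x)
      ((contDiff_ev q).differentiable (by simp) x), _root_.add_apply, hp, hq]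
    simp [ev]
  | mul_X p i hp =>
    have : ev (p * MvPolynomial.X i) =
        fun x => ev p x * (EuclideanSpace.proj i : Sp d →L[ℝ] ℝ) x := by ext; simp [ev]
    rw [this, fderiv_fun_mul ((contDiff_ev p).differentiable (by simp) x)
      (EuclideanSpace.proj i : Sp d →L[ℝ] ℝ).differentiableAt, _root_.add_apply,
      _root_.smul_apply, _root_.smul_apply, hp, ContinuousLinearMap.fderiv, Derivation.leibniz,
      MvPolynomial.pderiv_X]
    by_cases h : i = j
    · subst h; simp [ev]
    · simp [ev, h]

/-- A nonempty open set contains a box, and a polynomial is determined by its values on a product of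
infinite sets. -/
theorem eq_of_ev_eq_on_open {U : Set (Sp d)} (hU : IsOpen U) (hne : U.Nonempty)
    {p q : MvPolynomial (Fin d) ℝ} (h : ∀ x ∈ U, ev p x = ev q x) : p = q := by
  obtain ⟨x, hx⟩ := hne
  have hV : IsOpen ((fun y : Fin d → ℝ => (WithLp.toLp 2 y : Sp d)) ⁻¹' U) :=
    hU.preimage (PiLp.continuous_toLp 2 _)
  obtain ⟨r, hr, hball⟩ := Metric.isOpen_iff.1 hV x.ofLp hx
  refine MvPolynomial.funext_set (fun i => Metric.ball (x i) r) (fun i => ?_) fun y hy => ?_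
  · rw [Real.ball_eq_Ioo]; exact Set.Ioo_infinite (by linarith)
  · have hyb : y ∈ Metric.ball x.ofLp r := by rw [ball_pi _ hr]; exact hy
    exact h _ (hball hyb)

variable {Ω : Set (Sp d)} {T : Finset (Set (Sp d))}

/-- Elements cover the closure of Ω while `L2` is taken over Ω; the difference is null because Ω is
convex. -/
theorem restrict_closure_eq (hΩ : IsConvexPolyhedralDomain Ω) :
    volume.restrict (closure Ω) = volume.restrict Ω := by
  refine Measure.restrict_congr_set (Filter.EventuallyLE.antisymm ?_
    (Filter.Eventually.of_forall fun x hx => subset_closure hx))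
  have hnull := measure_eq_zero_iff_ae_notMem.1 (hΩ.convex.addHaar_frontier volume)
  filter_upwards [hnull] with x hx hxc
  by_contra h
  refine hx ?_
  rw [hΩ.isOpen.frontier_eq]
  exact ⟨hxc, h⟩

theorem IsMesh.restrict_le (hT : IsMesh Ω T) (hΩ : IsConvexPolyhedralDomain Ω) {K : Set (Sp d)}
    (hK : K ∈ T) : volume.restrict K ≤ volume.restrict Ω := by
  rw [← restrict_closure_eq hΩ]
  exact Measure.restrict_mono (hT.subset_closure hK) le_rfl

/-- Makes `elemPoly` canonical, hence linear in v. Equality almost everywhere becomes equality on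
`interior K` by continuity. -/
theorem EqOnPoly.unique (hT : IsMesh Ω T) (hΩ : IsConvexPolyhedralDomain Ω) {K : Set (Sp d)}
    (hK : K ∈ T) {v : L2 Ω} {p q : MvPolynomial (Fin d) ℝ} (hp : EqOnPoly Ω K v p)
    (hq : EqOnPoly Ω K v q) : p = q := by
  refine eq_of_ev_eq_on_open isOpen_interior (hT.polytope K hK).2 fun x hx => ?_
  have hae : ∀ᵐ x, x ∈ Ω → x ∈ K → ev p x = ev q x := by
    rw [← ae_restrict_iff' hΩ.isOpen.measurableSet]
    filter_upwards [hp, hq] with x h1 h2 hxK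
    rw [← h1 hxK, ← h2 hxK]
  have hopen : IsOpen (interior K ∩ {x | ev p x ≠ ev q x}) :=
    isOpen_interior.inter (isOpen_ne_fun (continuous_ev p) (continuous_ev q))
  have hzero : volume (interior K ∩ {x | ev p x ≠ ev q x}) = 0 := by
    rw [measure_eq_zero_iff_ae_notMem]
    filter_upwards [hae] with y hy hmem
    exact hmem.2 (hy (hT.interior_subset hΩ hK hmem.1) (interior_subset hmem.1))
  have hempty := (hopen.measure_eq_zero_iff volume).1 hzero
  by_contra hne
  exact Set.notMem_empty x (hempty ▸ ⟨hx, hne⟩)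

theorem elemPoly_spec {K : Set (Sp d)} (hK : K ∈ T) {m : ℕ} {v : L2 Ω}
    (hv : v ∈ brokenPoly Ω T m) : EqOnPoly Ω K v (elemPoly Ω K v) := by
  obtain ⟨p, -, hp⟩ := hv K hK
  have h : ∃ p, EqOnPoly Ω K v p := ⟨p, hp⟩
  rw [elemPoly, dif_pos h]
  exact h.choose_spec

theorem elemPoly_eq (hT : IsMesh Ω T) (hΩ : IsConvexPolyhedralDomain Ω) {K : Set (Sp d)}
    (hK : K ∈ T) {v : L2 Ω} {p : MvPolynomial (Fin d) ℝ} (hp : EqOnPoly Ω K v p) :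
    elemPoly Ω K v = p := by
  have h : ∃ p, EqOnPoly Ω K v p := ⟨p, hp⟩
  rw [elemPoly, dif_pos h]
  exact h.choose_spec.unique hT hΩ hK hp

theorem elemPoly_add (hT : IsMesh Ω T) (hΩ : IsConvexPolyhedralDomain Ω) {K : Set (Sp d)}
    (hK : K ∈ T) {m : ℕ} {v w : L2 Ω} (hv : v ∈ brokenPoly Ω T m) (hw : w ∈ brokenPoly Ω T m) :
    elemPoly Ω K (v + w) = elemPoly Ω K v + elemPoly Ω K w := by
  refine elemPoly_eq hT hΩ hK ?_
  filter_upwards [Lp.coeFn_add v w, elemPoly_spec hK hv, elemPoly_spec hK hw] with x h1 h2 h3 hx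
  rw [h1, Pi.add_apply, h2 hx, h3 hx]
  simp [ev]

theorem elemPoly_smul (hT : IsMesh Ω T) (hΩ : IsConvexPolyhedralDomain Ω) {K : Set (Sp d)}
    (hK : K ∈ T) {m : ℕ} (c : ℝ) {v : L2 Ω} (hv : v ∈ brokenPoly Ω T m) :
    elemPoly Ω K (c • v) = c • elemPoly Ω K v := by
  refine elemPoly_eq hT hΩ hK ?_
  filter_upwards [Lp.coeFn_smul c v, elemPoly_spec hK hv] with x h1 h2 hx
  rw [h1, Pi.smul_apply, h2 hx]
  simp [ev, MvPolynomial.smul_eval]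

theorem totalDegree_elemPoly_le (hT : IsMesh Ω T) (hΩ : IsConvexPolyhedralDomain Ω)
    {K : Set (Sp d)} (hK : K ∈ T) {m : ℕ} {v : L2 Ω} (hv : v ∈ brokenPoly Ω T m) :
    (elemPoly Ω K v).totalDegree ≤ m := by
  obtain ⟨p, hdeg, hp⟩ := hv K hK
  rwa [elemPoly_eq hT hΩ hK hp]

/-- A piecewise polynomial function that vanishes almost everywhere on the elements is zero. -/
theorem eq_zero_of_val_ae_eq_zero (hT : IsMesh Ω T) (hΩ : IsConvexPolyhedralDomain Ω)
    {m : ℕ} {v : L2 Ω}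
    (hv : v ∈ brokenPoly Ω T m) (h : ∀ K ∈ T, ∀ᵐ x ∂(volume.restrict K), val K v x = 0) :
    v = 0 := by
  rw [Lp.eq_zero_iff_ae_eq_zero]
  have h1 : ∀ᵐ x ∂(volume.restrict Ω), ∀ K ∈ T, x ∈ K → v x = val K v x :=
    (Filter.eventually_all_finset T).2 fun K hK => elemPoly_spec hK hv
  have h2 : ∀ᵐ x ∂(volume.restrict Ω), ∀ K ∈ T, x ∈ K → val K v x = 0 :=
    (Filter.eventually_all_finset T).2 fun K hK => ae_restrict_of_ae
      ((ae_restrict_iff' (hT.polytope K hK).isClosed.measurableSet).1 (h K hK))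
  have h3 : ∀ᵐ x ∂(volume.restrict Ω), x ∈ closure Ω := by
    rw [← restrict_closure_eq hΩ]
    exact ae_restrict_mem isClosed_closure.measurableSet
  filter_upwards [h1, h2, h3] with x h1 h2 h3
  rw [← hT.cover] at h3
  obtain ⟨K, hK, hx⟩ := Set.mem_iUnion₂.1 h3
  rw [h1 K hK hx, h2 K hK hx, Pi.zero_apply]

theorem finite_brokenPoly (hT : IsMesh Ω T) (hΩ : IsConvexPolyhedralDomain Ω) (m : ℕ) :
    Module.Finite ℝ (brokenPoly Ω T m) := by
  let f : brokenPoly Ω T m →ₗ[ℝ] (T → MvPolynomial.restrictTotalDegree (Fin d) ℝ m) :=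
    { toFun := fun v K => ⟨elemPoly Ω K v.1, (MvPolynomial.mem_restrictTotalDegree _ _ _).2
        (totalDegree_elemPoly_le hT hΩ K.2 v.2)⟩
      map_add' := fun v w => funext fun K => Subtype.ext (elemPoly_add hT hΩ K.2 v.2 w.2)
      map_smul' := fun c v => funext fun K => Subtype.ext (elemPoly_smul hT hΩ K.2 c v.2) }
  refine Module.Finite.of_injective f ((injective_iff_map_eq_zero f).2 fun v hv => ?_)
  refine Subtype.ext (eq_zero_of_val_ae_eq_zero hT hΩ v.2 fun K hK => Filter.Eventually.of_forall
    fun x => ?_)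
  have : elemPoly Ω K v.1 = 0 := congrArg Subtype.val (congrFun hv ⟨K, hK⟩)
  simp [val, this, ev]

theorem finite_Vh (hT : IsMesh Ω T) (hΩ : IsConvexPolyhedralDomain Ω) (k : ℕ) :
    Module.Finite ℝ (Vh Ω T k) := by
  have := finite_brokenPoly hT hΩ k
  let f : Vh Ω T k →ₗ[ℝ] (Fin d → brokenPoly Ω T k) :=
    { toFun := fun v i => ⟨v.1 i, v.2 i (Set.mem_univ i)⟩
      map_add' := fun v w => rfl
      map_smul' := fun c v => rfl }
  refine Module.Finite.of_injective f fun v w h => Subtype.ext (funext fun i => ?_)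
  exact congrArg Subtype.val (congrFun h i)

/-- A face lies in a hyperplane, so its functions do not determine a polynomial in d variables. The
space is therefore embedded in the ranges of the restriction maps, not in spaces of polynomials. -/
theorem finite_Mh (T : Finset (Set (Sp d))) (k : ℕ) : Module.Finite ℝ (Mh T k) := by
  have := (finite_interiorFaces T).to_subtype
  let R : ∀ e : Set (Sp d), MvPolynomial.restrictTotalDegree (Fin d) ℝ (k + 1) →ₗ[ℝ] (e → ℝ) :=
    fun e =>
    { toFun := fun p x => ev p.1 x
      map_add' := fun p q => by ext; simp [ev]
      map_smul' := fun c p => by ext; simp [ev, MvPolynomial.smul_eval] }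
  have hsub : ∀ e : interiorFaces T, ∀ x : (e : Set (Sp d)), (x : Sp d) ∈ skeleton T :=
    fun e x => Set.mem_sUnion_of_mem x.2 e.2
  let f : Mh T k →ₗ[ℝ] (∀ e : interiorFaces T, LinearMap.range (R e)) :=
    { toFun := fun μ e => ⟨fun x => μ.1 ⟨x, hsub e x⟩, by
        obtain ⟨p, hp, hpμ⟩ := μ.2 e e.2
        exact ⟨⟨p, (MvPolynomial.mem_restrictTotalDegree _ _ _).2 hp⟩,
          funext fun x => (hpμ ⟨x, hsub e x⟩ x.2).symm⟩⟩
      map_add' := fun μ ν => rfl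
      map_smul' := fun c μ => rfl }
  refine Module.Finite.of_injective f fun μ ν h => Subtype.ext (ContinuousMap.ext fun x => ?_)
  obtain ⟨e, he, hxe⟩ := Set.mem_sUnion.1 x.2
  exact congrFun (congrArg Subtype.val (congrFun h ⟨e, he⟩)) ⟨x, hxe⟩

end Polynomials

/-! ### The bilinear forms as integrals of pointwise bilinear forms -/

section Forms

variable {d : ℕ}

/-- A flux, a scalar and a trace. -/
abbrev Triple (Ω : Set (Sp d)) (T : Finset (Set (Sp d))) (k : ℕ) : Type :=
  Vh Ω T k × Wh Ω T k × Mh T k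

/-- Pointwise data of a triple: flux, scalar, gradient, divergence and trace. -/
abbrev Jet (d : ℕ) : Type := Sp d × ℝ × Sp d × ℝ × ℝ

variable {Ω : Set (Sp d)} {T : Finset (Set (Sp d))} {k : ℕ}

/-- The pointwise data of a triple at a point of the element `K`. -/
def jet (K : Set (Sp d)) (s : Triple Ω T k) (x : Sp d) : Jet d :=
  (vval K s.1.1 x, val K s.2.1.1 x, gradOn K s.2.1.1 x, divOn K s.1.1 x, tr s.2.2.1 x)

theorem tr_add (μ ν : C(skeleton T, ℝ)) (x : Sp d) : tr (μ + ν) x = tr μ x + tr ν x := by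
  unfold tr; split_ifs <;> simp

theorem tr_smul (c : ℝ) (μ : C(skeleton T, ℝ)) (x : Sp d) : tr (c • μ) x = c * tr μ x := by
  unfold tr; split_ifs <;> simp

/-- With its homogeneous counterpart, this reduces the linearity of all integrated forms and
functionals to linearity of their integrands in the jets. -/
theorem jet_add (hT : IsMesh Ω T) (hΩ : IsConvexPolyhedralDomain Ω) {K : Set (Sp d)}
    (hK : K ∈ T) (s t : Triple Ω T k) (x : Sp d) : jet K (s + t) x = jet K s x + jet K t x := by
  have h1 : ∀ i, elemPoly Ω K ((s.1 + t.1).1 i) = elemPoly Ω K (s.1.1 i) + elemPoly Ω K (t.1.1 i) :=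
    fun i => elemPoly_add hT hΩ hK (s.1.2 i (Set.mem_univ i)) (t.1.2 i (Set.mem_univ i))
  have h2 : elemPoly Ω K (s.2.1 + t.2.1).1 = elemPoly Ω K s.2.1.1 + elemPoly Ω K t.2.1.1 :=
    elemPoly_add hT hΩ hK s.2.1.2 t.2.1.2
  refine Prod.ext ?_ (Prod.ext ?_ (Prod.ext ?_ (Prod.ext ?_ ?_)))
  · ext i
    simp only [jet, vval, val, Prod.fst_add, PiLp.add_apply, h1, ev, map_add]
  · simp only [jet, val, Prod.snd_add, Prod.fst_add, h2, ev, map_add]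
  · ext i
    simp only [jet, gradOn, Prod.snd_add, Prod.fst_add, PiLp.add_apply, h2, ev, map_add]
  · simp only [jet, divOn, Prod.snd_add, Prod.fst_add, h1, ev, map_add, Finset.sum_add_distrib]
  · exact tr_add _ _ _

theorem jet_smul (hT : IsMesh Ω T) (hΩ : IsConvexPolyhedralDomain Ω) {K : Set (Sp d)}
    (hK : K ∈ T) (c : ℝ) (s : Triple Ω T k) (x : Sp d) : jet K (c • s) x = c • jet K s x := by
  have h1 : ∀ i, elemPoly Ω K ((c • s.1).1 i) = c • elemPoly Ω K (s.1.1 i) :=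
    fun i => elemPoly_smul hT hΩ hK c (s.1.2 i (Set.mem_univ i))
  have h2 : elemPoly Ω K (c • s.2.1).1 = c • elemPoly Ω K s.2.1.1 :=
    elemPoly_smul hT hΩ hK c s.2.1.2
  refine Prod.ext ?_ (Prod.ext ?_ (Prod.ext ?_ (Prod.ext ?_ ?_)))
  · ext i
    simp only [jet, vval, val, Prod.smul_fst, PiLp.smul_apply, h1, ev, MvPolynomial.smul_eval,
      smul_eq_mul]
  · simp only [jet, val, Prod.smul_snd, Prod.smul_fst, h2, ev, MvPolynomial.smul_eval,
      smul_eq_mul]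
  · ext i
    simp only [jet, gradOn, Prod.smul_snd, Prod.smul_fst, PiLp.smul_apply, h2, ev,
      Derivation.map_smul,
      MvPolynomial.smul_eval, smul_eq_mul]
  · simp only [jet, divOn, Prod.smul_snd, Prod.smul_fst, h1, ev, Derivation.map_smul,
      MvPolynomial.smul_eval, smul_eq_mul, Finset.mul_sum]
  · exact tr_smul _ _ _

/-- The bilinear form on triples obtained by integrating a pointwise bilinear form. -/
def integralForm (hT : IsMesh Ω T) (hΩ : IsConvexPolyhedralDomain Ω)
    (Φ : Set (Sp d) → Sp d → Jet d →ₗ[ℝ] Jet d →ₗ[ℝ] ℝ) (A : Set (Sp d) → Set (Sp d))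
    (ν : Measure (Sp d)) (hint : ∀ K ∈ T, ∀ s t : Triple Ω T k,
      IntegrableOn (fun x => Φ K x (jet K s x) (jet K t x)) (A K) ν) :
    Triple Ω T k →ₗ[ℝ] Triple Ω T k →ₗ[ℝ] ℝ :=
  LinearMap.mk₂ ℝ (fun s t => ∑ K ∈ T, ∫ x in A K, Φ K x (jet K s x) (jet K t x) ∂ν)
    (fun s s' t => by
      rw [← Finset.sum_add_distrib]
      refine Finset.sum_congr rfl fun K hK => ?_
      rw [← integral_add (hint K hK s t) (hint K hK s' t)]
      simp only [jet_add hT hΩ hK, map_add, LinearMap.add_apply])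
    (fun c s t => by
      rw [smul_eq_mul, Finset.mul_sum]
      refine Finset.sum_congr rfl fun K hK => ?_
      rw [← integral_const_mul]
      simp only [jet_smul hT hΩ hK, map_smul, LinearMap.smul_apply, smul_eq_mul])
    (fun s t t' => by
      rw [← Finset.sum_add_distrib]
      refine Finset.sum_congr rfl fun K hK => ?_
      rw [← integral_add (hint K hK s t) (hint K hK s t')]
      simp only [jet_add hT hΩ hK, map_add])
    (fun c s t => by
      rw [smul_eq_mul, Finset.mul_sum]
      refine Finset.sum_congr rfl fun K hK => ?_
      rw [← integral_const_mul]
      simp only [jet_smul hT hΩ hK, map_smul, smul_eq_mul])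

/-- The linear functional on triples obtained by integrating a pointwise linear functional. -/
def integralFunctional (hT : IsMesh Ω T) (hΩ : IsConvexPolyhedralDomain Ω)
    (Φ : Set (Sp d) → Sp d → Jet d →ₗ[ℝ] ℝ) (A : Set (Sp d) → Set (Sp d))
    (ν : Measure (Sp d)) (hint : ∀ K ∈ T, ∀ t : Triple Ω T k,
      IntegrableOn (fun x => Φ K x (jet K t x)) (A K) ν) :
    Triple Ω T k →ₗ[ℝ] ℝ where
  toFun t := ∑ K ∈ T, ∫ x in A K, Φ K x (jet K t x) ∂ν
  map_add' t t' := by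
    rw [← Finset.sum_add_distrib]
    refine Finset.sum_congr rfl fun K hK => ?_
    rw [← integral_add (hint K hK t) (hint K hK t')]
    simp only [jet_add hT hΩ hK, map_add]
  map_smul' c t := by
    rw [smul_eq_mul, Finset.mul_sum]
    refine Finset.sum_congr rfl fun K hK => ?_
    rw [RingHom.id_apply, ← integral_const_mul]
    simp only [jet_smul hT hΩ hK, map_smul, smul_eq_mul]

/-- The integrand over the elements, with reaction coefficient `c` and convection `b`. -/
def volForm (c : ℝ) (b : Sp d) : Jet d →ₗ[ℝ] Jet d →ₗ[ℝ] ℝ :=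
  LinearMap.mk₂ ℝ (fun s t => inner ℝ s.1 t.1 - s.2.1 * t.2.2.2.1 -
      inner ℝ (s.1 + s.2.1 • b) t.2.2.1 - c * s.2.1 * t.2.1)
    (fun s s' t => by simp [inner_add_left, inner_smul_left]; ring)
    (fun a s t => by simp [inner_add_left, inner_smul_left]; ring)
    (fun s t t' => by simp [inner_add_right]; ring)
    (fun a s t => by simp [inner_smul_right]; ring)

/-- The integrand over the element boundaries, with stabilization `σ`. -/
def bdForm (σ : ℝ) (n : Sp d) : Jet d →ₗ[ℝ] Jet d →ₗ[ℝ] ℝ :=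
  LinearMap.mk₂ ℝ (fun s t => (inner ℝ s.1 n + σ * s.2.1) * t.2.1)
    (fun s s' t => by simp [inner_add_left]; ring)
    (fun a s t => by simp [inner_smul_left]; ring)
    (fun s t t' => by simp; ring)
    (fun a s t => by simp; ring)

/-- The integrand over the interior part of the element boundaries, with stabilization `σ` and
normal convection `ν`. -/
def intForm (σ ν : ℝ) (n : Sp d) : Jet d →ₗ[ℝ] Jet d →ₗ[ℝ] ℝ :=
  LinearMap.mk₂ ℝ (fun s t => s.2.2.2.2 * inner ℝ t.1 n + (ν - σ) * s.2.2.2.2 * t.2.1 -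
      (inner ℝ s.1 n + ν * s.2.2.2.2 + σ * (s.2.1 - s.2.2.2.2)) * t.2.2.2.2)
    (fun s s' t => by simp [inner_add_left]; ring)
    (fun a s t => by simp [inner_smul_left]; ring)
    (fun s t t' => by simp [inner_add_left]; ring)
    (fun a s t => by simp [inner_smul_left]; ring)

/-- The pointwise product of the scalars. -/
def massForm : Jet d →ₗ[ℝ] Jet d →ₗ[ℝ] ℝ :=
  LinearMap.mk₂ ℝ (fun s t => s.2.1 * t.2.1)
    (fun s s' t => by simp; ring) (fun a s t => by simp; ring)
    (fun s t t' => by simp; ring) (fun a s t => by simp; ring)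

/-! ### Integrability -/

theorem continuous_val (K : Set (Sp d)) (v : L2 Ω) : Continuous (val K v) := continuous_ev _

theorem continuous_vval (K : Set (Sp d)) (r : Fin d → L2 Ω) : Continuous (vval K r) :=
  (PiLp.continuous_toLp 2 _).comp (continuous_pi fun i => continuous_val K (r i))

theorem continuous_gradOn (K : Set (Sp d)) (v : L2 Ω) : Continuous (gradOn K v) :=
  (PiLp.continuous_toLp 2 _).comp (continuous_pi fun _ => continuous_ev _)

theorem continuous_divOn (K : Set (Sp d)) (r : Fin d → L2 Ω) : Continuous (divOn K r) :=
  continuous_finsetSum _ fun _ _ => continuous_ev _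

theorem IsConvexBody.memLp_top_of_continuousOn {K : Set (Sp d)} (hK : IsConvexBody K)
    {f : Sp d → ℝ} (hf : ContinuousOn f (frontier K)) :
    MemLp f ⊤ ((surf d).restrict (frontier K)) := by
  obtain ⟨C, hC⟩ := hK.isCompact_frontier.exists_bound_of_continuousOn hf
  exact memLp_top_of_bound (hf.aestronglyMeasurable isClosed_frontier.measurableSet) C
    ((ae_restrict_iff' isClosed_frontier.measurableSet).2 (Filter.Eventually.of_forall hC))

theorem IsConvexBody.memLp_top_inner_normal {K : Set (Sp d)} (hK : IsConvexBody K)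
    {b : Sp d → Sp d} (hb : ContinuousOn b (frontier K)) :
    MemLp (fun x => inner ℝ (b x) (normal K x)) ⊤ ((surf d).restrict (frontier K)) := by
  obtain ⟨C, hC⟩ := hK.isCompact_frontier.exists_bound_of_continuousOn hb
  refine memLp_top_of_bound ((hb.aestronglyMeasurable isClosed_frontier.measurableSet).inner
    hK.aestronglyMeasurable_normal) C
    ((ae_restrict_iff' isClosed_frontier.measurableSet).2 (Filter.Eventually.of_forall
      fun x hx => ?_))
  refine (norm_inner_le_norm _ _).trans ?_
  calc ‖b x‖ * ‖normal K x‖ ≤ ‖b x‖ * 1 :=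
        mul_le_mul_of_nonneg_left (norm_normal_le K x) (norm_nonneg _)
    _ ≤ C := by rw [mul_one]; exact hC x hx

open Classical in
theorem memLp_top_dite {A : Set (Sp d)} (hA : IsCompact A) (μ : C(A, ℝ)) (ν : Measure (Sp d)) :
    MemLp (fun x => if hx : x ∈ A then μ ⟨x, hx⟩ else 0) ⊤ ν := by
  have := isCompact_iff_compactSpace.1 hA
  refine memLp_top_of_bound (Measurable.aestronglyMeasurable ?_) ‖μ‖
    (Filter.Eventually.of_forall fun x => ?_)
  · exact Measurable.dite μ.continuous.measurable measurable_const hA.measurableSet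
  · split_ifs
    · exact μ.norm_coe_le_norm _
    · simp

theorem memLp_top_tr (hT : IsMesh Ω T) (μ : C(skeleton T, ℝ)) (ν : Measure (Sp d)) :
    MemLp (tr μ) ⊤ ν := memLp_top_dite hT.isCompact_skeleton μ ν

theorem memLp_top_bval (hΩ : IsConvexPolyhedralDomain Ω) (g : C(frontier Ω, ℝ))
    (ν : Measure (Sp d)) : MemLp (bval g) ⊤ ν :=
  memLp_top_dite ((hΩ.isBounded.isCompact_closure).of_isClosed_subset isClosed_frontier
    frontier_subset_closure) g ν

theorem _root_.MeasureTheory.Integrable.mul_memLp_top {α : Type*} [MeasurableSpace α]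
    {ν : Measure α} {f g : α → ℝ} (hf : Integrable f ν) (hg : MemLp g ⊤ ν) :
    Integrable (fun x => f x * g x) ν := hf.mul_of_top_left hg

theorem _root_.MeasureTheory.MemLp.mul_memLp_top {α : Type*} [MeasurableSpace α]
    {ν : Measure α} {f g : α → ℝ} (hf : MemLp f ⊤ ν) (hg : MemLp g ⊤ ν) :
    MemLp (fun x => f x * g x) ⊤ ν := hg.mul hf

/-- The coefficients are regular enough for all integrals in the bilinear forms to exist. -/
structure IsAdmissible (T : Finset (Set (Sp d))) (c : Sp d → ℝ) (b : Sp d → Sp d)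
    (τ : Set (Sp d) → Sp d → ℝ) : Prop where
  reaction : ∀ K ∈ T, IntegrableOn c K
  convection : ∀ K ∈ T, ContinuousOn b K
  stabilization : ∀ K ∈ T, IntegrableOn (τ K) (frontier K) (surf d)

variable {c : Sp d → ℝ} {b : Sp d → Sp d} {τ : Set (Sp d) → Sp d → ℝ}

theorem IsMesh.integrableOn_of_continuousOn (hT : IsMesh Ω T) {K : Set (Sp d)} (hK : K ∈ T)
    {f : Sp d → ℝ} (hf : ContinuousOn f K) : IntegrableOn f K :=
  hf.integrableOn_compact (hT.polytope K hK).isCompact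

theorem IsMesh.isFiniteMeasure (hT : IsMesh Ω T) {K : Set (Sp d)} (hK : K ∈ T) :
    IsFiniteMeasure ((surf d).restrict (frontier K)) :=
  ⟨by simpa using (hT.polytope K hK).surf_frontier_lt_top⟩

theorem memLp_top_bn (hT : IsMesh Ω T) (ha : IsAdmissible T c b τ) {K : Set (Sp d)} (hK : K ∈ T) :
    MemLp (bn b K) ⊤ ((surf d).restrict (frontier K)) :=
  (hT.polytope K hK).memLp_top_inner_normal
    ((ha.convection K hK).mono (hT.polytope K hK).frontier_subset)

theorem memLp_top_rn (hT : IsMesh Ω T) {K : Set (Sp d)} (hK : K ∈ T) (r : Fin d → L2 Ω) :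
    MemLp (rn r K) ⊤ ((surf d).restrict (frontier K)) :=
  (hT.polytope K hK).memLp_top_inner_normal (continuous_vval K r).continuousOn

theorem memLp_top_val (hT : IsMesh Ω T) {K : Set (Sp d)} (hK : K ∈ T) (v : L2 Ω) :
    MemLp (val K v) ⊤ ((surf d).restrict (frontier K)) :=
  (hT.polytope K hK).memLp_top_of_continuousOn (continuous_val K v).continuousOn

theorem integrable_flux (hT : IsMesh Ω T) {K : Set (Sp d)} (hK : K ∈ T)
    (q r : Fin d → L2 Ω) : IntegrableOn (fun x => inner ℝ (vval K q x) (vval K r x)) K :=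
  hT.integrableOn_of_continuousOn hK
    ((continuous_vval K q).inner (continuous_vval K r)).continuousOn

theorem integrable_val_div (hT : IsMesh Ω T) {K : Set (Sp d)} (hK : K ∈ T)
    (y : L2 Ω) (r : Fin d → L2 Ω) : IntegrableOn (fun x => val K y x * divOn K r x) K :=
  hT.integrableOn_of_continuousOn hK
    ((continuous_val K y).mul (continuous_divOn K r)).continuousOn

theorem integrable_val_val (hT : IsMesh Ω T) {K : Set (Sp d)} (hK : K ∈ T)
    (y w : L2 Ω) : IntegrableOn (fun x => val K y x * val K w x) K :=
  hT.integrableOn_of_continuousOn hK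
    ((continuous_val K y).mul (continuous_val K w)).continuousOn

theorem integrable_convection (hT : IsMesh Ω T) (ha : IsAdmissible T c b τ) {K : Set (Sp d)}
    (hK : K ∈ T) (q : Fin d → L2 Ω) (y w : L2 Ω) :
    IntegrableOn (fun x => inner ℝ (vval K q x + val K y x • b x) (gradOn K w x)) K :=
  hT.integrableOn_of_continuousOn hK (((continuous_vval K q).continuousOn.add
    ((continuous_val K y).continuousOn.smul (ha.convection K hK))).inner
    (continuous_gradOn K w).continuousOn)

theorem integrable_reaction (hT : IsMesh Ω T) (ha : IsAdmissible T c b τ) {K : Set (Sp d)}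
    (hK : K ∈ T) (y w : L2 Ω) : IntegrableOn (fun x => c x * val K y x * val K w x) K :=
  ((ha.reaction K hK).mul_continuousOn (continuous_val K y).continuousOn
    (hT.polytope K hK).isCompact).mul_continuousOn (continuous_val K w).continuousOn
    (hT.polytope K hK).isCompact

theorem integrable_stabilization (hT : IsMesh Ω T) (ha : IsAdmissible T c b τ) (h : ℝ)
    {K : Set (Sp d)} (hK : K ∈ T) :
    IntegrableOn (fun x => h⁻¹ + τ K x) (frontier K) (surf d) := by
  have := hT.isFiniteMeasure hK
  exact (integrable_const h⁻¹).add (ha.stabilization K hK)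

theorem integrable_bd (hT : IsMesh Ω T) (ha : IsAdmissible T c b τ) (h : ℝ) {K : Set (Sp d)}
    (hK : K ∈ T) (q : Fin d → L2 Ω) (y w : L2 Ω) :
    IntegrableOn (fun x => (rn q K x + (h⁻¹ + τ K x) * val K y x) * val K w x)
      (frontier K) (surf d) := by
  have := hT.isFiniteMeasure hK
  exact (((memLp_top_rn hT hK q).integrable le_top).add
    ((integrable_stabilization hT ha h hK).mul_memLp_top (memLp_top_val hT hK y))).mul_memLp_top
    (memLp_top_val hT hK w)

theorem integrable_tr_rn (hT : IsMesh Ω T) {K : Set (Sp d)} (hK : K ∈ T)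
    (μ : C(skeleton T, ℝ)) (r : Fin d → L2 Ω) :
    IntegrableOn (fun x => tr μ x * rn r K x) (frontier K) (surf d) := by
  have := hT.isFiniteMeasure hK
  exact ((memLp_top_tr hT μ _).integrable le_top).mul_memLp_top (memLp_top_rn hT hK r)

theorem integrable_tr_val (hT : IsMesh Ω T) (ha : IsAdmissible T c b τ) (h : ℝ) {K : Set (Sp d)}
    (hK : K ∈ T) (μ : C(skeleton T, ℝ)) (w : L2 Ω) :
    IntegrableOn (fun x => (bn b K x - (h⁻¹ + τ K x)) * tr μ x * val K w x)
      (frontier K) (surf d) := by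
  have := hT.isFiniteMeasure hK
  exact ((((memLp_top_bn hT ha hK).integrable le_top).sub
    (integrable_stabilization hT ha h hK)).mul_memLp_top (memLp_top_tr hT μ _)).mul_memLp_top
    (memLp_top_val hT hK w)

theorem integrable_flux_tr (hT : IsMesh Ω T) (ha : IsAdmissible T c b τ) (h : ℝ) {K : Set (Sp d)}
    (hK : K ∈ T) (q : Fin d → L2 Ω) (y : L2 Ω) (μ ν : C(skeleton T, ℝ)) :
    IntegrableOn (fun x => (rn q K x + bn b K x * tr μ x +
      (h⁻¹ + τ K x) * (val K y x - tr μ x)) * tr ν x) (frontier K) (surf d) := by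
  have := hT.isFiniteMeasure hK
  exact ((((memLp_top_rn hT hK q).integrable le_top).add
    (((memLp_top_bn hT ha hK).integrable le_top).mul_memLp_top (memLp_top_tr hT μ _))).add
    ((integrable_stabilization hT ha h hK).mul_memLp_top
      ((memLp_top_val hT hK y).sub (memLp_top_tr hT μ _)))).mul_memLp_top (memLp_top_tr hT ν _)

/-! ### The general form -/

theorem integrable_volForm (hT : IsMesh Ω T) (ha : IsAdmissible T c b τ) :
    ∀ K ∈ T, ∀ s t : Triple Ω T k,
      IntegrableOn (fun x => volForm (c x) (b x) (jet K s x) (jet K t x)) K := fun _ hK s t =>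
  (((integrable_flux hT hK s.1.1 t.1.1).sub (integrable_val_div hT hK s.2.1.1 t.1.1)).sub
    (integrable_convection hT ha hK s.1.1 s.2.1.1 t.2.1.1)).sub
    (integrable_reaction hT ha hK s.2.1.1 t.2.1.1)

theorem integrable_bdForm (hT : IsMesh Ω T) (ha : IsAdmissible T c b τ) (h : ℝ) :
    ∀ K ∈ T, ∀ s t : Triple Ω T k, IntegrableOn
      (fun x => bdForm (h⁻¹ + τ K x) (normal K x) (jet K s x) (jet K t x))
      (frontier K) (surf d) := fun _ hK s t =>
  integrable_bd hT ha h hK s.1.1 s.2.1.1 t.2.1.1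

theorem integrable_intForm_frontier (hT : IsMesh Ω T) (ha : IsAdmissible T c b τ) (h : ℝ) :
    ∀ K ∈ T, ∀ s t : Triple Ω T k, IntegrableOn
      (fun x => intForm (h⁻¹ + τ K x) (bn b K x) (normal K x) (jet K s x) (jet K t x))
      (frontier K) (surf d) := fun _ hK s t =>
  ((integrable_tr_rn hT hK s.2.2.1 t.1.1).add
    (integrable_tr_val hT ha h hK s.2.2.1 t.2.1.1)).sub
    (integrable_flux_tr hT ha h hK s.1.1 s.2.1.1 s.2.2.1 t.2.2.1)

theorem integrable_intForm (hT : IsMesh Ω T) (ha : IsAdmissible T c b τ) (h : ℝ) :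
    ∀ K ∈ T, ∀ s t : Triple Ω T k, IntegrableOn
      (fun x => intForm (h⁻¹ + τ K x) (bn b K x) (normal K x) (jet K s x) (jet K t x))
      (frontier K \ frontier Ω) (surf d) := fun K hK s t =>
  (integrable_intForm_frontier hT ha h K hK s t).mono_set Set.sdiff_subset

/-- The embedded discontinuous Galerkin form with reaction `c`, convection `b`, stabilization
`τ`. -/
def edgForm (hT : IsMesh Ω T) (hΩ : IsConvexPolyhedralDomain Ω) (k : ℕ)
    (ha : IsAdmissible T c b τ) (h : ℝ) : Triple Ω T k →ₗ[ℝ] Triple Ω T k →ₗ[ℝ] ℝ :=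
  integralForm hT hΩ (fun _ x => volForm (c x) (b x)) (fun K => K) volume
      (integrable_volForm hT ha) +
    integralForm hT hΩ (fun K x => bdForm (h⁻¹ + τ K x) (normal K x)) frontier (surf d)
      (integrable_bdForm hT ha h) +
    integralForm hT hΩ (fun K x => intForm (h⁻¹ + τ K x) (bn b K x) (normal K x))
      (fun K => frontier K \ frontier Ω) (surf d) (integrable_intForm hT ha h)

theorem edgForm_eq (hT : IsMesh Ω T) (hΩ : IsConvexPolyhedralDomain Ω)
    (ha : IsAdmissible T c b τ) (h : ℝ) (s t : Triple Ω T k) :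
    edgForm hT hΩ k ha h s t =
      volSum T (fun K x => inner ℝ (vval K s.1.1 x) (vval K t.1.1 x))
      - volSum T (fun K x => val K s.2.1.1 x * divOn K t.1.1 x)
      - volSum T (fun K x =>
          inner ℝ (vval K s.1.1 x + val K s.2.1.1 x • b x) (gradOn K t.2.1.1 x))
      - volSum T (fun K x => c x * val K s.2.1.1 x * val K t.2.1.1 x)
      + bdSum T (fun K x =>
          (rn s.1.1 K x + (h⁻¹ + τ K x) * val K s.2.1.1 x) * val K t.2.1.1 x)
      + (intSum Ω T (fun K x => tr s.2.2.1 x * rn t.1.1 K x)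
      + intSum Ω T (fun K x => (bn b K x - (h⁻¹ + τ K x)) * tr s.2.2.1 x * val K t.2.1.1 x)
      - intSum Ω T (fun K x =>
          (rn s.1.1 K x + bn b K x * tr s.2.2.1 x +
            (h⁻¹ + τ K x) * (val K s.2.1.1 x - tr s.2.2.1 x)) * tr t.2.2.1 x)) := by
  have h1 : ∑ K ∈ T, ∫ x in K, volForm (c x) (b x) (jet K s x) (jet K t x) =
      volSum T (fun K x => inner ℝ (vval K s.1.1 x) (vval K t.1.1 x))
      - volSum T (fun K x => val K s.2.1.1 x * divOn K t.1.1 x)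
      - volSum T (fun K x =>
          inner ℝ (vval K s.1.1 x + val K s.2.1.1 x • b x) (gradOn K t.2.1.1 x))
      - volSum T (fun K x => c x * val K s.2.1.1 x * val K t.2.1.1 x) := by
    simp only [volSum, ← Finset.sum_sub_distrib]
    refine Finset.sum_congr rfl fun K hK => ?_
    have i1 := integrable_flux hT hK s.1.1 t.1.1
    have i2 := integrable_val_div hT hK s.2.1.1 t.1.1
    have i3 := integrable_convection hT ha hK s.1.1 s.2.1.1 t.2.1.1
    have i4 := integrable_reaction hT ha hK s.2.1.1 t.2.1.1
    exact (integral_sub ((i1.sub i2).sub i3) i4).trans (congrArg₂ _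
      ((integral_sub (i1.sub i2) i3).trans (congrArg₂ _ (integral_sub i1 i2) rfl)) rfl)
  have h2 : ∑ K ∈ T, ∫ x in frontier K \ frontier Ω,
        intForm (h⁻¹ + τ K x) (bn b K x) (normal K x) (jet K s x) (jet K t x) ∂(surf d) =
      intSum Ω T (fun K x => tr s.2.2.1 x * rn t.1.1 K x)
      + intSum Ω T (fun K x => (bn b K x - (h⁻¹ + τ K x)) * tr s.2.2.1 x * val K t.2.1.1 x)
      - intSum Ω T (fun K x =>
          (rn s.1.1 K x + bn b K x * tr s.2.2.1 x +
            (h⁻¹ + τ K x) * (val K s.2.1.1 x - tr s.2.2.1 x)) * tr t.2.2.1 x) := by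
    simp only [intSum, ← Finset.sum_sub_distrib, ← Finset.sum_add_distrib]
    refine Finset.sum_congr rfl fun K hK => ?_
    have i1 := (integrable_tr_rn hT hK s.2.2.1 t.1.1).mono_set
      (Set.sdiff_subset (t := frontier Ω))
    have i2 := (integrable_tr_val hT ha h hK s.2.2.1 t.2.1.1).mono_set
      (Set.sdiff_subset (t := frontier Ω))
    have i3 := (integrable_flux_tr hT ha h hK s.1.1 s.2.1.1 s.2.2.1 t.2.2.1).mono_set
      (Set.sdiff_subset (t := frontier Ω))
    exact (integral_sub (i1.add i2) i3).trans (congrArg₂ _ (integral_add i1 i2) rfl)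
  rw [← h1, ← h2]
  rfl

theorem B1_eq_edgForm (hT : IsMesh Ω T) (hΩ : IsConvexPolyhedralDomain Ω)
    (ha : IsAdmissible T (weakDiv Ω b) b τ) (h : ℝ) (s t : Triple Ω T k) :
    B1 Ω T h b τ s.1.1 s.2.1.1 s.2.2.1 t.1.1 t.2.1.1 t.2.2.1 = edgForm hT hΩ k ha h s t := by
  rw [edgForm_eq, B1]
  simp only [← sub_sub]
  ring

/-- The dual form is the state form with reversed convection and no reaction, so results on
`edgForm` serve both equations. -/
theorem B2_eq_edgForm (hT : IsMesh Ω T) (hΩ : IsConvexPolyhedralDomain Ω)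
    (ha : IsAdmissible T 0 (-b) τ) (h : ℝ) (s t : Triple Ω T k) :
    B2 Ω T h b τ s.1.1 s.2.1.1 s.2.2.1 t.1.1 t.2.1.1 t.2.2.1 = edgForm hT hΩ k ha h s t := by
  have hbn : ∀ K x, bn (-b) K x = -bn b K x := fun K x => by simp [bn]
  have h0 : volSum T (fun K x =>
      (0 : Sp d → ℝ) x * val K s.2.1.1 x * val K t.2.1.1 x) = 0 := by simp [volSum]
  have h1 : intSum Ω T (fun K x =>
      (-bn b K x - (h⁻¹ + τ K x)) * tr s.2.2.1 x * val K t.2.1.1 x) =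
      -intSum Ω T (fun K x => (bn b K x + h⁻¹ + τ K x) * tr s.2.2.1 x * val K t.2.1.1 x) := by
    simp only [intSum, ← Finset.sum_neg_distrib, ← integral_neg]
    refine Finset.sum_congr rfl fun K _ => integral_congr_ae (Filter.Eventually.of_forall
      fun x => ?_)
    ring
  rw [edgForm_eq, B2, h0]
  simp only [hbn, h1, Pi.neg_apply, smul_neg, neg_mul, ← sub_eq_add_neg]
  ring

end Forms

/-! ### Integration by parts for finite element functions -/

section IntegrationByParts

variable {d : ℕ} {Ω : Set (Sp d)} {T : Finset (Set (Sp d))} {k : ℕ}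

/-- With the constant 1 as weakly differentiable factor, `IsConvexBody.integral_mul_add_mul` becomes
the divergence theorem for smooth functions. -/
theorem hasWeakPartial_one (Ω : Set (Sp d)) (j : Fin d) :
    HasWeakPartial Ω j (fun _ => 1) (fun _ => 0) := by
  intro φ hφ hc hsub
  have hcont : Continuous fun x => fderiv ℝ φ x (EuclideanSpace.single j 1) :=
    (hφ.continuous_fderiv (by simp)).clm_apply continuous_const
  have hint : Integrable fun x => fderiv ℝ φ x (EuclideanSpace.single j 1) :=
    hcont.integrable_of_hasCompactSupport (hc.fderiv_apply ℝ _)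
  have h := integral_mul_fderiv_eq_neg_fderiv_mul_of_integrable (μ := volume)
    (f := fun _ : Sp d => (1 : ℝ)) (g := φ) (v := EuclideanSpace.single j 1) (by simp)
    (by simpa using hint) (by simpa using hφ.continuous.integrable_of_hasCompactSupport hc)
    (fun x _ => differentiableAt_const _) (fun x _ => hφ.differentiable (by simp) x)
  rw [setIntegral_eq_integral_of_forall_compl_eq_zero, h]
  · simp
  · intro x hx
    rw [fderiv_of_notMem_tsupport ℝ (fun h => hx (hsub h))]
    simp

theorem fderiv_ev_mul_single (p q : MvPolynomial (Fin d) ℝ) (j : Fin d) (x : Sp d) :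
    fderiv ℝ (ev (p * q)) x (EuclideanSpace.single j 1) =
      ev p x * ev (MvPolynomial.pderiv j q) x + ev q x * ev (MvPolynomial.pderiv j p) x := by
  rw [fderiv_ev_single, Derivation.leibniz]
  simp [ev]

theorem ev_mul (p q : MvPolynomial (Fin d) ℝ) (x : Sp d) : ev (p * q) x = ev p x * ev q x := by
  simp [ev]

/-- Integration by parts for each polynomial q_i z, summed over i. -/
theorem integral_flux_grad_add_div (hT : IsMesh Ω T) (hΩ : IsConvexPolyhedralDomain Ω)
    {K : Set (Sp d)} (hK : K ∈ T) (q : Fin d → L2 Ω) (z : L2 Ω) :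
    ∫ x in K, (inner ℝ (vval K q x) (gradOn K z x) + val K z x * divOn K q x) =
      ∫ x in frontier K, rn q K x * val K z x ∂(surf d) := by
  have hb := hT.polytope K hK
  have key : ∀ i : Fin d, ∫ x in K, (val K (q i) x * gradOn K z x i +
      val K z x * ev (MvPolynomial.pderiv i (elemPoly Ω K (q i))) x) =
      ∫ x in frontier K, val K (q i) x * val K z x * normal K x i ∂(surf d) := by
    intro i
    have h := hb.integral_mul_add_mul (hT.interior_subset hΩ hK) (j := i)
      (v := fun _ => 1) (w := fun _ => 0) continuousOn_const (integrable_zero _ _ _)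
      (hasWeakPartial_one Ω i) (contDiff_ev (elemPoly Ω K (q i) * elemPoly Ω K z))
    simp only [one_mul, zero_mul, add_zero, fderiv_ev_mul_single, ev_mul] at h
    exact h
  have i1 : ∀ i : Fin d, IntegrableOn (fun x => val K (q i) x * gradOn K z x i +
      val K z x * ev (MvPolynomial.pderiv i (elemPoly Ω K (q i))) x) K := fun i =>
    hT.integrableOn_of_continuousOn hK (((continuous_val K _).mul (continuous_ev _)).add
      ((continuous_val K z).mul (continuous_ev _))).continuousOn
  have i2 : ∀ i : Fin d, IntegrableOn (fun x => val K (q i) x * val K z x * normal K x i)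
      (frontier K) (surf d) := fun i => hb.integrable_mul_normal (hb.integrableOn_frontier
    ((continuous_val K _).mul (continuous_val K z)).continuousOn) i
  have hsum := Finset.sum_congr rfl fun (i : Fin d) (_ : i ∈ Finset.univ) => key i
  rw [← integral_finsetSum _ fun i _ => i1 i, ← integral_finsetSum _ fun i _ => i2 i] at hsum
  convert! hsum using 3 with x x
  · rw [Finset.sum_add_distrib, divOn, Finset.mul_sum]
    congr 1
    simp [PiLp.inner_apply, vval, mul_comm]
  · simp only [rn, PiLp.inner_apply, Finset.sum_mul, vval]
    refine Finset.sum_congr rfl fun i _ => ?_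
    simp
    ring

theorem isBddWeakPartial_weakPartial {j : Fin d} {v : Sp d → ℝ} (hv : MemW1Inf Ω v) :
    IsBddWeakPartial Ω j v (weakPartial Ω j v) := by
  rw [weakPartial, dif_pos (hv.2 j)]
  exact (hv.2 j).choose_spec

theorem IsMesh.integrableOn_of_memLp (hT : IsMesh Ω T) (hΩ : IsConvexPolyhedralDomain Ω)
    {K : Set (Sp d)} (hK : K ∈ T) {p : ℝ≥0∞} (hp : 1 ≤ p) {f : Sp d → ℝ}
    (hf : MemLp f p (volume.restrict Ω)) : IntegrableOn f K := by
  have : IsFiniteMeasure (volume.restrict Ω) :=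
    ⟨by simpa using hΩ.isBounded.measure_lt_top⟩
  exact (hf.integrable hp).mono_measure (hT.restrict_le hΩ hK)

theorem integrableOn_weakPartial (hT : IsMesh Ω T) (hΩ : IsConvexPolyhedralDomain Ω)
    {K : Set (Sp d)} (hK : K ∈ T) {j : Fin d} {v : Sp d → ℝ} (hv : MemW1Inf Ω v) :
    IntegrableOn (weakPartial Ω j v) K :=
  hT.integrableOn_of_memLp hΩ hK le_top (isBddWeakPartial_weakPartial hv).1

theorem integrableOn_weakDiv (hT : IsMesh Ω T) (hΩ : IsConvexPolyhedralDomain Ω)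
    {K : Set (Sp d)} (hK : K ∈ T) {β : Sp d → Sp d} (hβ : ∀ i, MemW1Inf Ω (fun x => β x i)) :
    IntegrableOn (weakDiv Ω β) K :=
  integrable_finsetSum _ fun j _ => integrableOn_weakPartial hT hΩ hK (hβ j)

/-- The divergence theorem for β y z. Only the components of β are weakly differentiable; the
polynomial y z takes the part of the smooth factor. -/
theorem integral_convection (hT : IsMesh Ω T) (hΩ : IsConvexPolyhedralDomain Ω)
    {K : Set (Sp d)} (hK : K ∈ T) {β : Sp d → Sp d} (hβc : ContinuousOn β (closure Ω))
    (hβ : ∀ i, MemW1Inf Ω (fun x => β x i)) (y z : L2 Ω) :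
    ∫ x in K, (val K y x * inner ℝ (β x) (gradOn K z x) +
        val K z x * inner ℝ (β x) (gradOn K y x) + weakDiv Ω β x * val K y x * val K z x) =
      ∫ x in frontier K, bn β K x * val K y x * val K z x ∂(surf d) := by
  have hb := hT.polytope K hK
  have hβK : ∀ i, ContinuousOn (fun x => β x i) K := fun i =>
    (EuclideanSpace.proj i : Sp d →L[ℝ] ℝ).continuous.comp_continuousOn
      (hβc.mono (hT.subset_closure hK))
  have key : ∀ i : Fin d, ∫ x in K, (β x i * (val K y x * gradOn K z x i +
      val K z x * gradOn K y x i) +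
      weakPartial Ω i (fun x => β x i) x * (val K y x * val K z x)) =
      ∫ x in frontier K, β x i * (val K y x * val K z x) * normal K x i ∂(surf d) := by
    intro i
    have h := hb.integral_mul_add_mul (hT.interior_subset hΩ hK) (j := i) (hβK i)
      (integrableOn_weakPartial (j := i) hT hΩ hK (hβ i))
      (isBddWeakPartial_weakPartial (j := i) (hβ i)).2
      (contDiff_ev (elemPoly Ω K y * elemPoly Ω K z))
    simp only [fderiv_ev_mul_single, ev_mul] at h
    exact h
  have hyz : Continuous fun x => val K y x * val K z x :=
    (continuous_val K y).mul (continuous_val K z)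
  have i1 : ∀ i : Fin d, IntegrableOn (fun x => β x i * (val K y x * gradOn K z x i +
      val K z x * gradOn K y x i) +
      weakPartial Ω i (fun x => β x i) x * (val K y x * val K z x)) K := fun i =>
    (hT.integrableOn_of_continuousOn hK ((hβK i).mul
      (((continuous_val K y).mul (continuous_ev _)).add
        ((continuous_val K z).mul (continuous_ev _))).continuousOn)).add
      ((integrableOn_weakPartial hT hΩ hK (hβ i)).mul_continuousOn hyz.continuousOn hb.isCompact)
  have i2 : ∀ i : Fin d, IntegrableOn (fun x => β x i * (val K y x * val K z x) * normal K x i)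
      (frontier K) (surf d) := fun i => hb.integrable_mul_normal (hb.integrableOn_frontier
    (((hβK i).mono hb.frontier_subset).mul hyz.continuousOn)) i
  have hsum := Finset.sum_congr rfl fun (i : Fin d) (_ : i ∈ Finset.univ) => key i
  rw [← integral_finsetSum _ fun i _ => i1 i, ← integral_finsetSum _ fun i _ => i2 i] at hsum
  convert! hsum using 3 with x x
  · simp only [PiLp.inner_apply, weakDiv, Finset.mul_sum, Finset.sum_mul, ← Finset.sum_add_distrib]
    refine Finset.sum_congr rfl fun i _ => ?_
    simp
    ring
  · simp only [bn, PiLp.inner_apply, Finset.sum_mul]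
    refine Finset.sum_congr rfl fun i _ => ?_
    simp
    ring

end IntegrationByParts

/-! ### The adjoint identity and the energy identity -/

section Identities

variable {d : ℕ} {Ω : Set (Sp d)} {T : Finset (Set (Sp d))} {k : ℕ}
  {c : Sp d → ℝ} {b : Sp d → Sp d} {τ : Set (Sp d) → Sp d → ℝ}

theorem edgForm_apply (hT : IsMesh Ω T) (hΩ : IsConvexPolyhedralDomain Ω)
    (ha : IsAdmissible T c b τ) (h : ℝ) (s t : Triple Ω T k) :
    edgForm hT hΩ k ha h s t =
      ∑ K ∈ T, ((∫ x in K, volForm (c x) (b x) (jet K s x) (jet K t x)) +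
        (∫ x in frontier K,
          bdForm (h⁻¹ + τ K x) (normal K x) (jet K s x) (jet K t x) ∂(surf d)) +
        ∫ x in frontier K \ frontier Ω,
          intForm (h⁻¹ + τ K x) (bn b K x) (normal K x) (jet K s x) (jet K t x) ∂(surf d)) := by
  rw [Finset.sum_add_distrib, Finset.sum_add_distrib]
  rfl

theorem elemPoly_neg (hT : IsMesh Ω T) (hΩ : IsConvexPolyhedralDomain Ω) {K : Set (Sp d)}
    (hK : K ∈ T) {m : ℕ} {v : L2 Ω} (hv : v ∈ brokenPoly Ω T m) :
    elemPoly Ω K (-v) = -elemPoly Ω K v := by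
  rw [← neg_one_smul ℝ v, elemPoly_smul hT hΩ hK _ hv, neg_one_smul]

theorem tr_neg (μ : C(skeleton T, ℝ)) (x : Sp d) : tr (-μ) x = -tr μ x := by
  unfold tr; split_ifs <;> simp

theorem jet_neg_snd (hT : IsMesh Ω T) (hΩ : IsConvexPolyhedralDomain Ω) {K : Set (Sp d)}
    (hK : K ∈ T) (q : Vh Ω T k) (y : Wh Ω T k) (μ : Mh T k) (x : Sp d) :
    jet K ((q, -y, -μ) : Triple Ω T k) x =
      (vval K q.1 x, -val K y.1 x, -gradOn K y.1 x, divOn K q.1 x, -tr μ.1 x) := by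
  have h : elemPoly Ω K (-y.1) = -elemPoly Ω K y.1 := elemPoly_neg hT hΩ hK y.2
  refine Prod.ext rfl (Prod.ext ?_ (Prod.ext ?_ (Prod.ext rfl ?_)))
  · simp only [jet, val, NegMemClass.coe_neg, h, ev, map_neg]
  · ext i
    simp only [jet, gradOn, NegMemClass.coe_neg, h, ev, map_neg, PiLp.neg_apply]
  · simp only [jet, NegMemClass.coe_neg, tr_neg]

theorem jet_neg_fst (hT : IsMesh Ω T) (hΩ : IsConvexPolyhedralDomain Ω) {K : Set (Sp d)}
    (hK : K ∈ T) (q : Vh Ω T k) (y : Wh Ω T k) (μ : Mh T k) (x : Sp d) :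
    jet K ((-q, y, μ) : Triple Ω T k) x =
      (-vval K q.1 x, val K y.1 x, gradOn K y.1 x, -divOn K q.1 x, tr μ.1 x) := by
  have h : ∀ i, elemPoly Ω K ((-q.1) i) = -elemPoly Ω K (q.1 i) := fun i =>
    elemPoly_neg hT hΩ hK (q.2 i (Set.mem_univ i))
  refine Prod.ext ?_ (Prod.ext rfl (Prod.ext rfl (Prod.ext ?_ rfl)))
  · ext i
    simp only [jet, vval, val, NegMemClass.coe_neg, h, ev, map_neg, PiLp.neg_apply]
  · simp only [jet, divOn, NegMemClass.coe_neg, h, ev, map_neg, Finset.sum_neg_distrib]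

/-- The forms of the state and of the dual equation are adjoint to each other. -/
theorem edgForm_add_edgForm_eq_zero (hT : IsMesh Ω T) (hΩ : IsConvexPolyhedralDomain Ω)
    {β : Sp d → Sp d} (hβc : ContinuousOn β (closure Ω)) (hβ : ∀ i, MemW1Inf Ω (fun x => β x i))
    {τ₁ τ₂ : Set (Sp d) → Sp d → ℝ} (ha₁ : IsAdmissible T (weakDiv Ω β) β τ₁)
    (ha₂ : IsAdmissible T 0 (-β) τ₂)
    (hτ : ∀ K ∈ T, ∀ᵐ x ∂((surf d).restrict (frontier K)), τ₂ K x = τ₁ K x - bn β K x)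
    (h : ℝ) (q p : Vh Ω T k) (y z : Wh Ω T k) (μ ν : Mh T k) :
    edgForm hT hΩ k ha₁ h (q, y, μ) (p, -z, -ν) +
      edgForm hT hΩ k ha₂ h (p, z, ν) (-q, y, μ) = 0 := by
  have hbn : ∀ K x, bn (-β) K x = -bn β K x := fun K x => by simp [bn]
  -- The product of the traces is single-valued, so the opposite normals cancel it. This is the only
  -- contribution that does not already cancel within an element.
  have hsum : ∑ K ∈ T, ∫ x in frontier K \ frontier Ω,
      bn β K x * (tr μ.1 x * tr ν.1 x) ∂(surf d) = 0 := by
    refine intSum_eq_zero_of_normal hT β (fun x => tr μ.1 x * tr ν.1 x)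
      (fun x hx => by simp [tr, hx]) fun K hK => ?_
    have := hT.isFiniteMeasure hK
    exact IntegrableOn.mono_set (((memLp_top_bn hT ha₁ hK).mul_memLp_top
      ((memLp_top_tr hT _ _).mul_memLp_top (memLp_top_tr hT _ _))).integrable le_top)
      Set.sdiff_subset
  rw [edgForm_apply, edgForm_apply, ← Finset.sum_add_distrib, ← hsum]
  refine Finset.sum_congr rfl fun K hK => ?_
  have hfin := hT.isFiniteMeasure hK
  -- The mass terms cancel, and the remaining volume terms are the exact derivatives handled by the
  -- two integration by parts formulas.
  have hvol : (∫ x in K, volForm (weakDiv Ω β x) (β x)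
          (jet K ((q, y, μ) : Triple Ω T k) x) (jet K ((p, -z, -ν) : Triple Ω T k) x)) +
      (∫ x in K, volForm ((0 : Sp d → ℝ) x) ((-β) x)
          (jet K ((p, z, ν) : Triple Ω T k) x) (jet K ((-q, y, μ) : Triple Ω T k) x)) =
      (∫ x in frontier K, rn q.1 K x * val K z.1 x ∂(surf d)) -
      (∫ x in frontier K, rn p.1 K x * val K y.1 x ∂(surf d)) +
      ∫ x in frontier K, bn β K x * val K y.1 x * val K z.1 x ∂(surf d) := by
    rw [← integral_flux_grad_add_div hT hΩ hK, ← integral_flux_grad_add_div hT hΩ hK,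
      ← integral_convection hT hΩ hK hβc hβ]
    have j1 : ∀ (q : Fin d → L2 Ω) (z : L2 Ω), IntegrableOn (fun x =>
        inner ℝ (vval K q x) (gradOn K z x) + val K z x * divOn K q x) K := fun q z =>
      hT.integrableOn_of_continuousOn hK (((continuous_vval K q).inner
        (continuous_gradOn K z)).add ((continuous_val K z).mul
        (continuous_divOn K q))).continuousOn
    have hβK := ha₁.convection K hK
    have j2 : IntegrableOn (fun x => val K y.1 x * inner ℝ (β x) (gradOn K z.1 x) +
        val K z.1 x * inner ℝ (β x) (gradOn K y.1 x) +
        weakDiv Ω β x * val K y.1 x * val K z.1 x) K := by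
      refine Integrable.add (hT.integrableOn_of_continuousOn hK ?_)
        (integrable_reaction hT ha₁ hK _ _)
      exact ((continuous_val K _).continuousOn.mul
        (hβK.inner (continuous_gradOn K _).continuousOn)).add
        ((continuous_val K _).continuousOn.mul
        (hβK.inner (continuous_gradOn K _).continuousOn))
    refine (integral_add (integrable_volForm hT ha₁ K hK (q, y, μ) (p, -z, -ν))
      (integrable_volForm hT ha₂ K hK (p, z, ν) (-q, y, μ))).symm.trans (Eq.trans ?_
      ((integral_add ((j1 q.1 z.1).sub (j1 p.1 y.1)) j2).trans
        (congrArg₂ _ (integral_sub (j1 _ _) (j1 _ _)) rfl)))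
    refine integral_congr_ae (Filter.Eventually.of_forall fun x => ?_)
    simp only [jet_neg_snd hT hΩ hK, jet_neg_fst hT hΩ hK]
    simp only [volForm, LinearMap.mk₂_apply, jet, Pi.neg_apply, Pi.zero_apply, Pi.sub_apply, smul_neg,
      inner_add_left, inner_neg_right,
      inner_neg_left, inner_smul_left, conj_trivial,
      real_inner_comm (vval K q.1 x) (vval K p.1 x)]
    ring
  -- By (A1) the two stabilizations differ by β·n, exactly what is needed to cancel the boundary
  -- term produced by the convection.
  have hbd : (∫ x in frontier K,
        bdForm (h⁻¹ + τ₁ K x) (normal K x)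
          (jet K ((q, y, μ) : Triple Ω T k) x) (jet K ((p, -z, -ν) : Triple Ω T k) x) ∂(surf d)) +
      (∫ x in frontier K,
        bdForm (h⁻¹ + τ₂ K x) (normal K x)
          (jet K ((p, z, ν) : Triple Ω T k) x) (jet K ((-q, y, μ) : Triple Ω T k) x) ∂(surf d)) =
      -((∫ x in frontier K, rn q.1 K x * val K z.1 x ∂(surf d)) -
      (∫ x in frontier K, rn p.1 K x * val K y.1 x ∂(surf d)) +
      ∫ x in frontier K, bn β K x * val K y.1 x * val K z.1 x ∂(surf d)) := by
    have j1 : ∀ (q : Fin d → L2 Ω) (z : L2 Ω), IntegrableOn (fun x => rn q K x * val K z x)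
        (frontier K) (surf d) := fun q z =>
      ((memLp_top_rn hT hK q).mul_memLp_top (memLp_top_val hT hK z)).integrable le_top
    have j2 : IntegrableOn (fun x => bn β K x * val K y.1 x * val K z.1 x)
        (frontier K) (surf d) :=
      (((memLp_top_bn hT ha₁ hK).mul_memLp_top (memLp_top_val hT hK _)).mul_memLp_top
        (memLp_top_val hT hK _)).integrable le_top
    refine (integral_add (integrable_bdForm hT ha₁ h K hK (q, y, μ) (p, -z, -ν))
      (integrable_bdForm hT ha₂ h K hK (p, z, ν) (-q, y, μ))).symm.trans (Eq.trans ?_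
      ((integral_neg _).trans (congrArg _
        ((integral_add ((j1 q.1 z.1).sub (j1 p.1 y.1)) j2).trans
        (congrArg₂ _ (integral_sub (j1 _ _) (j1 _ _)) rfl)))))
    refine integral_congr_ae ?_
    filter_upwards [hτ K hK] with x hx
    simp only [jet_neg_snd hT hΩ hK, jet_neg_fst hT hΩ hK]
    simp only [bdForm, LinearMap.mk₂_apply, jet, hx, rn, Pi.sub_apply]
    ring
  have hin : (∫ x in frontier K \ frontier Ω,
        intForm (h⁻¹ + τ₁ K x) (bn β K x) (normal K x)
          (jet K ((q, y, μ) : Triple Ω T k) x) (jet K ((p, -z, -ν) : Triple Ω T k) x) ∂(surf d)) +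
      (∫ x in frontier K \ frontier Ω,
        intForm (h⁻¹ + τ₂ K x) (bn (-β) K x) (normal K x)
          (jet K ((p, z, ν) : Triple Ω T k) x) (jet K ((-q, y, μ) : Triple Ω T k) x) ∂(surf d)) =
      ∫ x in frontier K \ frontier Ω, bn β K x * (tr μ.1 x * tr ν.1 x) ∂(surf d) := by
    rw [← integral_add (integrable_intForm hT ha₁ h K hK (q, y, μ) (p, -z, -ν))
      (integrable_intForm hT ha₂ h K hK (p, z, ν) (-q, y, μ))]
    refine integral_congr_ae ?_
    filter_upwards [ae_restrict_of_ae_restrict_of_subset Set.sdiff_subset (hτ K hK)] with x hx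
    simp only [jet_neg_snd hT hΩ hK, jet_neg_fst hT hΩ hK]
    simp only [intForm, LinearMap.mk₂_apply, jet, hx, hbn, inner_neg_left]
    ring
  linarith

/-- The form is definite on triples without scalar part. -/
theorem eq_zero_of_edgForm_self_eq_zero (hT : IsMesh Ω T) (hΩ : IsConvexPolyhedralDomain Ω)
    (ha : IsAdmissible T c b τ) {h : ℝ} (hh : 0 < h)
    (hτ : ∀ K ∈ T, ∀ᵐ x ∂((surf d).restrict (frontier K)), 0 ≤ τ K x - 1 / 2 * bn b K x)
    (q : Vh Ω T k) (μ : Mh T k)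
    (h0 : edgForm hT hΩ k ha h ((q, 0, μ) : Triple Ω T k) (q, 0, μ) = 0) : q = 0 ∧ μ = 0 := by
  set s : Triple Ω T k := (q, 0, μ) with hs
  have hval : ∀ K ∈ T, ∀ x, val K (0 : Wh Ω T k).1 x = 0 ∧
      gradOn K (0 : Wh Ω T k).1 x = 0 := by
    intro K hK x
    -- Values of the zero function pass through a chosen polynomial; homogeneity of the jets shows
    -- that they vanish.
    have hj : jet K (0 : Triple Ω T k) x = 0 := by
      rw [← zero_smul ℝ (0 : Triple Ω T k), jet_smul hT hΩ hK, zero_smul]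
    exact ⟨congrArg (fun j : Jet d => j.2.1) hj, congrArg (fun j : Jet d => j.2.2.1) hj⟩
  have i1 : ∀ K ∈ T, IntegrableOn (fun x => bn b K x * (tr μ.1 x * tr μ.1 x))
      (frontier K \ frontier Ω) (surf d) := fun K hK => by
    have := hT.isFiniteMeasure hK
    exact IntegrableOn.mono_set (((memLp_top_bn hT ha hK).mul_memLp_top
      ((memLp_top_tr hT _ _).mul_memLp_top (memLp_top_tr hT _ _))).integrable le_top)
      Set.sdiff_subset
  have i2 : ∀ K ∈ T, IntegrableOn (fun x => (h⁻¹ + τ K x) * (tr μ.1 x * tr μ.1 x))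
      (frontier K \ frontier Ω) (surf d) := fun K hK =>
    IntegrableOn.mono_set ((integrable_stabilization hT ha h hK).mul_memLp_top
      ((memLp_top_tr hT _ _).mul_memLp_top (memLp_top_tr hT _ _))) Set.sdiff_subset
  have hsum : ∑ K ∈ T, ∫ x in frontier K \ frontier Ω,
      bn b K x * (tr μ.1 x * tr μ.1 x) ∂(surf d) = 0 :=
    intSum_eq_zero_of_normal hT b (fun x => tr μ.1 x * tr μ.1 x)
      (fun x hx => by simp [tr, hx]) i1
  have i3 : ∀ K ∈ T, IntegrableOn (fun x => (h⁻¹ + (τ K x - 1 / 2 * bn b K x)) * tr μ.1 x ^ 2)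
      (frontier K \ frontier Ω) (surf d) := fun K hK => by
    refine (((i2 K hK).sub ((i1 K hK).const_mul (1 / 2)))).congr
      (Filter.Eventually.of_forall fun x => ?_)
    simp only [Pi.sub_apply]
    ring
  -- The interior integrand reduces to (h⁻¹ + τ - b·n) μ². One half of b·n goes into the positive
  -- coefficient, and the other half sums to zero over neighbouring elements.
  have hen : ∑ K ∈ T, ((∫ x in K, ‖vval K q.1 x‖ ^ 2) + ∫ x in frontier K \ frontier Ω,
      (h⁻¹ + (τ K x - 1 / 2 * bn b K x)) * tr μ.1 x ^ 2 ∂(surf d)) = 0 := by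
    have hK : ∀ K ∈ T, _ = _ := fun K hK =>
      show (∫ x in K, volForm (c x) (b x) (jet K s x) (jet K s x)) +
          (∫ x in frontier K,
            bdForm (h⁻¹ + τ K x) (normal K x) (jet K s x) (jet K s x) ∂(surf d)) +
          (∫ x in frontier K \ frontier Ω,
            intForm (h⁻¹ + τ K x) (bn b K x) (normal K x) (jet K s x) (jet K s x) ∂(surf d)) =
        ((∫ x in K, ‖vval K q.1 x‖ ^ 2) + ∫ x in frontier K \ frontier Ω,
          (h⁻¹ + (τ K x - 1 / 2 * bn b K x)) * tr μ.1 x ^ 2 ∂(surf d)) -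
        1 / 2 * ∫ x in frontier K \ frontier Ω, bn b K x * (tr μ.1 x * tr μ.1 x) ∂(surf d) by
      have e1 : ∀ x, volForm (c x) (b x) (jet K s x) (jet K s x) = ‖vval K q.1 x‖ ^ 2 := by
        intro x
        simp only [volForm, LinearMap.mk₂_apply, jet, hs]
        simp only [hval K hK x, inner_zero_right, real_inner_self_eq_norm_sq]
        ring
      have e2 : ∀ x, bdForm (h⁻¹ + τ K x) (normal K x) (jet K s x) (jet K s x) = 0 := by
        intro x
        simp only [bdForm, LinearMap.mk₂_apply, jet, hs]
        simp only [hval K hK x, mul_zero]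
      have e3 : ∫ x in frontier K \ frontier Ω,
            intForm (h⁻¹ + τ K x) (bn b K x) (normal K x) (jet K s x) (jet K s x) ∂(surf d) =
          (∫ x in frontier K \ frontier Ω,
            (h⁻¹ + (τ K x - 1 / 2 * bn b K x)) * tr μ.1 x ^ 2 ∂(surf d)) -
          1 / 2 * ∫ x in frontier K \ frontier Ω,
            bn b K x * (tr μ.1 x * tr μ.1 x) ∂(surf d) := by
        rw [← integral_const_mul, ← integral_sub (i3 K hK) ((i1 K hK).const_mul _)]
        refine integral_congr_ae (Filter.Eventually.of_forall fun x => ?_)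
        simp only [intForm, LinearMap.mk₂_apply, jet, hs]
        simp only [hval K hK x]
        ring
      simp only [e1, e2, e3, integral_zero]
      ring
    rw [edgForm_apply, Finset.sum_congr rfl hK, Finset.sum_sub_distrib, ← Finset.mul_sum, hsum,
      mul_zero, sub_zero] at h0
    exact h0
  have hpos : ∀ K ∈ T, ∀ᵐ x ∂((surf d).restrict (frontier K \ frontier Ω)),
      0 < h⁻¹ + (τ K x - 1 / 2 * bn b K x) := fun K hK => by
    filter_upwards [ae_restrict_of_ae_restrict_of_subset Set.sdiff_subset (hτ K hK)] with x hx
    exact add_pos_of_pos_of_nonneg (inv_pos.2 hh) hx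
  have n1 : ∀ K, 0 ≤ ∫ x in K, ‖vval K q.1 x‖ ^ 2 := fun K => integral_nonneg fun x => by positivity
  have n2' : ∀ K ∈ T, 0 ≤ᵐ[(surf d).restrict (frontier K \ frontier Ω)] fun x =>
      (h⁻¹ + (τ K x - 1 / 2 * bn b K x)) * tr μ.1 x ^ 2 := fun K hK => by
    filter_upwards [hpos K hK] with x hx
    exact mul_nonneg hx.le (sq_nonneg _)
  have n2 := fun K hK => integral_nonneg_of_ae (n2' K hK)
  have hzero := (Finset.sum_eq_zero_iff_of_nonneg fun K hK => add_nonneg (n1 K) (n2 K hK)).1 hen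
  constructor
  · refine Subtype.ext (funext fun i => ?_)
    refine eq_zero_of_val_ae_eq_zero hT hΩ (q.2 i (Set.mem_univ i)) fun K hK => ?_
    have h1 : ∫ x in K, ‖vval K q.1 x‖ ^ 2 = 0 := by
      linarith [hzero K hK, n1 K, n2 K hK]
    have i4 : IntegrableOn (fun x => ‖vval K q.1 x‖ ^ 2) K :=
      hT.integrableOn_of_continuousOn hK ((continuous_vval K q.1).norm.pow 2).continuousOn
    have h2 := (integral_eq_zero_iff_of_nonneg (fun x => by positivity) i4).1 h1
    filter_upwards [h2] with x hx
    have hx' : vval K q.1 x = 0 := by simpa using hx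
    exact congrArg (fun v : Sp d => v i) hx'
  · refine Subtype.ext (hT.eq_zero_of_tr_ae_eq_zero hΩ fun K hK => ?_)
    have h1 : ∫ x in frontier K \ frontier Ω,
        (h⁻¹ + (τ K x - 1 / 2 * bn b K x)) * tr μ.1 x ^ 2 ∂(surf d) = 0 := by
      linarith [hzero K hK, n1 K, n2 K hK]
    have h2 := (integral_eq_zero_iff_of_nonneg_ae (n2' K hK) (i3 K hK)).1 h1
    filter_upwards [h2, hpos K hK] with x hx hp
    exact pow_eq_zero_iff two_ne_zero |>.1 ((mul_eq_zero.1 hx).resolve_left hp.ne')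

end Identities

/-! ### The optimality system as a linear system -/

section System

variable {d : ℕ} {Ω : Set (Sp d)} {T : Finset (Set (Sp d))} {k : ℕ}
  {c : Sp d → ℝ} {b : Sp d → Sp d} {τ : Set (Sp d) → Sp d → ℝ}

/-- The inner product of `W_h`, computed elementwise. -/
def elemInner (hT : IsMesh Ω T) (hΩ : IsConvexPolyhedralDomain Ω) (k : ℕ) :
    Wh Ω T k →ₗ[ℝ] Wh Ω T k →ₗ[ℝ] ℝ :=
  (integralForm (k := k) hT hΩ (fun _ _ => massForm) (fun K => K) volume
    (fun _ hK s t => integrable_val_val hT hK s.2.1.1 t.2.1.1)).compl₁₂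
    (LinearMap.inr ℝ (Vh Ω T k) (Wh Ω T k × Mh T k) ∘ₗ LinearMap.inl ℝ (Wh Ω T k) (Mh T k))
    (LinearMap.inr ℝ (Vh Ω T k) (Wh Ω T k × Mh T k) ∘ₗ LinearMap.inl ℝ (Wh Ω T k) (Mh T k))

theorem elemInner_apply (hT : IsMesh Ω T) (hΩ : IsConvexPolyhedralDomain Ω) (y w : Wh Ω T k) :
    elemInner hT hΩ k y w = volSum T (fun K x => val K y.1 x * val K w.1 x) := rfl

theorem elemInner_comm (hT : IsMesh Ω T) (hΩ : IsConvexPolyhedralDomain Ω) (y w : Wh Ω T k) :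
    elemInner hT hΩ k y w = elemInner hT hΩ k w y := by
  simp only [elemInner_apply, mul_comm]

theorem elemInner_self_nonneg (hT : IsMesh Ω T) (hΩ : IsConvexPolyhedralDomain Ω)
    (w : Wh Ω T k) : 0 ≤ elemInner hT hΩ k w w := by
  rw [elemInner_apply]
  exact Finset.sum_nonneg fun K _ => integral_nonneg fun x => mul_self_nonneg _

theorem eq_zero_of_elemInner_self_eq_zero (hT : IsMesh Ω T) (hΩ : IsConvexPolyhedralDomain Ω)
    {w : Wh Ω T k} (h : elemInner hT hΩ k w w = 0) : w = 0 := by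
  rw [elemInner_apply] at h
  have hn : ∀ K, 0 ≤ fun x => val K w.1 x * val K w.1 x := fun K x => mul_self_nonneg _
  have h0 := (Finset.sum_eq_zero_iff_of_nonneg fun K _ => integral_nonneg (hn K)).1 h
  refine Subtype.ext (eq_zero_of_val_ae_eq_zero hT hΩ w.2 fun K hK => ?_)
  filter_upwards [(integral_eq_zero_iff_of_nonneg (hn K) (integrable_val_val hT hK _ _)).1
    (h0 K hK)] with x hx
  exact mul_self_eq_zero.1 hx

/-! ### Data functionals and the assembled linear system. -/

/-- Multiplication of the scalar by `a`. -/
def sourceForm (a : ℝ) : Jet d →ₗ[ℝ] ℝ where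
  toFun t := a * t.2.1
  map_add' s t := by simp [mul_add]
  map_smul' a t := by simp; ring

/-- The integrand of the boundary data `g`, with normal coefficient `σ`. -/
def dirichletForm (g σ : ℝ) (n : Sp d) : Jet d →ₗ[ℝ] ℝ where
  toFun t := g * (σ * t.2.1 + inner ℝ t.1 n)
  map_add' s t := by simp [inner_add_left]; ring
  map_smul' a t := by simp [inner_smul_left]; ring

theorem integrable_source (hT : IsMesh Ω T) (hΩ : IsConvexPolyhedralDomain Ω) (f : L2 Ω)
    {K : Set (Sp d)} (hK : K ∈ T) (w : L2 Ω) : IntegrableOn (fun x => f x * val K w x) K :=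
  (hT.integrableOn_of_memLp hΩ hK one_le_two (Lp.memLp f)).mul_continuousOn
    (continuous_val K w).continuousOn (hT.polytope K hK).isCompact

theorem integrable_dirichlet (hT : IsMesh Ω T) (hΩ : IsConvexPolyhedralDomain Ω)
    (ha : IsAdmissible T c b τ) (h : ℝ) (g : C(frontier Ω, ℝ)) {K : Set (Sp d)} (hK : K ∈ T)
    (w : L2 Ω) (r : Fin d → L2 Ω) :
    IntegrableOn (fun x => bval g x * ((bn b K x - τ K x - h⁻¹) * val K w x + rn r K x))
      (frontier K ∩ frontier Ω) (surf d) := by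
  have := hT.isFiniteMeasure hK
  refine IntegrableOn.mono_set ?_ Set.inter_subset_left
  refine Integrable.congr ((((((memLp_top_bn hT ha hK).integrable le_top).sub
    (ha.stabilization K hK)).sub (integrable_const h⁻¹)).mul_memLp_top
    (memLp_top_val hT hK w)).add ((memLp_top_rn hT hK r).integrable le_top) |>.mul_memLp_top
    (memLp_top_bval hΩ g _)) (Filter.Eventually.of_forall fun x => mul_comm _ _)

/-- `(f, w)` as a functional on triples. -/
def sourceFunctional (hT : IsMesh Ω T) (hΩ : IsConvexPolyhedralDomain Ω) (k : ℕ) (f : L2 Ω) :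
    Triple Ω T k →ₗ[ℝ] ℝ :=
  integralFunctional hT hΩ (fun _ x => sourceForm (f x)) (fun K => K) volume
    fun _ hK t => integrable_source hT hΩ f hK t.2.1.1

theorem sourceFunctional_apply (hT : IsMesh Ω T) (hΩ : IsConvexPolyhedralDomain Ω) (f : L2 Ω)
    (t : Triple Ω T k) :
    sourceFunctional hT hΩ k f t = volSum T (fun K x => f x * val K t.2.1.1 x) := rfl

/-- The boundary data as a functional on triples. -/
def dirichletFunctional (hT : IsMesh Ω T) (hΩ : IsConvexPolyhedralDomain Ω) (k : ℕ)
    (ha : IsAdmissible T c b τ) (h : ℝ) (g : C(frontier Ω, ℝ)) : Triple Ω T k →ₗ[ℝ] ℝ :=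
  integralFunctional hT hΩ
    (fun K x => dirichletForm (bval g x) (bn b K x - τ K x - h⁻¹) (normal K x))
    (fun K => frontier K ∩ frontier Ω) (surf d)
    fun _ hK t => integrable_dirichlet hT hΩ ha h g hK t.2.1.1 t.1.1

theorem dirichletFunctional_apply (hT : IsMesh Ω T) (hΩ : IsConvexPolyhedralDomain Ω)
    (ha : IsAdmissible T c b τ) (h : ℝ) (g : C(frontier Ω, ℝ)) (t : Triple Ω T k) :
    dirichletFunctional hT hΩ k ha h g t = extSum Ω T (fun K x =>
      bval g x * ((bn b K x - τ K x - h⁻¹) * val K t.2.1.1 x + rn t.1.1 K x)) := rfl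

/-- The state part of an element of the product space. -/
def stateTriple (Ω : Set (Sp d)) (T : Finset (Set (Sp d))) (k : ℕ) :
    Space Ω T k →ₗ[ℝ] Triple Ω T k where
  toFun s := (s.1, s.2.2.1, s.2.2.2.2.2.1)
  map_add' _ _ := rfl
  map_smul' _ _ := rfl

/-- The dual part of an element of the product space. -/
def dualTriple (Ω : Set (Sp d)) (T : Finset (Set (Sp d))) (k : ℕ) :
    Space Ω T k →ₗ[ℝ] Triple Ω T k where
  toFun s := (s.2.1, s.2.2.2.1, s.2.2.2.2.2.2)
  map_add' _ _ := rfl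
  map_smul' _ _ := rfl

/-- The control part of an element of the product space. -/
def control (Ω : Set (Sp d)) (T : Finset (Set (Sp d))) (k : ℕ) :
    Space Ω T k →ₗ[ℝ] Wh Ω T k where
  toFun s := s.2.2.2.2.1
  map_add' _ _ := rfl
  map_smul' _ _ := rfl

/-- The scalar part of a triple. -/
def scalar (Ω : Set (Sp d)) (T : Finset (Set (Sp d))) (k : ℕ) : Triple Ω T k →ₗ[ℝ] Wh Ω T k where
  toFun s := s.2.1
  map_add' _ _ := rfl
  map_smul' _ _ := rfl

/-- The linear map of the optimality system, for general state and dual forms. -/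
def systemMap (hT : IsMesh Ω T) (hΩ : IsConvexPolyhedralDomain Ω) (k : ℕ) (γ : ℝ)
    (G₁ G₂ : Triple Ω T k →ₗ[ℝ] Triple Ω T k →ₗ[ℝ] ℝ) : Space Ω T k →ₗ[ℝ]
      (Module.Dual ℝ (Triple Ω T k) × Module.Dual ℝ (Triple Ω T k) ×
        Module.Dual ℝ (Wh Ω T k)) :=
  LinearMap.prod
    (G₁ ∘ₗ stateTriple Ω T k -
      (elemInner hT hΩ k).compl₁₂ (control Ω T k) (scalar Ω T k))
    (LinearMap.prod
      (G₂ ∘ₗ dualTriple Ω T k -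
        (elemInner hT hΩ k).compl₁₂ (scalar Ω T k ∘ₗ stateTriple Ω T k) (scalar Ω T k))
      (elemInner hT hΩ k ∘ₗ scalar Ω T k ∘ₗ dualTriple Ω T k +
        γ • elemInner hT hΩ k ∘ₗ control Ω T k))

theorem systemMap_eq_iff (hT : IsMesh Ω T) (hΩ : IsConvexPolyhedralDomain Ω) {γ : ℝ}
    {G₁ G₂ : Triple Ω T k →ₗ[ℝ] Triple Ω T k →ₗ[ℝ] ℝ} {F₁ F₂ : Module.Dual ℝ (Triple Ω T k)}
    {F₃ : Module.Dual ℝ (Wh Ω T k)} (q p : Vh Ω T k) (y z u : Wh Ω T k) (μ ν : Mh T k) :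
    systemMap hT hΩ k γ G₁ G₂ (q, p, y, z, u, μ, ν) = (F₁, F₂, F₃) ↔
      (∀ r w ρ, G₁ (q, y, μ) (r, w, ρ) - elemInner hT hΩ k u w = F₁ (r, w, ρ)) ∧
      (∀ r w ρ, G₂ (p, z, ν) (r, w, ρ) - elemInner hT hΩ k y w = F₂ (r, w, ρ)) ∧
      ∀ w, elemInner hT hΩ k z w + γ * elemInner hT hΩ k u w = F₃ w := by
  rw [Prod.ext_iff, Prod.ext_iff]
  refine and_congr ?_ (and_congr ?_ ?_)
  · exact ⟨fun e r w ρ => DFunLike.congr_fun e (r, w, ρ),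
      fun e => LinearMap.ext fun t => e t.1 t.2.1 t.2.2⟩
  · exact ⟨fun e r w ρ => DFunLike.congr_fun e (r, w, ρ),
      fun e => LinearMap.ext fun t => e t.1 t.2.1 t.2.2⟩
  · exact ⟨fun e w => DFunLike.congr_fun e w, fun e => LinearMap.ext fun w => e w⟩

/-- Adjointness eliminates the scalars and the control; definiteness on triples without scalar part
is then enough for the fluxes and traces. -/
theorem systemMap_bijective (hT : IsMesh Ω T) (hΩ : IsConvexPolyhedralDomain Ω) {γ : ℝ}
    (hγ : 0 < γ) {G₁ G₂ : Triple Ω T k →ₗ[ℝ] Triple Ω T k →ₗ[ℝ] ℝ}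
    (hadj : ∀ (q p : Vh Ω T k) (y z : Wh Ω T k) (μ ν : Mh T k),
      G₁ (q, y, μ) (p, -z, -ν) + G₂ (p, z, ν) (-q, y, μ) = 0)
    (h₁ : ∀ (q : Vh Ω T k) (μ : Mh T k), G₁ (q, 0, μ) (q, 0, μ) = 0 → q = 0 ∧ μ = 0)
    (h₂ : ∀ (q : Vh Ω T k) (μ : Mh T k), G₂ (q, 0, μ) (q, 0, μ) = 0 → q = 0 ∧ μ = 0) :
    Function.Bijective (systemMap hT hΩ k γ G₁ G₂) := by
  have := finite_Vh hT hΩ k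
  have : Module.Finite ℝ (Wh Ω T k) := finite_brokenPoly hT hΩ (k + 1)
  have := finite_Mh T k
  have hinj : Function.Injective (systemMap hT hΩ k γ G₁ G₂) := by
    rw [injective_iff_map_eq_zero]
    rintro ⟨q, p, y, z, u, μ, ν⟩ hs
    obtain ⟨e₁, e₂, e₃⟩ := (systemMap_eq_iff (F₁ := 0) (F₂ := 0) (F₃ := 0) hT hΩ
      q p y z u μ ν).1 hs
    simp only [LinearMap.zero_apply] at e₁ e₂ e₃
    -- The tests are chosen to match the adjoint identity, and u in the third equation replaces -(u,
    -- z) by γ(u, u).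
    have hyu : elemInner hT hΩ k y y + γ * elemInner hT hΩ k u u = 0 := by
      have a₁ := e₁ p (-z) (-ν)
      have a₂ := e₂ (-q) y μ
      have a₃ := e₃ u
      rw [map_neg] at a₁
      rw [elemInner_comm hT hΩ z u] at a₃
      linarith [hadj q p y z μ ν]
    have hy := elemInner_self_nonneg hT hΩ y
    have hu := mul_nonneg hγ.le (elemInner_self_nonneg hT hΩ u)
    obtain rfl : y = 0 := eq_zero_of_elemInner_self_eq_zero hT hΩ (by linarith)
    obtain rfl : u = 0 := eq_zero_of_elemInner_self_eq_zero hT hΩ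
      ((mul_eq_zero.1 (by linarith : γ * elemInner hT hΩ k u u = 0)).resolve_left hγ.ne')
    obtain rfl : z = 0 := eq_zero_of_elemInner_self_eq_zero hT hΩ (by simpa using e₃ z)
    obtain ⟨rfl, rfl⟩ := h₁ q μ (by simpa using e₁ q 0 μ)
    obtain ⟨rfl, rfl⟩ := h₂ p ν (by simpa using e₂ p 0 ν)
    rfl
  -- Both sides have dimension 2 dim V_h + 3 dim W_h + 2 dim M̃_h(o), so injectivity gives
  -- surjectivity.
  refine ⟨hinj, (LinearMap.injective_iff_surjective_of_finrank_eq_finrank ?_).1 hinj⟩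
  simp only [Module.finrank_prod, Subspace.dual_finrank_eq]
  ring

/-- The contributions of u and y on the right-hand sides move to the left; the data f, g and y_d
alone form the target functional. -/
theorem isSolution_iff (hT : IsMesh Ω T) (hΩ : IsConvexPolyhedralDomain Ω) {h γ : ℝ}
    {β : Sp d → Sp d} {τ₁ τ₂ : Set (Sp d) → Sp d → ℝ}
    (ha₁ : IsAdmissible T (weakDiv Ω β) β τ₁) (ha₂ : IsAdmissible T 0 (-β) τ₂)
    (f yd : L2 Ω) (g : C(frontier Ω, ℝ)) (s : Space Ω T k) :
    IsSolution Ω T k h γ β τ₁ τ₂ f yd g s ↔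
      systemMap hT hΩ k γ (edgForm hT hΩ k ha₁ h) (edgForm hT hΩ k ha₂ h) s =
        (sourceFunctional hT hΩ k f - dirichletFunctional hT hΩ k ha₁ h g,
          -sourceFunctional hT hΩ k yd, 0) := by
  obtain ⟨q, p, y, z, u, μ, ν⟩ := s
  have E₁ : ∀ (r : Vh Ω T k) (w : Wh Ω T k) (ρ : Mh T k),
      (B1 Ω T h β τ₁ q y μ r w ρ = volSum T (fun K x => (f x + val K u.1 x) * val K w.1 x)
        - extSum Ω T (fun K x =>
            bval g x * ((bn β K x - τ₁ K x - h⁻¹) * val K w.1 x + rn r.1 K x))) ↔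
      edgForm hT hΩ k ha₁ h (q, y, μ) (r, w, ρ) - elemInner hT hΩ k u w =
        (sourceFunctional hT hΩ k f - dirichletFunctional hT hΩ k ha₁ h g) (r, w, ρ) := by
    intro r w ρ
    have hsum : volSum T (fun K x => (f x + val K u.1 x) * val K w.1 x) =
        volSum T (fun K x => f x * val K w.1 x) + elemInner hT hΩ k u w := by
      rw [elemInner_apply, volSum, volSum, volSum, ← Finset.sum_add_distrib]
      refine Finset.sum_congr rfl fun K hK => ?_
      rw [← integral_add (integrable_source hT hΩ f hK w.1) (integrable_val_val hT hK u.1 w.1)]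
      simp only [add_mul]
    have hB := B1_eq_edgForm hT hΩ ha₁ h ((q, y, μ) : Triple Ω T k) (r, w, ρ)
    rw [← hB, LinearMap.sub_apply, sourceFunctional_apply, dirichletFunctional_apply, hsum,
      sub_eq_iff_eq_add]
    refine Eq.congr_right ?_
    ring
  have E₂ : ∀ (r : Vh Ω T k) (w : Wh Ω T k) (ρ : Mh T k),
      (B2 Ω T h β τ₂ p z ν r w ρ =
        volSum T (fun K x => (val K y.1 x - yd x) * val K w.1 x)) ↔
      edgForm hT hΩ k ha₂ h (p, z, ν) (r, w, ρ) - elemInner hT hΩ k y w =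
        (-sourceFunctional hT hΩ k yd) (r, w, ρ) := by
    intro r w ρ
    have hsum : volSum T (fun K x => (val K y.1 x - yd x) * val K w.1 x) =
        elemInner hT hΩ k y w - volSum T (fun K x => yd x * val K w.1 x) := by
      rw [elemInner_apply, volSum, volSum, volSum, ← Finset.sum_sub_distrib]
      refine Finset.sum_congr rfl fun K hK => ?_
      rw [← integral_sub (integrable_val_val hT hK y.1 w.1) (integrable_source hT hΩ yd hK w.1)]
      simp only [sub_mul]
    have hB := B2_eq_edgForm hT hΩ ha₂ h ((p, z, ν) : Triple Ω T k) (r, w, ρ)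
    rw [← hB, LinearMap.neg_apply, sourceFunctional_apply, hsum, sub_eq_iff_eq_add]
    refine Eq.congr_right ?_
    ring
  have E₃ : ∀ w : Wh Ω T k,
      (volSum T (fun K x => (val K z.1 x + γ * val K u.1 x) * val K w.1 x) = 0) ↔
      elemInner hT hΩ k z w + γ * elemInner hT hΩ k u w = (0 : Module.Dual ℝ (Wh Ω T k)) w := by
    intro w
    rw [elemInner_apply, elemInner_apply, volSum, volSum, volSum, Finset.mul_sum,
      ← Finset.sum_add_distrib]
    refine Eq.congr_left (Finset.sum_congr rfl fun K hK => ?_)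
    rw [← integral_const_mul, ← integral_add (integrable_val_val hT hK z.1 w.1)
      ((integrable_val_val hT hK u.1 w.1).const_mul γ)]
    simp only [add_mul, mul_assoc]
  rw [systemMap_eq_iff]
  simp only [← E₁, ← E₂, ← E₃]
  -- Each equation involves only its own test functions, so the others may be set to zero.
  exact ⟨fun H => ⟨fun r w ρ => (H r 0 w 0 0 ρ 0).1, fun r w ρ => (H 0 r 0 w 0 0 ρ).2.1,
    fun w => (H 0 0 0 0 w 0 0).2.2⟩,
    fun H r₁ r₂ w₁ w₂ w₃ μ₁ μ₂ => ⟨H.1 r₁ w₁ μ₁, H.2.1 r₂ w₂ μ₂, H.2.2 w₃⟩⟩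

end System

end EDG

end

theorem proposition3p3 {d : ℕ} (hd : 2 ≤ d)
    (Ω : Set (EDG.Sp d)) (hΩ : EDG.IsConvexPolyhedralDomain Ω)
    (T : Finset (Set (EDG.Sp d))) (hT : EDG.IsMesh Ω T)
    (k : ℕ) (h : ℝ) (hh : 0 < h) (γ : ℝ) (hγ : 0 < γ)
    -- the continuous representative of a vector field in `[W^{1,∞}(Ω)]ᵈ` with `∇·β ≤ 0`
    (β : EDG.Sp d → EDG.Sp d) (hβc : ContinuousOn β (closure Ω))
    (hβ : ∀ i, EDG.MemW1Inf Ω (fun x => β x i))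
    (hβdiv : ∀ᵐ x ∂(volume.restrict Ω), EDG.weakDiv Ω β x ≤ 0)
    -- stabilization functions on the element boundaries
    (τ₁ τ₂ : Set (EDG.Sp d) → EDG.Sp d → ℝ)
    (hτ : ∀ K ∈ T, IntegrableOn (τ₁ K) (frontier K) (EDG.surf d))
    (hA1 : ∀ K ∈ T, ∀ᵐ x ∂((EDG.surf d).restrict (frontier K)),
      τ₂ K x = τ₁ K x - EDG.bn β K x)
    (hA2 : ∀ K ∈ T, ∃ c > 0, ∀ᵐ x ∂((EDG.surf d).restrict (frontier K)),
      c ≤ τ₁ K x - 1 / 2 * EDG.bn β K x)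
    (f yd : EDG.L2 Ω) (g : C(frontier Ω, ℝ))
    -- any interpolation operator with continuous values
    (Ih : C(frontier Ω, ℝ) → C(frontier Ω, ℝ)) :
    ∃! s : EDG.Space Ω T k, EDG.IsSolution Ω T k h γ β τ₁ τ₂ f yd (Ih g) s := by
  have hK : ∀ K ∈ T, ContinuousOn β K := fun K hK => hβc.mono (hT.subset_closure hK)
  have ha₁ : EDG.IsAdmissible T (EDG.weakDiv Ω β) β τ₁ :=
    ⟨fun K hK => EDG.integrableOn_weakDiv hT hΩ hK hβ, hK, hτ⟩
  -- Integrability of τ₂ is inherited from τ₁ through (A1), β·n being bounded.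
  have ha₂ : EDG.IsAdmissible T 0 (-β) τ₂ := by
    refine ⟨fun K _ => integrable_zero _ _ _, fun K h => (hK K h).neg, fun K h => ?_⟩
    have := hT.isFiniteMeasure h
    exact ((hτ K h).sub ((EDG.memLp_top_bn hT ha₁ h).integrable le_top)).congr
      ((hA1 K h).mono fun x hx => hx.symm)
  have hbn : ∀ K x, EDG.bn (-β) K x = -EDG.bn β K x := fun K x => by simp [EDG.bn]
  have hpos₁ : ∀ K ∈ T, ∀ᵐ x ∂((EDG.surf d).restrict (frontier K)),
      0 ≤ τ₁ K x - 1 / 2 * EDG.bn β K x := fun K h => by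
    obtain ⟨c, hc, hA⟩ := hA2 K h
    exact hA.mono fun x hx => hc.le.trans hx
  -- By (A1), τ₂ + ½ β·n = τ₁ - ½ β·n, so (A2) controls the dual form as well.
  have hpos₂ : ∀ K ∈ T, ∀ᵐ x ∂((EDG.surf d).restrict (frontier K)),
      0 ≤ τ₂ K x - 1 / 2 * EDG.bn (-β) K x := fun K h => by
    filter_upwards [hpos₁ K h, hA1 K h] with x hx hx'
    rw [hbn, hx']
    linarith
  have hbij := EDG.systemMap_bijective (k := k) hT hΩ hγ
    (EDG.edgForm_add_edgForm_eq_zero hT hΩ hβc hβ ha₁ ha₂ hA1 h)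
    (EDG.eq_zero_of_edgForm_self_eq_zero hT hΩ ha₁ hh hpos₁)
    (EDG.eq_zero_of_edgForm_self_eq_zero hT hΩ ha₂ hh hpos₂)
  simp only [EDG.isSolution_iff hT hΩ ha₁ ha₂]
  exact hbij.existsUnique _
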